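/- **Setting.** Let $\mathbb K$ be an evenly graded commutative ring containing $\mathbb Q$ and let $V$ be a free graded $\mathbb K$-module. For a graded module $M$ write $\Sigma M$ for its suspension, $(\Sigma M)^n=M^{n+1}$. Put $W:=\Sigma V^*$, a topological (profinite) graded module, let $\widehat{T}W=\prod_{n\ge 0}W^{\hat\otimes n}$ be the completed tensor algebra and $\widehat{L}W\subset\widehat{T}W$ the completed free Lie algebra on $W$ (the closed $\mathbb K$-submodule spanned by iterated graded commutators of elements of $W$). A *$C_\infty$-structure* on $V$ is a continuous derivation $m$ of $\widehat{L}W$ of degree $1$ with $m^2=0$; it extends uniquely to a continuous derivation $m$ of the algebra $\widehat{T}W$, that is, to an $A_\infty$-structure on $V$. Let $P:=\prod_{i\ge1}W^{\hat\otimes i}$. *Differentials.* Let $b'\colon P\to P$ be the restriction of $m$ to $P$. Let $\Omega^\bullet(\widehat{T}W)$ be the noncommutative de Rham algebra, $DR^0=\widehat{T}W/[\widehat{T}W,\widehat{T}W]$ and $DR^1=\Omega^1/[\widehat{T}W,\Omega^1]$ (quotients by the closed submodules spanned by graded commutators), and let $L_m$ be the Lie derivative, i.e. the continuous derivation of degree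 $1$ with $L_m(x)=m(x)$ and $L_m(dx)=-d(m(x))$ for $x\in\widehat{T}W$. The map $\Theta\colon P=W\hat\otimes\widehat{T}W\to DR^1$, $x\otimes y\mapsto dx\cdot y$, is an isomorphism, and $b:=\Theta^{-1}L_m\Theta\colon P\to P$. *Cyclic operators.* On $W^{\hat\otimes n}$, $n\ge1$, let $z(x_1\otimes\dots\otimes x_n)=(-1)^{|x_1|(|x_2|+\dots+|x_n|)}x_2\otimes\dots\otimes x_n\otimes x_1$, let $Z_n$ be the cyclic group of order $n$ acting through $z$, and let $N=1+z+\dots+z^{n-1}$; $z$ and $N$ extend to $P$. *Hodge operators.* Let $\Delta\colon\widehat{T}W\to\widehat{T}W\hat\otimes\widehat{T}W$ be the continuous algebra homomorphism with $\Delta(w)=w\otimes1+1\otimes w$ for $w\in W$, let $\mu$ be the multiplication of $\widehat{T}W$, $s:=\mu\Delta$, and let $s_n$ be the restriction of $s$ to $W^{\hat\otimes n}$. With $\lambda_r=2^r$ put $$e_n(j)=\prod_{0\le r\le n,\ r\ne j}\frac{s_n-\lambda_r}{\lambda_j-\lambda_r}\quad(0\le j\le n),\qquad e_n(j)=0\quad(j>n),$$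 let $e(j)\colon\widehat{T}W\to\widehat{T}W$ be the operator equal to $e_n(j)$ on $W^{\hat\otimes n}$ for every $n$, and let $\tilde e(j):=1\hat\otimes e(j)$ on $P=W\hat\otimes\widehat{T}W$. *Complexes.* The cyclic Hochschild complex $CC^\bullet(V)$ is the suspension $\Sigma$ of the module of $0$-forms in $DR^0$ vanishing at zero (the image of $P$), with the differential induced by $b'$. The Tsygan bicomplex has columns numbered $0,1,2,\dots$, all equal to $\Sigma P$; the vertical differential is $b$ on even and $b'$ on odd columns, and the horizontal differential is $1-z$ out of even and $N$ out of odd columns: $$(\Sigma P,b)\xrightarrow{1-z}(\Sigma P,b')\xrightarrow{N}(\Sigma P,b)\xrightarrow{1-z}(\Sigma P,b')\xrightarrow{N}\cdots$$ (the squares anticommute). **Theorem.** Let $V$ be a $C_\infty$-algebra. (i) The $0$-forms vanishing at zero are the cyclic coinvariants $\prod_{i\ge1}(W^{\hat\otimes i})_{Z_i}=P/(1-z)P$. The differential $b'$ and the operators $e(j)$, $j\ge1$, descend to this module; with the induced $b'$, $CC^\bullet(V)$ is a complex, each $\Sigma\bigl(e(j)\bigl[\prod_{i\ge1}(W^{\hat\otimes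 i})_{Z_i}\bigr]\bigr)$, $j\ge1$, is a subcomplex, and $CC^\bullet(V)$ is the direct product of these subcomplexes: $$CC^\bullet(V)=\prod_{j=1}^\infty\Bigl(\Sigma\Bigl(e(j)\Bigl[\prod_{i=1}^\infty (W^{\hat\otimes i})_{Z_i}\Bigr]\Bigr),\,b'\Bigr).$$ (ii) Let $Q_j=\Sigma(e(j)[P])$ and $\widetilde Q_j=\Sigma(\tilde e(j)[P])$. The Tsygan bicomplex is a bicomplex; for every $j\ge0$ the strip occupying columns $0,\dots,2j$, $$\Gamma_j:=\ (\widetilde Q_j,b)\xrightarrow{1-z}(Q_j,b')\xrightarrow{N}(\widetilde Q_{j-1},b)\xrightarrow{1-z}(Q_{j-1},b')\xrightarrow{N}\cdots\xrightarrow{1-z}(Q_1,b')\xrightarrow{N}(\widetilde Q_0,b),$$ is a sub-bicomplex of it; and the Tsygan bicomplex is the direct product $\prod_{j=0}^\infty\Gamma_j$. Here direct products are direct products of topological modules, taken in each degree, respectively bidegree. -/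

import Mathlib

open Polynomial Topology

noncomputable section

namespace HodgeCyclic

/-! ### Profinite modules given by a topological basis -/

/-- The profinite (topologically free) `K`-module with topological basis `X`: its elements are the
arbitrary, possibly infinite, linear combinations `∑ x, f x • x`.  It carries the product topology,
each copy of `K` being discrete. -/
def Formal (X K : Type*) : Type _ := X → K

instance {X K : Type*} [AddCommGroup K] : AddCommGroup (Formal X K) :=
  inferInstanceAs (AddCommGroup (X → K))

instance {X K : Type*} [CommRing K] : Module K (Formal X K) :=
  inferInstanceAs (Module K (X → K))

instance {X K : Type*} : TopologicalSpace (Formal X K) :=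
  @Pi.topologicalSpace X (fun _ => K) (fun _ => ⊥)

@[ext] theorem Formal.ext {X K : Type*} {f g : Formal X K} (h : ∀ x, f x = g x) : f = g := funext h

@[simp] theorem Formal.add_apply {X K : Type*} [CommRing K] (f g : Formal X K) (x : X) :
    (f + g) x = f x + g x := rfl

@[simp] theorem Formal.sub_apply {X K : Type*} [CommRing K] (f g : Formal X K) (x : X) :
    (f - g) x = f x - g x := rfl

@[simp] theorem Formal.neg_apply {X K : Type*} [CommRing K] (f : Formal X K) (x : X) :
    (-f) x = -f x := rfl

@[simp] theorem Formal.zero_apply {X K : Type*} [CommRing K] (x : X) :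
    (0 : Formal X K) x = 0 := rfl

@[simp] theorem Formal.smul_apply {X K : Type*} [CommRing K] (c : K) (f : Formal X K) (x : X) :
    (c • f) x = c * f x := rfl

/-- The linear map with coefficients `φ f y`. -/
def Formal.lin {X Y K : Type*} [CommRing K] (φ : Formal X K → Y → K)
    (hadd : ∀ f g y, φ (f + g) y = φ f y + φ g y) (hsmul : ∀ c f y, φ (c • f) y = c * φ f y) :
    Formal X K →ₗ[K] Formal Y K where
  toFun f := φ f
  map_add' f g := funext (hadd f g)
  map_smul' c f := funext (hsmul c f)

/-- The linear map `f ↦ ∑ y, f (σ y) • y`. -/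
def Formal.reindex {X Y K : Type*} [CommRing K] (σ : Y → X) : Formal X K →ₗ[K] Formal Y K :=
  Formal.lin (fun f y => f (σ y)) (fun _ _ _ => rfl) (fun _ _ _ => rfl)

/-- A map all of whose coefficients depend on finitely many coefficients is continuous. -/
theorem Formal.continuous_of_finite {X Y K : Type*} (φ : Formal X K → Formal Y K)
    (h : ∀ y, ∃ F : Finset X, ∀ f g : Formal X K, (∀ x ∈ F, f x = g x) → φ f y = φ g y) :
    Continuous φ := by
  let _ : TopologicalSpace K := ⊥
  have _ : DiscreteTopology K := ⟨rfl⟩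
  refine continuous_pi (A := fun _ : Y => K) fun y => ?_
  obtain ⟨F, hF⟩ := h y
  refine (IsLocallyConstant.iff_eventually_eq _ |>.2 fun f => ?_).continuous
  have : ∀ x ∈ F, ∀ᶠ g : Formal X K in 𝓝 f, g x = f x := fun x _ => by
    have hc : Continuous fun g : Formal X K => (g x : K) := continuous_apply (A := fun _ : X => K) x
    exact hc.continuousAt.eventually_mem (s := {f x}) (by simp [nhds_discrete])
  filter_upwards [(Filter.eventually_all_finset F).2 this] with g hg
  exact hF _ _ hg

instance {X K : Type*} [CommRing K] : IsTopologicalAddGroup (Formal X K) := by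
  let _ : TopologicalSpace K := ⊥
  have _ : DiscreteTopology K := ⟨rfl⟩
  exact inferInstanceAs (IsTopologicalAddGroup (X → K))

instance {X K : Type*} : T2Space (Formal X K) := by
  let _ : TopologicalSpace K := ⊥
  have _ : DiscreteTopology K := ⟨rfl⟩
  exact inferInstanceAs (T2Space (X → K))

instance {X K : Type*} [CommRing K] : ContinuousConstSMul K (Formal X K) :=
  ⟨fun c => Formal.continuous_of_finite _ fun x => ⟨{x}, fun f g h => by simp [h x]⟩⟩

/-! ### The completed tensor algebra `T̂W`

`W` is the profinite graded module with topological basis `t i`, `i : I`, where `t i` has degree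
`τ i`.  The completed tensor algebra of `W` is `K⟨⟨t⟩⟩`, with topological basis the words in `I`. -/

/-- The completed tensor algebra `T̂W = K⟨⟨t⟩⟩`. -/
abbrev PowSer (I K : Type*) : Type _ := Formal (List I) K

/-- The sign `(-1)^p`. -/
def sgn (K : Type*) [CommRing K] (p : ℤ) : K := (((Int.negOnePow p : ℤˣ) : ℤ) : K)

/-- The degree of the monomial given by a word. -/
def wdeg {I : Type*} (τ : I → ℤ) (w : List I) : ℤ := (w.map τ).sum

/-- The ideal of power series vanishing at zero, i.e. `∏_{n ≥ 1} W^{⊗n}`. -/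
def pos (I K : Type*) [CommRing K] : Submodule K (PowSer I K) where
  carrier := {f | f [] = 0}
  add_mem' {f g} hf hg := by simp_all
  zero_mem' := rfl
  smul_mem' c f hf := by simp_all

/-- The elements of `T̂W` of degree `n`; the ground ring is graded by `𝒜`. -/
def homog {I K : Type*} [CommRing K] (𝒜 : ℤ → AddSubgroup K) (τ : I → ℤ) (n : ℤ) :
    AddSubgroup (PowSer I K) where
  carrier := {f | ∀ w, f w ∈ 𝒜 (n - wdeg τ w)}
  add_mem' hf hg w := add_mem (hf w) (hg w)
  zero_mem' _ := zero_mem _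
  neg_mem' hf w := neg_mem (hf w)

/-- The inclusion `W → T̂W`. -/
def letter {I K : Type*} [CommRing K] : Formal I K →ₗ[K] PowSer I K :=
  Formal.lin
    (fun g w => match w with
      | [i] => g i
      | _ => 0)
    (fun _ _ w => match w with
      | [] => (add_zero 0).symm
      | [_] => rfl
      | _ :: _ :: _ => (add_zero 0).symm)
    (fun c _ w => match w with
      | [] => (mul_zero c).symm
      | [_] => rfl
      | _ :: _ :: _ => (mul_zero c).symm)

/-- The multiplication `μ : T̂W ⊗̂ T̂W → T̂W`.  An element `h` of `T̂W ⊗̂ T̂W` is given by the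
coefficients `h (a, b)` of `a ⊗ b`. -/
def mulMap (I K : Type*) [CommRing K] : Formal (List I × List I) K →ₗ[K] PowSer I K :=
  Formal.lin (fun h u => ∑ k ∈ Finset.range (u.length + 1), h (u.take k, u.drop k))
    (by simp [Finset.sum_add_distrib]) (by simp [Finset.mul_sum])

/-- The graded commutator `[f, g] = f g - (-1)^{|f||g|} g f`, extended bilinearly. -/
def comm {I K : Type*} [CommRing K] (τ : I → ℤ) (f g : PowSer I K) : PowSer I K := fun u =>
  ∑ k ∈ Finset.range (u.length + 1),
    (f (u.take k) * g (u.drop k)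
      - sgn K (wdeg τ (u.take k) * wdeg τ (u.drop k)) * (g (u.take k) * f (u.drop k)))

/-- The coefficient of `a ⊗ b` in `Δ f`, computed from the rules that `Δ` is an algebra homomorphism
and `Δ (t i) = t i ⊗ 1 + 1 ⊗ t i`, so that `Δ (t i * g) = (t i ⊗ 1 + 1 ⊗ t i) * Δ g`. -/
def coprodCoeff {I K : Type*} [CommRing K] (τ : I → ℤ) :
    (List I → K) → List I → List I → K
  | f, [], b => f b
  | f, i :: a, [] => f (i :: a)
  | f, i :: a, j :: b =>
      coprodCoeff τ (fun w => f (i :: w)) a (j :: b)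
        + sgn K (τ j * wdeg τ (i :: a)) * coprodCoeff τ (fun w => f (j :: w)) (i :: a) b
  termination_by _ a b => a.length + b.length

theorem coprodCoeff_add {I K : Type*} [CommRing K] (τ : I → ℤ) (f g : List I → K)
    (a b : List I) :
    coprodCoeff τ (fun w => f w + g w) a b = coprodCoeff τ f a b + coprodCoeff τ g a b := by
  induction f, a, b using coprodCoeff.induct generalizing g with
  | case1 f b => simp [coprodCoeff]
  | case2 f i a => simp [coprodCoeff]
  | case3 f i a j b h1 h2 => simp only [coprodCoeff]; rw [h1, h2]; ring

theorem coprodCoeff_smul {I K : Type*} [CommRing K] (τ : I → ℤ) (c : K) (f : List I → K)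
    (a b : List I) :
    coprodCoeff τ (fun w => c * f w) a b = c * coprodCoeff τ f a b := by
  induction f, a, b using coprodCoeff.induct with
  | case1 f b => simp [coprodCoeff]
  | case2 f i a => simp [coprodCoeff]
  | case3 f i a j b h1 h2 => simp only [coprodCoeff]; rw [h1, h2]; ring

/-- The cocommutative (shuffle) coproduct `Δ : T̂W → T̂W ⊗̂ T̂W`. -/
def coprod {I : Type*} (K : Type*) [CommRing K] (τ : I → ℤ) :
    PowSer I K →ₗ[K] Formal (List I × List I) K :=
  Formal.lin (fun f p => coprodCoeff τ f p.1 p.2)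
    (fun f g p => coprodCoeff_add τ f g p.1 p.2) (fun c f p => coprodCoeff_smul τ c f p.1 p.2)

/-- The modified shuffle operator `s = μ Δ`. -/
def shuffleOp {I : Type*} (K : Type*) [CommRing K] (τ : I → ℤ) : Module.End K (PowSer I K) :=
  mulMap I K ∘ₗ coprod K τ

/-- The polynomial `∏_{r ≠ j} (X - λ_r) / ∏_{r ≠ j} (λ_j - λ_r)`, where `0 ≤ r ≤ n` and
`λ_r = 2^r`; it is `0` for `j > n`. -/
def lagrangePoly (n j : ℕ) : ℚ[X] :=
  if j ≤ n then Lagrange.basis (Finset.range (n + 1)) (fun r => (2 : ℚ) ^ r) j else 0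

/-- The operator `e(j)` on `T̂W`.  On `W^{⊗n}` it is the Lagrange interpolation polynomial
`e_n(j)` of the restriction `s_n` of `s` to `W^{⊗n}`. -/
def hodgeProj {I K : Type*} [CommRing K] [Algebra ℚ K] (τ : I → ℤ) (j : ℕ) :
    Module.End K (PowSer I K) :=
  Formal.lin
    (fun f u => aeval (shuffleOp K τ) ((lagrangePoly u.length j).map (algebraMap ℚ K)) f u)
    (by simp) (by simp)

/-- The operator `1 ⊗̂ φ` on `W ⊗̂ T̂W = ∏_{n ≥ 1} W^{⊗n}`, extended by `0` to constants. -/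
def oneTensor {I K : Type*} [CommRing K] (φ : Module.End K (PowSer I K)) :
    Module.End K (PowSer I K) :=
  Formal.lin
    (fun f w => match w with
      | [] => 0
      | i :: w => φ (Formal.reindex (i :: ·) f) w)
    (fun f g w => match w with
      | [] => (add_zero 0).symm
      | i :: w => by simp)
    (fun c f w => match w with
      | [] => (mul_zero c).symm
      | i :: w => by simp)

/-- The operator `ẽ(j) = 1 ⊗̂ e(j)`. -/
def hodgeProjTilde {I K : Type*} [CommRing K] [Algebra ℚ K] (τ : I → ℤ) (j : ℕ) :
    Module.End K (PowSer I K) :=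
  oneTensor (hodgeProj τ j)

/-- The cyclic operator: `z (x₁ ⊗ ⋯ ⊗ xₙ) = (-1)^{|x₁|(|x₂|+⋯+|xₙ|)} x₂ ⊗ ⋯ ⊗ xₙ ⊗ x₁`. -/
def cyc {I : Type*} (K : Type*) [CommRing K] (τ : I → ℤ) : Module.End K (PowSer I K) :=
  Formal.lin
    (fun f u => if h : u = [] then f []
      else sgn K (τ (u.getLast h) * wdeg τ u.dropLast) * f (u.getLast h :: u.dropLast))
    (fun f g u => by by_cases h : u = [] <;> simp [h, mul_add])
    (fun c f u => by by_cases h : u = [] <;> simp [h, mul_left_comm])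

/-- The norm operator: `1 + z + ⋯ + z^{n-1}` on `W^{⊗n}`. -/
def normOp {I : Type*} (K : Type*) [CommRing K] (τ : I → ℤ) : Module.End K (PowSer I K) :=
  Formal.lin (fun f u => ∑ k ∈ Finset.range u.length, (cyc K τ ^ k) f u)
    (by simp [Finset.sum_add_distrib]) (by simp [Finset.mul_sum])

/-- `[T̂W, T̂W]`: all convergent linear combinations of commutators. -/
def commutators {I : Type*} (K : Type*) [CommRing K] (τ : I → ℤ) : Submodule K (PowSer I K) :=
  (Submodule.span K (Set.range fun p : PowSer I K × PowSer I K => comm τ p.1 p.2)).topologicalClosure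

/-- The 0-forms `DR⁰(T̂W) = T̂W / [T̂W, T̂W]`. -/
abbrev ZeroForms {I : Type*} (K : Type*) [CommRing K] (τ : I → ℤ) : Type _ :=
  PowSer I K ⧸ commutators K τ

/-! ### The completed free Lie algebra `L̂W` -/

/-- Lie monomials in elements of `W`. -/
inductive IsLieMonomial {I K : Type*} [CommRing K] (τ : I → ℤ) : PowSer I K → Prop
  | letter (g : Formal I K) : IsLieMonomial τ (letter g)
  | comm {x y : PowSer I K} (hx : IsLieMonomial τ x) (hy : IsLieMonomial τ y) :
      IsLieMonomial τ (comm τ x y)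

/-- `L̂W ⊆ T̂W`: all convergent linear combinations of Lie monomials. -/
def lieAlg {I : Type*} (K : Type*) [CommRing K] (τ : I → ℤ) : Submodule K (PowSer I K) :=
  (Submodule.span K {x | IsLieMonomial τ x}).topologicalClosure

theorem letter_mem_lieAlg {I K : Type*} [CommRing K] (τ : I → ℤ) (g : Formal I K) :
    letter g ∈ lieAlg K τ :=
  Submodule.le_topologicalClosure _ (Submodule.subset_span (.letter g))

theorem comm_add_left {I K : Type*} [CommRing K] (τ : I → ℤ) (f f' g : PowSer I K) :
    comm τ (f + f') g = comm τ f g + comm τ f' g := by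
  ext u
  simp only [comm, Formal.add_apply, ← Finset.sum_add_distrib]
  exact Finset.sum_congr rfl fun _ _ => by ring

theorem comm_smul_left {I K : Type*} [CommRing K] (τ : I → ℤ) (c : K) (f g : PowSer I K) :
    comm τ (c • f) g = c • comm τ f g := by
  ext u
  simp only [comm, Formal.smul_apply, Finset.mul_sum]
  exact Finset.sum_congr rfl fun _ _ => by ring

theorem comm_add_right {I K : Type*} [CommRing K] (τ : I → ℤ) (f g g' : PowSer I K) :
    comm τ f (g + g') = comm τ f g + comm τ f g' := by
  ext u
  simp only [comm, Formal.add_apply, ← Finset.sum_add_distrib]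
  exact Finset.sum_congr rfl fun _ _ => by ring

theorem comm_smul_right {I K : Type*} [CommRing K] (τ : I → ℤ) (c : K) (f g : PowSer I K) :
    comm τ f (c • g) = c • comm τ f g := by
  ext u
  simp only [comm, Formal.smul_apply, Finset.mul_sum]
  exact Finset.sum_congr rfl fun _ _ => by ring

theorem continuous_comm_left {I K : Type*} [CommRing K] (τ : I → ℤ) (g : PowSer I K) :
    Continuous fun f => comm τ f g := by
  classical
  refine Formal.continuous_of_finite _ fun u =>
    ⟨(Finset.range (u.length + 1)).image u.take ∪ (Finset.range (u.length + 1)).image u.drop,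
      fun f f' h => Finset.sum_congr rfl fun k hk => ?_⟩
  rw [h _ (Finset.mem_union_left _ (Finset.mem_image_of_mem _ hk)),
    h _ (Finset.mem_union_right _ (Finset.mem_image_of_mem _ hk))]

theorem continuous_comm_right {I K : Type*} [CommRing K] (τ : I → ℤ) (f : PowSer I K) :
    Continuous fun g => comm τ f g := by
  classical
  refine Formal.continuous_of_finite _ fun u =>
    ⟨(Finset.range (u.length + 1)).image u.take ∪ (Finset.range (u.length + 1)).image u.drop,
      fun f f' h => Finset.sum_congr rfl fun k hk => ?_⟩
  rw [h _ (Finset.mem_union_left _ (Finset.mem_image_of_mem _ hk)),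
    h _ (Finset.mem_union_right _ (Finset.mem_image_of_mem _ hk))]

theorem comm_mem_lieAlg {I K : Type*} [CommRing K] (τ : I → ℤ) {x y : PowSer I K}
    (hx : x ∈ lieAlg K τ) (hy : y ∈ lieAlg K τ) : comm τ x y ∈ lieAlg K τ := by
  let S : Submodule K (PowSer I K) := Submodule.span K {x | IsLieMonomial τ x}
  have h1 : ∀ x ∈ S, ∀ y ∈ S, comm τ x y ∈ S := fun x hx y hy => by
    induction hx, hy using Submodule.span_induction₂ with
    | mem_mem x y hx hy => exact Submodule.subset_span (.comm hx hy)
    | zero_left y _ =>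
      have := comm_smul_left τ 0 0 y
      rw [zero_smul, zero_smul] at this
      rw [this]; exact zero_mem _
    | zero_right x _ =>
      have := comm_smul_right τ 0 x 0
      rw [zero_smul, zero_smul] at this
      rw [this]; exact zero_mem _
    | add_left x y z _ _ _ h h' => rw [comm_add_left]; exact add_mem h h'
    | add_right x y z _ _ _ h h' => rw [comm_add_right]; exact add_mem h h'
    | smul_left r x y _ _ h => rw [comm_smul_left]; exact S.smul_mem r h
    | smul_right r x y _ _ h => rw [comm_smul_right]; exact S.smul_mem r h
  have h2 : ∀ x ∈ S, ∀ y ∈ closure (S : Set (PowSer I K)), comm τ x y ∈ closure (S : Set _) :=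
    fun x hx y hy => map_mem_closure (continuous_comm_right τ x) hy fun y hy => h1 x hx y hy
  have h3 : comm τ x y ∈ closure (closure (S : Set (PowSer I K))) :=
    map_mem_closure (f := fun x => comm τ x y) (continuous_comm_left τ y) hx
      fun x hx => h2 x hx y hy
  rwa [closure_closure] at h3

/-! ### `C∞`-algebras -/

/-- The degree of the element `t i` of the topological basis of `ΣV*` dual to the basis `Σ (x i)` of
`ΣV`, where `x i` has degree `d i` and `Σ V^n = V^{n+1}`. -/
def dualDeg {I : Type*} (d : I → ℤ) (i : I) : ℤ := 1 - d i

/-- A `C∞`-structure on the free graded `K`-module `V` with homogeneous basis `x i` of degree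
`d i`: a continuous derivation `m` of `L̂(ΣV*)` of degree one with `m² = 0`. -/
structure CInftyStructure {I K : Type*} [CommRing K] (𝒜 : ℤ → AddSubgroup K) (d : I → ℤ) where
  /-- The vector field. -/
  m : lieAlg K (dualDeg d) →ₗ[K] lieAlg K (dualDeg d)
  continuous_m : Continuous m
  degree_one : ∀ (n : ℤ) (x : lieAlg K (dualDeg d)),
    (x : PowSer I K) ∈ homog 𝒜 (dualDeg d) n → (m x : PowSer I K) ∈ homog 𝒜 (dualDeg d) (n + 1)
  leibniz : ∀ (n : ℤ) (x y : lieAlg K (dualDeg d)),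
    (x : PowSer I K) ∈ homog 𝒜 (dualDeg d) n →
      (m ⟨comm (dualDeg d) x y, comm_mem_lieAlg _ x.2 y.2⟩ : PowSer I K)
        = comm (dualDeg d) (m x) y + sgn K n • comm (dualDeg d) x (m y)
  square_zero : ∀ x, m (m x) = 0

/-- The restriction of a vector field to `W`, as a map `W → T̂W`. -/
def CInftyStructure.onLetters {I K : Type*} [CommRing K] {𝒜 : ℤ → AddSubgroup K} {d : I → ℤ}
    (m : CInftyStructure 𝒜 d) : Formal I K →ₗ[K] PowSer I K :=
  (lieAlg K (dualDeg d)).subtype ∘ₗ m.m ∘ₗ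
    (letter (I := I) (K := K)).codRestrict _ (letter_mem_lieAlg (dualDeg d))

/-- The derivation of `T̂W` of degree one whose restriction to `W` is `ξ`:
`x₁ ⊗ ⋯ ⊗ xₙ ↦ ∑_k (-1)^{|x₁|+⋯+|x_{k-1}|} x₁ ⊗ ⋯ ⊗ ξ(x_k) ⊗ ⋯ ⊗ xₙ`.
In the coefficient of a word `u`, all decompositions `u = a ++ c ++ b` contribute the coefficient
of `c` in `ξ (∑ i, f (a ++ i :: b) • t i)`. -/
def derExt {I K : Type*} [CommRing K] (τ : I → ℤ) (ξ : Formal I K →ₗ[K] PowSer I K) :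
    Module.End K (PowSer I K) :=
  Formal.lin
    (fun f u =>
      ∑ k ∈ Finset.range (u.length + 1), ∑ l ∈ Finset.range ((u.drop k).length + 1),
        sgn K (wdeg τ (u.take k)) *
          ξ (Formal.reindex (fun i => u.take k ++ i :: (u.drop k).drop l) f) ((u.drop k).take l))
    (by simp [Finset.sum_add_distrib, mul_add])
    (by simp [Finset.mul_sum, mul_left_comm])

/-- The `A∞`-structure `T̂(ΣV*) → T̂(ΣV*)` extending a `C∞`-structure. -/
def CInftyStructure.ext {I K : Type*} [CommRing K] {𝒜 : ℤ → AddSubgroup K} {d : I → ℤ}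
    (m : CInftyStructure 𝒜 d) : Module.End K (PowSer I K) :=
  derExt (dualDeg d) m.onLetters

/-! ### Noncommutative 1-forms and the Hochschild differential `b` -/

/-- The noncommutative 1-forms `Ω¹(T̂W)`, with topological basis the forms `a · dt i · c`, `a` and
`c` words; the form `dt i` has degree `τ i + 1`. -/
abbrev OneForms (I K : Type*) : Type _ := Formal (List I × I × List I) K

/-- The graded commutator of a 0-form and a 1-form. -/
def commForm {I K : Type*} [CommRing K] (τ : I → ℤ) (g : PowSer I K) (ω : OneForms I K) :
    OneForms I K := fun p =>
  (∑ k ∈ Finset.range (p.1.length + 1), g (p.1.take k) * ω (p.1.drop k, p.2.1, p.2.2))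
    - ∑ l ∈ Finset.range (p.2.2.length + 1),
        sgn K (wdeg τ (p.2.2.drop l) * (wdeg τ p.1 + (τ p.2.1 + 1) + wdeg τ (p.2.2.take l))) *
          (ω (p.1, p.2.1, p.2.2.take l) * g (p.2.2.drop l))

/-- All convergent linear combinations of commutators in `Ω¹(T̂W)`. -/
def formCommutators {I : Type*} (K : Type*) [CommRing K] (τ : I → ℤ) :
    Submodule K (OneForms I K) :=
  (Submodule.span K
    (Set.range fun p : PowSer I K × OneForms I K => commForm τ p.1 p.2)).topologicalClosure

/-- The 1-forms `DR¹(T̂W)` of the de Rham complex. -/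
abbrev DR1 {I : Type*} (K : Type*) [CommRing K] (τ : I → ℤ) : Type _ :=
  OneForms I K ⧸ formCommutators K τ

/-- The differential `d : T̂W → Ω¹(T̂W)`:
`d (x₁ ⋯ xₙ) = ∑_k (-1)^{|x₁|+⋯+|x_{k-1}|} x₁ ⋯ x_{k-1} · dx_k · x_{k+1} ⋯ xₙ`. -/
def dForm {I K : Type*} [CommRing K] (τ : I → ℤ) : PowSer I K →ₗ[K] OneForms I K :=
  Formal.lin (fun f p => sgn K (wdeg τ p.1) * f (p.1 ++ p.2.1 :: p.2.2))
    (by simp [mul_add]) (by simp [mul_left_comm])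

/-- The Lie derivative `L_m` on `Ω¹(T̂W)` of the vector field `m` of degree one with restriction
`ξ` to `W`.  It is the derivation of degree one with `L_m x = m x` and `L_m (dx) = - d (m x)`; the
three summands come from applying it to the factors `a`, `c` and `dt i` of `a · dt i · c`. -/
def lieForm {I K : Type*} [CommRing K] (τ : I → ℤ) (ξ : Formal I K →ₗ[K] PowSer I K) :
    OneForms I K →ₗ[K] OneForms I K :=
  Formal.lin
    (fun ω p =>
      derExt τ ξ (Formal.reindex (fun a => (a, p.2.1, p.2.2)) ω) p.1
        + sgn K (wdeg τ p.1 + (τ p.2.1 + 1)) *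
            derExt τ ξ (Formal.reindex (fun c => (p.1, p.2.1, c)) ω) p.2.2
        - ∑ k ∈ Finset.range (p.1.length + 1), ∑ l ∈ Finset.range (p.2.2.length + 1),
            sgn K (wdeg τ (p.1.take k)) *
              dForm τ (ξ (Formal.reindex (fun i => (p.1.take k, i, p.2.2.drop l)) ω))
                (p.1.drop k, p.2.1, p.2.2.take l))
    (fun ω η p => by simp only [map_add, Formal.add_apply, mul_add, Finset.sum_add_distrib]; ring)
    (fun r ω p => by
      simp only [map_smul, Formal.smul_apply, mul_left_comm _ r, ← Finset.mul_sum]; ring)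

/-- The map `W ⊗̂ T̂W → Ω¹(T̂W)`, `x ⊗ y ↦ dx · y`; constants go to `0`. -/
def thetaForm (I K : Type*) [CommRing K] : PowSer I K →ₗ[K] OneForms I K :=
  Formal.lin (fun f p => match p with
      | ([], i, c) => f (i :: c)
      | _ => 0)
    (fun _ _ p => match p with
      | ([], _, _) => rfl
      | (_ :: _, _, _) => (add_zero 0).symm)
    (fun r _ p => match p with
      | ([], _, _) => rfl
      | (_ :: _, _, _) => (mul_zero r).symm)

/-- The map `Ω¹(T̂W) → W ⊗̂ T̂W` sending `a · dx · c` to `± x ⊗ c a`, the Koszul sign being that of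
rotating `a` past `dx · c`.  It induces the inverse of the isomorphism `theta` below. -/
def rotForm {I : Type*} (K : Type*) [CommRing K] (τ : I → ℤ) : OneForms I K →ₗ[K] PowSer I K :=
  Formal.lin
    (fun ω u => match u with
      | [] => 0
      | i :: w => ∑ l ∈ Finset.range (w.length + 1),
          sgn K (wdeg τ (w.drop l) * (τ i + 1 + wdeg τ (w.take l))) * ω (w.drop l, i, w.take l))
    (fun ω η u => match u with
      | [] => (add_zero 0).symm
      | i :: w => by simp [mul_add, Finset.sum_add_distrib])
    (fun c ω u => match u with
      | [] => (mul_zero c).symm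
      | i :: w => by simp [Finset.mul_sum, mul_left_comm])

theorem sgn_add (K : Type*) [CommRing K] (p q : ℤ) : sgn K (p + q) = sgn K p * sgn K q := by
  simp [sgn, Int.negOnePow_add]

theorem sgn_two_mul (K : Type*) [CommRing K] (p : ℤ) : sgn K (2 * p) = 1 := by
  simp [sgn, Int.negOnePow_two_mul]

theorem wdeg_split {I : Type*} (τ : I → ℤ) (w : List I) (k : ℕ) :
    wdeg τ w = wdeg τ (w.take k) + wdeg τ (w.drop k) := by
  rw [wdeg, wdeg, wdeg, ← List.sum_append, ← List.map_append, List.take_append_drop]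

theorem sum_split_assoc {I K : Type*} [CommRing K] (w : List I)
    (F : List I → List I → List I → K) :
    ∑ l ∈ Finset.range (w.length + 1), ∑ k ∈ Finset.range ((w.drop l).length + 1),
        F (w.take l) ((w.drop l).take k) ((w.drop l).drop k)
      = ∑ l ∈ Finset.range (w.length + 1), ∑ k ∈ Finset.range ((w.take l).length + 1),
        F ((w.take l).take k) ((w.take l).drop k) (w.drop l) := by
  induction w generalizing F with
  | nil => simp
  | cons i w ih =>
    have h := ih fun a b c => F (i :: a) b c
    rw [List.length_cons, Finset.sum_range_succ', Finset.sum_range_succ' _ (w.length + 1)]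
    simp only [List.drop_succ_cons, List.take_succ_cons, h, List.drop_zero, List.take_zero,
      List.length_cons, List.length_nil, Finset.sum_range_succ' _ ((List.take _ w).length + 1),
      Finset.sum_add_distrib, Finset.sum_range_succ' _ (w.length + 1)]
    simp only [zero_add, Finset.range_one, Finset.sum_singleton, List.take_nil, List.drop_nil]
    ring

theorem rotForm_commForm {I K : Type*} [CommRing K] (τ : I → ℤ) (g : PowSer I K)
    (ω : OneForms I K) : rotForm K τ (commForm τ g ω) = 0 := by
  ext u
  match u with
  | [] => rfl
  | i :: w =>
    change ∑ l ∈ Finset.range (w.length + 1),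
      sgn K (wdeg τ (w.drop l) * (τ i + 1 + wdeg τ (w.take l))) *
        ((∑ k ∈ Finset.range ((w.drop l).length + 1),
            g ((w.drop l).take k) * ω ((w.drop l).drop k, i, w.take l))
          - ∑ k ∈ Finset.range ((w.take l).length + 1),
            sgn K (wdeg τ ((w.take l).drop k) *
                (wdeg τ (w.drop l) + (τ i + 1) + wdeg τ ((w.take l).take k))) *
              (ω (w.drop l, i, (w.take l).take k) * g ((w.take l).drop k))) = 0
    simp only [mul_sub, Finset.sum_sub_distrib, Finset.mul_sum]
    rw [sub_eq_zero]
    have h := sum_split_assoc w fun c a₁ a₂ =>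
      sgn K ((wdeg τ a₁ + wdeg τ a₂) * (τ i + 1 + wdeg τ c)) * (g a₁ * ω (a₂, i, c))
    refine Eq.trans (Finset.sum_congr rfl fun l _ => Finset.sum_congr rfl fun k _ => ?_)
      (h.trans (Finset.sum_congr rfl fun l _ => Finset.sum_congr rfl fun k _ => ?_))
    · rw [wdeg_split τ (w.drop l) k]
    · have hs : sgn K (wdeg τ (w.drop l) * (τ i + 1 + wdeg τ (w.take l)))
          * sgn K (wdeg τ ((w.take l).drop k) *
            (wdeg τ (w.drop l) + (τ i + 1) + wdeg τ ((w.take l).take k)))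
          = sgn K ((wdeg τ ((w.take l).drop k) + wdeg τ (w.drop l)) *
            (τ i + 1 + wdeg τ ((w.take l).take k))) := by
        rw [wdeg_split τ (w.take l) k, ← sgn_add]
        generalize wdeg τ ((w.take l).take k) = p
        generalize wdeg τ ((w.take l).drop k) = q
        generalize wdeg τ (w.drop l) = r
        have : r * (τ i + 1 + (p + q)) + q * (r + (τ i + 1) + p)
            = (q + r) * (τ i + 1 + p) + 2 * (r * q) := by ring
        rw [this, sgn_add, sgn_two_mul, mul_one]
      rw [← hs]
      ring

theorem continuous_rotForm {I K : Type*} [CommRing K] (τ : I → ℤ) : Continuous (rotForm K τ) := by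
  classical
  refine Formal.continuous_of_finite _ fun u => ?_
  match u with
  | [] => exact ⟨∅, fun _ _ _ => rfl⟩
  | i :: w =>
    refine ⟨(Finset.range (w.length + 1)).image fun l => (w.drop l, i, w.take l),
      fun f g h => ?_⟩
    refine Finset.sum_congr (M := K) (s₁ := Finset.range (w.length + 1)) rfl fun l hl => ?_
    rw [h _ (Finset.mem_image_of_mem _ hl)]

theorem continuous_thetaForm {I K : Type*} [CommRing K] : Continuous (thetaForm I K) := by
  refine Formal.continuous_of_finite _ fun p => ?_
  match p with
  | ([], i, c) => exact ⟨{i :: c}, fun f g h => h _ (by simp)⟩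
  | (_ :: _, i, c) => exact ⟨∅, fun _ _ _ => rfl⟩

theorem formCommutators_le_ker {I K : Type*} [CommRing K] (τ : I → ℤ) :
    formCommutators K τ ≤ LinearMap.ker (rotForm K τ) := by
  refine Submodule.topologicalClosure_minimal _ (Submodule.span_le.2 ?_) ?_
  · rintro _ ⟨p, rfl⟩
    exact rotForm_commForm τ p.1 p.2
  · exact isClosed_singleton.preimage (continuous_rotForm τ)

theorem rotForm_thetaForm {I K : Type*} [CommRing K] (τ : I → ℤ) {f : PowSer I K}
    (hf : f ∈ pos I K) : rotForm K τ (thetaForm I K f) = f := by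
  ext u
  match u with
  | [] => exact (show f [] = 0 from hf).symm
  | i :: w =>
    change ∑ l ∈ Finset.range (w.length + 1),
      sgn K (wdeg τ (w.drop l) * (τ i + 1 + wdeg τ (w.take l))) *
        thetaForm I K f (w.drop l, i, w.take l) = f (i :: w)
    rw [Finset.sum_eq_single w.length]
    · rw [List.drop_length, List.take_length]
      change sgn K (wdeg τ [] * _) * f (i :: w) = f (i :: w)
      simp [wdeg, sgn]
    · intro l hl hne
      have : w.drop l ≠ [] := by
        simp only [Finset.mem_range, ne_eq, List.drop_eq_nil_iff] at *; omega
      obtain ⟨j, v, hv⟩ := List.exists_cons_of_ne_nil this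
      rw [hv]
      exact mul_zero _
    · simp

open Classical in
/-- The monomial `r • x`. -/
def Formal.single {X K : Type*} [CommRing K] (x : X) (r : K) : Formal X K :=
  fun y => if y = x then r else 0

theorem sub_theta_rot_single {I K : Type*} [CommRing K] (τ : I → ℤ) (a : List I) (i : I)
    (c : List I) (r : K) :
    Formal.single (a, i, c) r - thetaForm I K (rotForm K τ (Formal.single (a, i, c) r))
      = commForm τ (Formal.single a r) (Formal.single ([], i, c) 1) := by
  classical
  ext ⟨a', i', c'⟩
  have h1 : ∑ k ∈ Finset.range (a'.length + 1),
      (Formal.single a r : PowSer I K) (a'.take k)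
        * (Formal.single ([], i, c) 1 : OneForms I K) (a'.drop k, i', c')
      = (Formal.single (a, i, c) r : OneForms I K) (a', i', c') := by
    rw [Finset.sum_eq_single a'.length]
    · simp only [Formal.single, List.take_length, List.drop_length, Prod.mk.injEq, true_and]
      split_ifs <;> simp_all
    · intro k hk hne
      have : a'.drop k ≠ [] := by
        simp only [Finset.mem_range, ne_eq, List.drop_eq_nil_iff] at *; omega
      simp [Formal.single, this]
    · simp
  refine congrArg₂ (fun x y : K => x - y) h1.symm ?_
  change thetaForm I K (rotForm K τ (Formal.single (a, i, c) r)) (a', i', c')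
    = ∑ l ∈ Finset.range (c'.length + 1),
        sgn K (wdeg τ (c'.drop l) * (wdeg τ a' + (τ i' + 1) + wdeg τ (c'.take l))) *
          ((Formal.single ([], i, c) 1 : OneForms I K) (a', i', c'.take l)
            * (Formal.single a r : PowSer I K) (c'.drop l))
  match a' with
  | _ :: _ =>
    change (0 : K) = _
    symm
    refine Finset.sum_eq_zero fun l _ => ?_
    simp [Formal.single]
  | [] =>
    change ∑ l ∈ Finset.range (c'.length + 1),
      sgn K (wdeg τ (c'.drop l) * (τ i' + 1 + wdeg τ (c'.take l))) *
        (Formal.single (a, i, c) r : OneForms I K) (c'.drop l, i', c'.take l) = _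
    refine Finset.sum_congr rfl fun l _ => ?_
    congr 1
    · simp [wdeg]
    · simp only [Formal.single, Prod.mk.injEq, true_and]
      split_ifs <;> simp_all

theorem Formal.mem_of_single_mem {X K : Type*} [CommRing K] (S : Submodule K (Formal X K))
    (hS : IsClosed (S : Set (Formal X K))) (h : ∀ x r, Formal.single x r ∈ S)
    (f : Formal X K) : f ∈ S := by
  classical
  let _ : TopologicalSpace K := ⊥
  have _ : DiscreteTopology K := ⟨rfl⟩
  have ht : Filter.Tendsto (fun F : Finset X => ∑ x ∈ F, Formal.single x (f x)) Filter.atTop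
      (𝓝 f) := by
    refine tendsto_pi_nhds (A := fun _ : X => K) |>.2 fun x => ?_
    refine tendsto_const_nhds.congr' ?_
    filter_upwards [Filter.eventually_ge_atTop {x}] with F hF
    have hF : x ∈ F := hF (by simp)
    let ev : Formal X K →+ K := { toFun := fun f => f x, map_zero' := rfl, map_add' := fun _ _ => rfl }
    have : (∑ y ∈ F, Formal.single y (f y) : Formal X K) x
        = ∑ y ∈ F, (Formal.single y (f y) : Formal X K) x :=
      map_sum ev (fun y => Formal.single y (f y)) F
    rw [this, Finset.sum_eq_single x]
    · simp [Formal.single]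
    · intro y _ hne
      simp [Formal.single, hne.symm]
    · exact fun hx => absurd hF hx
  exact hS.mem_of_tendsto ht (Filter.Eventually.of_forall fun F => sum_mem fun x _ => h x _)

theorem sub_theta_rot_mem {I K : Type*} [CommRing K] (τ : I → ℤ) (ω : OneForms I K) :
    ω - thetaForm I K (rotForm K τ ω) ∈ formCommutators K τ := by
  let φ : OneForms I K →ₗ[K] OneForms I K :=
    LinearMap.id - thetaForm I K ∘ₗ rotForm K τ
  have hφ : Continuous φ :=
    continuous_id.sub (continuous_thetaForm.comp (continuous_rotForm τ))
  refine Formal.mem_of_single_mem ((formCommutators K τ).comap φ)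
    ((Submodule.isClosed_topologicalClosure _).preimage hφ) ?_ ω
  rintro ⟨a, i, c⟩ r
  change Formal.single (a, i, c) r - thetaForm I K (rotForm K τ (Formal.single (a, i, c) r))
    ∈ formCommutators K τ
  rw [sub_theta_rot_single]
  exact Submodule.le_topologicalClosure _ (Submodule.subset_span ⟨(_, _), rfl⟩)

/-- The isomorphism `Θ : ∏_{n ≥ 1} W^{⊗n} = W ⊗̂ T̂W → DR¹(T̂W)`, `x ⊗ y ↦ dx · y`. -/
def theta {I : Type*} (K : Type*) [CommRing K] (τ : I → ℤ) : pos I K ≃ₗ[K] DR1 K τ :=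
  LinearEquiv.ofBijective
    ((formCommutators K τ).mkQ ∘ₗ thetaForm I K ∘ₗ (pos I K).subtype)
    ⟨by
      refine (injective_iff_map_eq_zero _).2 fun x hx => ?_
      have h := formCommutators_le_ker τ ((Submodule.Quotient.mk_eq_zero _).1 hx)
      exact Subtype.ext ((rotForm_thetaForm τ x.2).symm.trans h),
    fun y => by
      obtain ⟨ω, rfl⟩ := Submodule.Quotient.mk_surjective _ y
      exact ⟨⟨rotForm K τ ω, rfl⟩,
        ((Submodule.Quotient.eq _).2 (sub_theta_rot_mem τ ω)).symm⟩⟩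

/-- The differential `b' = m` of the bar complex, as an operator on `T̂(ΣV*)`; the bar complex is
its restriction to `∏_{n ≥ 1} (ΣV*)^{⊗n}`. -/
def CInftyStructure.bPrime {I K : Type*} [CommRing K] {𝒜 : ℤ → AddSubgroup K} {d : I → ℤ}
    (m : CInftyStructure 𝒜 d) : Module.End K (PowSer I K) :=
  m.ext

/-- The Hochschild differential `b = Θ⁻¹ L_m Θ` on `∏_{n ≥ 1} (ΣV*)^{⊗n}`, extended by `0` to
constants. -/
def CInftyStructure.b {I K : Type*} [CommRing K] {𝒜 : ℤ → AddSubgroup K} {d : I → ℤ}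
    (m : CInftyStructure 𝒜 d) : Module.End K (PowSer I K) :=
  (pos I K).subtype ∘ₗ (theta K (dualDeg d)).symm.toLinearMap ∘ₗ
    (formCommutators K (dualDeg d)).mkQ ∘ₗ lieForm (dualDeg d) m.onLetters ∘ₗ thetaForm I K

/-! ### Complexes, bicomplexes and direct products

Graded objects are families of subgroups of an ambient topological group. -/

/-- The map `d` is a differential of degree one on the graded group `C`. -/
def IsComplex {M : Type*} [AddCommGroup M] (C : ℤ → AddSubgroup M) (d : M →+ M) : Prop :=
  ∀ n, ∀ x ∈ C n, d x ∈ C (n + 1) ∧ d (d x) = 0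

/-- `S` is a subcomplex of `(C, d)`. -/
def IsSubcomplex {M : Type*} [AddCommGroup M] (S C : ℤ → AddSubgroup M) (d : M →+ M) : Prop :=
  ∀ n, S n ≤ C n ∧ ∀ x ∈ S n, d x ∈ S (n + 1)

/-- The columns `C p` with vertical differentials `dv p : C p q → C p (q + 1)` and horizontal
differentials `dh p : C p q → C (p + 1) q` form a bicomplex (with anticommuting squares). -/
def IsBicomplex {M : Type*} [AddCommGroup M] (C : ℕ → ℤ → AddSubgroup M) (dv dh : ℕ → M →+ M) :
    Prop :=
  ∀ p q, ∀ x ∈ C p q,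
    dv p x ∈ C p (q + 1) ∧ dh p x ∈ C (p + 1) q ∧
    dv p (dv p x) = 0 ∧ dh (p + 1) (dh p x) = 0 ∧ dv (p + 1) (dh p x) + dh p (dv p x) = 0

/-- `S` is a sub-bicomplex of `(C, dv, dh)`. -/
def IsSubbicomplex {M : Type*} [AddCommGroup M] (S C : ℕ → ℤ → AddSubgroup M)
    (dv dh : ℕ → M →+ M) : Prop :=
  ∀ p q, S p q ≤ C p q ∧ ∀ x ∈ S p q, dv p x ∈ S p (q + 1) ∧ dh p x ∈ S (p + 1) q

/-- `A` is the direct product of the subgroups `S j`: summation `(x j)_j ↦ ∑ j, x j` is an isomorphism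
of topological groups from `∏ j, S j` onto `A`. -/
def IsDirectProduct {M ι : Type*} [AddCommGroup M] [TopologicalSpace M] (A : AddSubgroup M)
    (S : ι → AddSubgroup M) : Prop :=
  ∃ Φ : (∀ j, S j) ≃ₜ+ A, ∀ x, HasSum (fun j => (x j : M)) (Φ x : M)

/-! ### The cyclic Hochschild complex and the Tsygan bicomplex -/

/-- Degree `n` of `Σ (∏_{i ≥ 1} W^{⊗i})`. -/
def column {I K : Type*} [CommRing K] (𝒜 : ℤ → AddSubgroup K) (τ : I → ℤ) (n : ℤ) :
    AddSubgroup (PowSer I K) :=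
  (pos I K).toAddSubgroup ⊓ homog 𝒜 τ (n + 1)

/-- Degree `n` of the module of 0-forms vanishing at zero, suspended; this module is the module
`Σ (∏_{i ≥ 1} (W^{⊗i})_{Z_i})` of cyclic coinvariants. -/
def cyclicCochains {I K : Type*} [CommRing K] (𝒜 : ℤ → AddSubgroup K) (τ : I → ℤ) (n : ℤ) :
    AddSubgroup (ZeroForms K τ) :=
  (column 𝒜 τ n).map (commutators K τ).mkQ.toAddMonoidHom

/-- The map induced on `DR⁰(T̂W) = T̂W / [T̂W, T̂W]` by an operator preserving `[T̂W, T̂W]`. -/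
def onZeroForms {I K : Type*} [CommRing K] {τ : I → ℤ} {φ : Module.End K (PowSer I K)}
    (h : commutators K τ ≤ (commutators K τ).comap φ) : ZeroForms K τ →+ ZeroForms K τ :=
  ((commutators K τ).mapQ (commutators K τ) φ h).toAddMonoidHom

/-- `Q_j = Σ (e(j) [∏_{i ≥ 1} W^{⊗i}])` in degree `n`. -/
def hodgeQ {I K : Type*} [CommRing K] [Algebra ℚ K] (𝒜 : ℤ → AddSubgroup K) (τ : I → ℤ) (j : ℕ)
    (n : ℤ) : AddSubgroup (PowSer I K) :=
  (column 𝒜 τ n).map (hodgeProj (K := K) τ j).toAddMonoidHom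

/-- `Q̃_j = Σ (ẽ(j) [∏_{i ≥ 1} W^{⊗i}])` in degree `n`. -/
def hodgeQTilde {I K : Type*} [CommRing K] [Algebra ℚ K] (𝒜 : ℤ → AddSubgroup K) (τ : I → ℤ)
    (j : ℕ) (n : ℤ) : AddSubgroup (PowSer I K) :=
  (column 𝒜 τ n).map (hodgeProjTilde (K := K) τ j).toAddMonoidHom

/-- The bigraded module of the Tsygan bicomplex: every column is `Σ (∏_{i ≥ 1} W^{⊗i})`. -/
def tsygan {I K : Type*} [CommRing K] (𝒜 : ℤ → AddSubgroup K) (τ : I → ℤ) (_p : ℕ) (q : ℤ) :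
    AddSubgroup (PowSer I K) :=
  column 𝒜 τ q

/-- The vertical differentials: `b` on the columns `0, 2, 4, …` and `b'` on `1, 3, 5, …`. -/
def CInftyStructure.tsyganV {I K : Type*} [CommRing K] {𝒜 : ℤ → AddSubgroup K} {d : I → ℤ}
    (m : CInftyStructure 𝒜 d) (p : ℕ) : PowSer I K →+ PowSer I K :=
  if Even p then m.b.toAddMonoidHom else m.bPrime.toAddMonoidHom

/-- The horizontal differentials: `1 - z` out of the columns `0, 2, 4, …` and `N` out of the columns
`1, 3, 5, …`. -/
def tsyganH {I : Type*} (K : Type*) [CommRing K] (τ : I → ℤ) (p : ℕ) :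
    PowSer I K →+ PowSer I K :=
  if Even p then (1 - cyc K τ).toAddMonoidHom else (normOp K τ).toAddMonoidHom

/-- The strip `Γ_j`, with columns `Q̃_j, Q_j, Q̃_{j-1}, Q_{j-1}, …, Q_1, Q̃_0, 0, 0, …`. -/
def strip {I K : Type*} [CommRing K] [Algebra ℚ K] (𝒜 : ℤ → AddSubgroup K) (τ : I → ℤ) (j p : ℕ)
    (q : ℤ) : AddSubgroup (PowSer I K) :=
  if Even p then
    if p / 2 ≤ j then hodgeQTilde 𝒜 τ (j - p / 2) q else ⊥
  else
    if p / 2 < j then hodgeQ 𝒜 τ (j - p / 2) q else ⊥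

end HodgeCyclic

end

open HodgeCyclic

/-!
All operators are computed on words: continuous linear maps between the modules `Formal X K` are
determined by their values on basis elements (`Formal.linearMap_ext`), and `T̂W` is a ring for the
concatenation product.

*The shuffle operator.*  Lie elements are primitive, so a continuous derivation `D` of `T̂W` sending
the letters to `L̂W` is a coderivation for `Δ`, whence `s D = D s` (`IsDer.shuffleOp`).  This
applies to `b'`, as `m` is a derivation of `L̂W`, and to the operators `ad t`, `t` a letter; as
`(1 - z) (t f) = [t, f]`, the latter case is the identity `s (1 - z) = (1 - z) s̃` with
`s̃ = 1 ⊗̂ s` (`shuffleOp_one_sub_cyc`).  Cocommutativity of `Δ` and the fact that `N` kills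
commutators give `N s = 2 N s̃`, and, as `N` is `n` times a projection on `W^{⊗n}`,
`N s = 2 s̃ N` (`normOp_shuffleOp`).  On the span of the products of at most `r` Lie elements
`s - 2^r` takes values in the span of products of fewer Lie elements, so `(s - 2) ⋯ (s - 2^n)`
vanishes on `W^{⊗n}`, `n ≥ 1` (`aeval_shuffleOp_eq_zero`).

*The differential `b`.*  The map `cycDeriv l v`, which is `Θ⁻¹ (dl · v)`, satisfies
`(1 - z) (cycDeriv l v) = [l, v]` and `cycDeriv f 1 = N f`, and it intertwines `s̃` with `s` in the
variable `v` if `l` is a Lie element.  The value of `b` on `t v` is expressed through `cycDeriv`,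
and so are the value of `b` on `cycDeriv f v` and the relations `b² = 0`, `b N = -N b'`,
`(1 - z) b = -b' (1 - z)` and `s̃ b = b s̃` (`b_b`, `b_normOp`, `one_sub_cyc_b`, `shuffleOp_b`).

*Decompositions.*  By Lagrange interpolation `e(j)` and `ẽ(j)` are the projections onto the
`2^j`-eigenspaces of `s` and `s̃`, and only finitely many of them are nonzero on `W^{⊗n}`; moreover
`e(0)` vanishes on `W^{⊗n}`, `n ≥ 1`.  So `b'` preserves `Q_j`, `b` preserves `Q̃_j`, `1 - z` maps
`Q̃_j` to `Q_j`, and `N` maps `Q_j` to `Q̃_{j-1}`: the strips are sub-bicomplexes.  Locally finite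
families of projections give direct products of topological groups
(`isDirectProduct_of_projections`).  For the cyclic complex, `[T̂W, T̂W]` is the image of `1 - z`
(`commutators_eq_map`), and `N / n` embeds the coinvariants into `T̂W` as a retract
(`zeroFormsLift`).
-/

noncomputable section

namespace HodgeCyclic

/-! ### Continuous linear maps between profinite modules -/

section Continuity

variable {X Y Z K : Type*} [CommRing K]

theorem Formal.single_eq_smul (x : X) (r : K) :
    (Formal.single x r : Formal X K) = r • Formal.single x 1 := by
  ext y
  simp [Formal.single]

@[simp] theorem Formal.single_self (x : X) (r : K) : (Formal.single x r : Formal X K) x = r := by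
  simp [Formal.single]

theorem Formal.single_of_ne {x y : X} (h : y ≠ x) (r : K) :
    (Formal.single x r : Formal X K) y = 0 := by
  simp [Formal.single, h]

theorem Formal.single_apply [DecidableEq X] (x y : X) (r : K) :
    (Formal.single x r : Formal X K) y = if y = x then r else 0 := by
  unfold Formal.single
  congr

/-- Two continuous linear maps agreeing on the topological basis are equal. -/
theorem Formal.linearMap_ext {φ ψ : Formal X K →ₗ[K] Formal Y K} (hφ : Continuous φ)
    (hψ : Continuous ψ) (h : ∀ x, φ (Formal.single x 1) = ψ (Formal.single x 1)) : φ = ψ := by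
  refine LinearMap.ext fun f => ?_
  refine Formal.mem_of_single_mem (LinearMap.eqLocus φ ψ) (isClosed_eq hφ hψ) (fun x r => ?_) f
  rw [Formal.single_eq_smul]
  exact Submodule.smul_mem _ r (h x)

theorem Formal.continuous_iff {Y K A : Type*} [TopologicalSpace A] {φ : A → Formal Y K} :
    Continuous φ ↔ ∀ y, @Continuous A K _ ⊥ (fun a => φ a y) := by
  let _ : TopologicalSpace K := ⊥
  exact continuous_pi_iff (X := A) (A := fun _ : Y => K)

theorem Formal.continuous_eval {X K : Type*} (x : X) :
    @Continuous (Formal X K) K _ ⊥ (fun f => f x) :=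
  Formal.continuous_iff.1 continuous_id x

theorem Formal.continuous_reindex (σ : Y → X) :
    Continuous (Formal.reindex (K := K) σ) :=
  Formal.continuous_iff.2 fun y => Formal.continuous_eval (σ y)

/-- Multiplication of the coefficients by scalars. -/
def Formal.diag (c : X → K) : Formal X K →ₗ[K] Formal X K :=
  Formal.lin (fun f x => c x * f x) (fun _ _ _ => mul_add _ _ _) (fun _ _ _ => mul_left_comm _ _ _)

@[simp] theorem Formal.diag_apply (c : X → K) (f : Formal X K) (x : X) :
    Formal.diag c f x = c x * f x := rfl

theorem Formal.continuous_diag (c : X → K) : Continuous (Formal.diag c) :=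
  Formal.continuous_of_finite _ fun x => ⟨{x}, fun f g h => by simp [h x]⟩

theorem Formal.sum_apply {ι : Type*} (s : Finset ι) (f : ι → Formal X K) (x : X) :
    (∑ i ∈ s, f i) x = ∑ i ∈ s, f i x :=
  let ev : Formal X K →+ K :=
    { toFun := fun f => f x, map_zero' := rfl, map_add' := fun _ _ => rfl }
  map_sum ev f s

end Continuity

/-! ### Signs -/

section Signs

variable (K : Type*) [CommRing K]

theorem sgn_of_even {p : ℤ} (h : Even p) : sgn K p = 1 := by
  simp [sgn, Int.negOnePow_even p h]

theorem sgn_of_odd {p : ℤ} (h : Odd p) : sgn K p = -1 := by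
  simp [sgn, Int.negOnePow_odd p h]

@[simp] theorem sgn_zero : sgn K 0 = 1 := sgn_of_even K ⟨0, rfl⟩

@[simp] theorem sgn_one : sgn K 1 = -1 := sgn_of_odd K ⟨0, rfl⟩

@[simp] theorem sgn_mul_self (p : ℤ) : sgn K p * sgn K p = 1 := by
  rw [← sgn_add, ← two_mul, sgn_two_mul]

theorem sgn_congr {p q : ℤ} (h : Even (p - q)) : sgn K p = sgn K q := by
  have : p = q + (p - q) := by ring
  rw [this, sgn_add, sgn_of_even K h, mul_one]

end Signs

/-! ### The algebra structure of `T̂W` -/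

section Algebra

variable {I K : Type*} [CommRing K]

/-- The concatenation product of noncommutative power series. -/
instance : Mul (PowSer I K) :=
  ⟨fun f g u => ∑ k ∈ Finset.range (u.length + 1), f (u.take k) * g (u.drop k)⟩

instance : One (PowSer I K) := ⟨Formal.single [] 1⟩

theorem PowSer.mul_apply (f g : PowSer I K) (u : List I) :
    (f * g) u = ∑ k ∈ Finset.range (u.length + 1), f (u.take k) * g (u.drop k) := rfl

theorem PowSer.one_def : (1 : PowSer I K) = Formal.single [] 1 := rfl

theorem PowSer.mul_nil (f g : PowSer I K) : (f * g) [] = f [] * g [] := by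
  simp [PowSer.mul_apply]

theorem PowSer.mul_cons (f g : PowSer I K) (i : I) (w : List I) :
    (f * g) (i :: w) = f [] * g (i :: w) + (Formal.reindex (i :: ·) f * g : PowSer I K) w := by
  rw [PowSer.mul_apply, List.length_cons, Finset.sum_range_succ', add_comm]
  rfl

theorem PowSer.single_nil_mul (f : PowSer I K) : (Formal.single [] 1 : PowSer I K) * f = f := by
  ext u
  rw [PowSer.mul_apply, Finset.sum_eq_single 0]
  · simp
  · intro k hk hk0
    rw [Formal.single_of_ne, zero_mul]
    simp only [Finset.mem_range, ne_eq, List.take_eq_nil_iff, not_or] at *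
    refine ⟨hk0, ?_⟩
    rintro rfl
    simp at hk
    omega
  · simp

theorem PowSer.mul_single_nil (f : PowSer I K) : f * (Formal.single [] 1 : PowSer I K) = f := by
  ext u
  rw [PowSer.mul_apply, Finset.sum_eq_single u.length]
  · simp
  · intro k hk hk0
    rw [Formal.single_of_ne, mul_zero]
    simp only [Finset.mem_range, ne_eq, List.drop_eq_nil_iff] at *
    omega
  · simp

instance : Ring (PowSer I K) :=
  { (inferInstance : AddCommGroup (PowSer I K)), (inferInstance : Mul (PowSer I K)),
    (inferInstance : One (PowSer I K)) with
    left_distrib := fun f g h => by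
      ext u
      simp only [PowSer.mul_apply, Formal.add_apply, mul_add, Finset.sum_add_distrib]
    right_distrib := fun f g h => by
      ext u
      simp only [PowSer.mul_apply, Formal.add_apply, add_mul, Finset.sum_add_distrib]
    zero_mul := fun f => by
      ext u
      simp [PowSer.mul_apply]
    mul_zero := fun f => by
      ext u
      simp [PowSer.mul_apply]
    mul_assoc := fun f g h => by
      ext u
      simp only [PowSer.mul_apply, Finset.sum_mul, Finset.mul_sum]
      have := sum_split_assoc u fun a b c => f a * g b * h c
      refine this.symm.trans ?_
      simp only [mul_assoc]
    one_mul := PowSer.single_nil_mul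
    mul_one := PowSer.mul_single_nil }

instance : IsScalarTower K (PowSer I K) (PowSer I K) :=
  ⟨fun c f g => by
    ext u
    simp only [smul_eq_mul, PowSer.mul_apply, Formal.smul_apply, Finset.mul_sum, mul_assoc]⟩

instance : SMulCommClass K (PowSer I K) (PowSer I K) :=
  ⟨fun c f g => by
    ext u
    simp only [smul_eq_mul, PowSer.mul_apply, Formal.smul_apply, Finset.mul_sum, mul_left_comm]⟩

theorem PowSer.continuous_mul_left (g : PowSer I K) : Continuous fun f : PowSer I K => f * g := by
  classical
  refine Formal.continuous_of_finite _ fun u =>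
    ⟨(Finset.range (u.length + 1)).image u.take, fun f f' h => Finset.sum_congr rfl fun k hk => ?_⟩
  rw [h _ (Finset.mem_image_of_mem _ hk)]

theorem PowSer.continuous_mul_right (f : PowSer I K) : Continuous fun g : PowSer I K => f * g := by
  classical
  refine Formal.continuous_of_finite _ fun u =>
    ⟨(Finset.range (u.length + 1)).image u.drop, fun f f' h => Finset.sum_congr rfl fun k hk => ?_⟩
  rw [h _ (Finset.mem_image_of_mem _ hk)]

theorem continuous_mulMap : Continuous (mulMap I K) := by
  classical
  refine Formal.continuous_of_finite _ fun u =>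
    ⟨(Finset.range (u.length + 1)).image fun k => (u.take k, u.drop k),
      fun f f' h => Finset.sum_congr (M := K) (s₁ := Finset.range (u.length + 1)) rfl
        fun k hk => h _ (Finset.mem_image_of_mem _ hk)⟩

/-- The basis element `t i` of `W`. -/
def gen (K : Type*) [CommRing K] {I : Type*} (i : I) : PowSer I K := Formal.single [i] 1

theorem gen_mul_nil (i : I) (f : PowSer I K) : (gen K i * f) [] = 0 := by
  rw [PowSer.mul_nil, gen, Formal.single_of_ne (by simp), zero_mul]

open Classical in
theorem gen_mul_cons (i j : I) (f : PowSer I K) (w : List I) :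
    (gen K i * f) (j :: w) = if j = i then f w else 0 := by
  rw [PowSer.mul_cons, gen, Formal.single_of_ne (by simp), zero_mul, zero_add]
  split_ifs with h
  · subst h
    have : Formal.reindex (j :: ·) (Formal.single [j] 1 : PowSer I K) = 1 := by
      ext w
      change (Formal.single [j] 1 : PowSer I K) (j :: w) = (Formal.single [] 1 : PowSer I K) w
      simp [Formal.single]
    rw [this, one_mul]
  · have : Formal.reindex (j :: ·) (Formal.single [i] 1 : PowSer I K) = 0 := by
      ext w
      exact Formal.single_of_ne (by simp [h]) _
    rw [this, zero_mul, Formal.zero_apply]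

theorem single_cons (i : I) (w : List I) :
    (Formal.single (i :: w) 1 : PowSer I K) = gen K i * Formal.single w 1 := by
  classical
  ext u
  match u with
  | [] => rw [gen_mul_nil, Formal.single_of_ne (by simp)]
  | j :: u =>
    rw [gen_mul_cons, Formal.single_apply, Formal.single_apply]
    by_cases h : j = i <;> simp [h]

theorem letter_single (i : I) : (letter (Formal.single i 1) : PowSer I K) = gen K i := by
  ext u
  match u with
  | [] => exact (Formal.single_of_ne (by simp) _).symm
  | [j] =>
    change (Formal.single i 1 : Formal I K) j = _
    by_cases h : j = i <;> simp [gen, Formal.single, h]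
  | _ :: _ :: _ => exact (Formal.single_of_ne (by simp) _).symm

theorem continuous_letter : Continuous (letter (I := I) (K := K)) := by
  refine Formal.continuous_of_finite _ fun u => ?_
  match u with
  | [] => exact ⟨∅, fun _ _ _ => rfl⟩
  | [j] => exact ⟨{j}, fun f g h => h j (by simp)⟩
  | _ :: _ :: _ => exact ⟨∅, fun _ _ _ => rfl⟩

/-- A closed submodule of `T̂W` stable under left multiplication by the `t i` and containing `1` is
everything. -/
theorem PowSer.induction {p : PowSer I K → Prop} (S : Submodule K (PowSer I K))
    (hS : IsClosed (S : Set (PowSer I K))) (hp : ∀ f, f ∈ S ↔ p f) (h1 : p 1)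
    (hmul : ∀ i f, p f → p (gen K i * f)) (f : PowSer I K) : p f := by
  refine (hp f).1 (Formal.mem_of_single_mem S hS (fun w r => ?_) f)
  rw [Formal.single_eq_smul]
  refine S.smul_mem r ((hp _).2 ?_)
  induction w with
  | nil => exact h1
  | cons i w ih => rw [single_cons]; exact hmul i _ ih

/-- Two continuous linear maps on `T̂W` are equal if they agree on `1` and, whenever they agree on
`f`, agree on `t i * f`. -/
theorem PowSer.linearMap_ext {Y : Type*} {φ ψ : PowSer I K →ₗ[K] Formal Y K} (hφ : Continuous φ)
    (hψ : Continuous ψ) (h1 : φ 1 = ψ 1)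
    (hmul : ∀ i f, φ f = ψ f → φ (gen K i * f) = ψ (gen K i * f)) (f : PowSer I K) : φ f = ψ f :=
  PowSer.induction (p := fun f => φ f = ψ f) (LinearMap.eqLocus φ ψ) (isClosed_eq hφ hψ)
    (fun _ => Iff.rfl) h1 hmul f

/-- A closed submodule containing all multiples of the `t i` contains all power series vanishing
at zero. -/
theorem pos_le {S : Submodule K (PowSer I K)} (hS : IsClosed (S : Set (PowSer I K)))
    (h : ∀ i f, gen K i * f ∈ S) : pos I K ≤ S := by
  classical
  let π : PowSer I K →ₗ[K] PowSer I K := Formal.diag fun w => if w = [] then 0 else 1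
  have hpos : ∀ f ∈ pos I K, π f = f := fun f hf => by
    ext u
    change (if u = [] then 0 else 1) * f u = f u
    split_ifs with hu
    · rw [hu, show f [] = 0 from hf, mul_zero]
    · exact one_mul _
  have hone : π 1 = 0 := by
    ext u
    change (if u = [] then 0 else 1) * (1 : PowSer I K) u = 0
    split_ifs with hu
    · exact zero_mul _
    · rw [PowSer.one_def, Formal.single_of_ne hu, mul_zero]
  intro f hf
  have key := Formal.mem_of_single_mem (S.comap π) (hS.preimage (Formal.continuous_diag _))
    (fun w r => ?_) f
  · rwa [Submodule.mem_comap, hpos f hf] at key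
  · rw [Formal.single_eq_smul]
    refine Submodule.smul_mem _ r ?_
    rw [Submodule.mem_comap]
    cases w with
    | nil =>
      rw [← PowSer.one_def, hone]
      exact zero_mem _
    | cons i w =>
      rw [single_cons, hpos _ (gen_mul_nil i _)]
      exact h i _

/-- Two continuous linear maps agreeing on all multiples of the `t i` agree on the power series
vanishing at zero. -/
theorem PowSer.linearMap_ext_pos {Y : Type*} {φ ψ : PowSer I K →ₗ[K] Formal Y K}
    (hφ : Continuous φ) (hψ : Continuous ψ) (h : ∀ i f, φ (gen K i * f) = ψ (gen K i * f))
    {f : PowSer I K} (hf : f ∈ pos I K) : φ f = ψ f :=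
  pos_le (S := LinearMap.eqLocus φ ψ) (isClosed_eq hφ hψ) h hf

end Algebra

/-! ### Parity -/

section Parity

variable {I K : Type*} [CommRing K] (τ : I → ℤ)

theorem wdeg_append (a b : List I) : wdeg τ (a ++ b) = wdeg τ a + wdeg τ b := by
  simp [wdeg]

@[simp] theorem wdeg_nil : wdeg τ [] = 0 := rfl

@[simp] theorem wdeg_cons (i : I) (w : List I) : wdeg τ (i :: w) = τ i + wdeg τ w := by
  simp [wdeg]

/-- The operator `f ↦ (-1)^{p|f|} f`. -/
def sig (p : ℤ) : PowSer I K →ₗ[K] PowSer I K := Formal.diag fun w => sgn K (p * wdeg τ w)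

theorem sig_apply (p : ℤ) (f : PowSer I K) (w : List I) :
    sig τ p f w = sgn K (p * wdeg τ w) * f w := rfl

theorem continuous_sig (p : ℤ) : Continuous (sig (K := K) τ p) := Formal.continuous_diag _

theorem sig_mul (p : ℤ) (f g : PowSer I K) : sig τ p (f * g) = sig τ p f * sig τ p g := by
  ext u
  simp only [sig_apply, PowSer.mul_apply, Finset.mul_sum]
  refine Finset.sum_congr rfl fun k _ => ?_
  rw [wdeg_split τ u k, mul_add, sgn_add]
  ring

@[simp] theorem sig_one (p : ℤ) : sig τ p (1 : PowSer I K) = 1 := by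
  ext u
  rw [sig_apply]
  by_cases h : u = []
  · simp [h]
  · rw [PowSer.one_def, Formal.single_of_ne h, mul_zero]

theorem sig_sig (p q : ℤ) (f : PowSer I K) : sig τ p (sig τ q f) = sig τ (p + q) f := by
  ext u
  rw [sig_apply, sig_apply, sig_apply, add_mul, sgn_add, mul_assoc]

theorem sig_congr {p q : ℤ} (h : Even (p - q)) (f : PowSer I K) : sig τ p f = sig τ q f := by
  ext u
  rw [sig_apply, sig_apply]
  congr 1
  apply sgn_congr
  rw [← sub_mul]
  exact h.mul_right _

@[simp] theorem sig_zero (f : PowSer I K) : sig τ 0 f = f := by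
  ext u
  simp [sig_apply]

/-- The power series has degree `p` modulo two, coefficients being counted as even; the signs
depend on degrees modulo two only. -/
def Par (p : ℤ) (f : PowSer I K) : Prop := ∀ w, Odd (wdeg τ w - p) → f w = 0

variable {τ}

theorem Par.sig {p : ℤ} {f : PowSer I K} (h : Par τ p f) (q : ℤ) :
    sig τ q f = sgn K (q * p) • f := by
  ext u
  rw [sig_apply, Formal.smul_apply]
  rcases Int.even_or_odd (wdeg τ u - p) with hu | hu
  · rw [sgn_congr K (q := q * p)]
    rw [← mul_sub]
    exact hu.mul_left _
  · rw [h u hu, mul_zero, mul_zero]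

theorem par_gen (i : I) : Par τ (τ i) (gen K i) := fun w hw => by
  refine Formal.single_of_ne ?_ _
  rintro rfl
  simp at hw

theorem par_single (w : List I) : Par τ (wdeg τ w) (Formal.single w 1 : PowSer I K) :=
  fun u hu => by
  refine Formal.single_of_ne ?_ _
  rintro rfl
  simp at hu

theorem Par.mul {p q : ℤ} {f g : PowSer I K} (hf : Par τ p f) (hg : Par τ q g) :
    Par τ (p + q) (f * g) := fun w hw => by
  refine Finset.sum_eq_zero fun k _ => ?_
  rcases Int.even_or_odd (wdeg τ (w.take k) - p) with h | h
  · rw [hg, mul_zero]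
    have : wdeg τ (w.drop k) - q = (wdeg τ w - (p + q)) - (wdeg τ (w.take k) - p) := by
      rw [wdeg_split τ w k]; ring
    rw [this]
    exact hw.sub_even h
  · rw [hf _ h, zero_mul]

theorem Par.smul {p : ℤ} {f : PowSer I K} (c : K) (hf : Par τ p f) : Par τ p (c • f) :=
  fun w hw => by rw [Formal.smul_apply, hf w hw, mul_zero]

theorem Par.sub {p : ℤ} {f g : PowSer I K} (hf : Par τ p f) (hg : Par τ p g) :
    Par τ p (f - g) := fun w hw => by
  rw [Formal.sub_apply, hf w hw, hg w hw, sub_zero]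

theorem sig_gen (p : ℤ) (i : I) : HodgeCyclic.sig τ p (gen K i) = sgn K (p * τ i) • gen K i :=
  (par_gen i).sig p

/-- The graded commutator with a homogeneous element. -/
theorem Par.comm_eq {p : ℤ} {l : PowSer I K} (h : Par τ p l) (f : PowSer I K) :
    comm τ l f = l * f - HodgeCyclic.sig τ p f * l := by
  ext u
  rw [Formal.sub_apply, PowSer.mul_apply, PowSer.mul_apply, ← Finset.sum_sub_distrib]
  refine Finset.sum_congr rfl fun k _ => ?_
  rw [sig_apply]
  rcases Int.even_or_odd (wdeg τ (u.drop k) - p) with hu | hu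
  · have : sgn K (wdeg τ (u.take k) * wdeg τ (u.drop k)) = sgn K (p * wdeg τ (u.take k)) := by
      apply sgn_congr
      rw [mul_comm p, ← mul_sub]
      exact hu.mul_left _
    rw [this, mul_assoc]
  · rw [h _ hu, mul_zero, mul_zero, mul_zero]

theorem Par.comm {p q : ℤ} {f g : PowSer I K} (hf : Par τ p f) (hg : Par τ q g) :
    Par τ (p + q) (comm τ f g) := by
  rw [hf.comm_eq, hg.sig]
  refine (hf.mul hg).sub ?_
  rw [smul_mul_assoc, add_comm]
  exact (hg.mul hf).smul _

end Parity

/-! ### Operators on `T̂W ⊗̂ T̂W` -/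

section Tensor

variable {I K : Type*} [CommRing K]

/-- The element `f ⊗ g` of `T̂W ⊗̂ T̂W`. -/
def tens (f g : PowSer I K) : Formal (List I × List I) K := fun p => f p.1 * g p.2

theorem tens_apply (f g : PowSer I K) (p : List I × List I) : tens f g p = f p.1 * g p.2 := rfl

theorem tens_add_left (f f' g : PowSer I K) : tens (f + f') g = tens f g + tens f' g := by
  ext p; simp [tens_apply, add_mul]

theorem tens_add_right (f g g' : PowSer I K) : tens f (g + g') = tens f g + tens f g' := by
  ext p; simp [tens_apply, mul_add]

theorem tens_sub_left (f f' g : PowSer I K) : tens (f - f') g = tens f g - tens f' g := by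
  ext p; simp [tens_apply, sub_mul]

theorem tens_sub_right (f g g' : PowSer I K) : tens f (g - g') = tens f g - tens f g' := by
  ext p; simp [tens_apply, mul_sub]

theorem tens_smul_left (c : K) (f g : PowSer I K) : tens (c • f) g = c • tens f g := by
  ext p; simp [tens_apply, mul_assoc]

theorem tens_smul_right (c : K) (f g : PowSer I K) : tens f (c • g) = c • tens f g := by
  ext p; simp [tens_apply, mul_left_comm]

theorem single_pair (a b : List I) :
    (Formal.single (a, b) 1 : Formal (List I × List I) K)
      = tens (Formal.single a 1) (Formal.single b 1) := by
  classical
  ext ⟨a', b'⟩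
  by_cases h : a' = a <;> by_cases h' : b' = b <;> simp [tens_apply, Formal.single, h, h']

theorem tens_linearMap_ext {Y : Type*} {φ ψ : Formal (List I × List I) K →ₗ[K] Formal Y K}
    (hφ : Continuous φ) (hψ : Continuous ψ) (h : ∀ f g, φ (tens f g) = ψ (tens f g))
    (x : Formal (List I × List I) K) : φ x = ψ x := by
  refine LinearMap.congr_fun (Formal.linearMap_ext hφ hψ fun p => ?_) x
  rw [single_pair, h]

@[simp] theorem mulMap_tens (f g : PowSer I K) : mulMap I K (tens f g) = f * g := rfl

/-- The operator `φ ⊗̂ 1`. -/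
def opL (φ : Module.End K (PowSer I K)) : Module.End K (Formal (List I × List I) K) :=
  Formal.lin (fun h p => φ (Formal.reindex (fun a => (a, p.2)) h) p.1) (by simp) (by simp)

/-- The operator `1 ⊗̂ φ`, without a sign. -/
def opR (φ : Module.End K (PowSer I K)) : Module.End K (Formal (List I × List I) K) :=
  Formal.lin (fun h p => φ (Formal.reindex (fun b => (p.1, b)) h) p.2) (by simp) (by simp)

@[simp] theorem opL_tens (φ : Module.End K (PowSer I K)) (f g : PowSer I K) :
    opL φ (tens f g) = tens (φ f) g := by
  ext ⟨a, b⟩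
  have : Formal.reindex (fun a => (a, b)) (tens f g) = g b • f := by
    ext a
    exact mul_comm _ _
  change φ (Formal.reindex (fun a => (a, b)) (tens f g)) a = φ f a * g b
  rw [this, map_smul, Formal.smul_apply, mul_comm]

@[simp] theorem opR_tens (φ : Module.End K (PowSer I K)) (f g : PowSer I K) :
    opR φ (tens f g) = tens f (φ g) := by
  ext ⟨a, b⟩
  have : Formal.reindex (fun b => (a, b)) (tens f g) = f a • g := rfl
  change φ (Formal.reindex (fun b => (a, b)) (tens f g)) b = f a * φ g b
  rw [this, map_smul, Formal.smul_apply]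

theorem continuous_opL {φ : Module.End K (PowSer I K)} (hφ : Continuous φ) :
    Continuous (opL φ) :=
  Formal.continuous_iff.2 fun p =>
    Formal.continuous_iff.1 (hφ.comp (Formal.continuous_reindex fun a => (a, p.2))) p.1

theorem continuous_opR {φ : Module.End K (PowSer I K)} (hφ : Continuous φ) :
    Continuous (opR φ) :=
  Formal.continuous_iff.2 fun p =>
    Formal.continuous_iff.1 (hφ.comp (Formal.continuous_reindex fun b => (p.1, b))) p.2

variable (τ : I → ℤ)

/-- The product of `l ⊗ 1 + 1 ⊗ l` and `h` in `T̂W ⊗̂ T̂W`. -/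
def coprimFun (l : PowSer I K) (h : Formal (List I × List I) K) :
    Formal (List I × List I) K := fun p =>
  ∑ k ∈ Finset.range (p.1.length + 1), l (p.1.take k) * h (p.1.drop k, p.2)
    + ∑ k ∈ Finset.range (p.2.length + 1),
      sgn K (wdeg τ p.1 * wdeg τ (p.2.take k)) * (l (p.2.take k) * h (p.1, p.2.drop k))

theorem coprimFun_apply (l : PowSer I K) (h : Formal (List I × List I) K) (p : List I × List I) :
    coprimFun τ l h p = ∑ k ∈ Finset.range (p.1.length + 1), l (p.1.take k) * h (p.1.drop k, p.2)
    + ∑ k ∈ Finset.range (p.2.length + 1),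
      sgn K (wdeg τ p.1 * wdeg τ (p.2.take k)) * (l (p.2.take k) * h (p.1, p.2.drop k)) := rfl

/-- The action of `l ⊗ 1 + 1 ⊗ l` on `T̂W ⊗̂ T̂W` by left multiplication. -/
def coprim : PowSer I K →ₗ[K] Module.End K (Formal (List I × List I) K) :=
  LinearMap.mk₂ K (coprimFun τ)
    (fun l l' h => by
      ext p
      simp only [coprimFun_apply, Formal.add_apply, add_mul, mul_add, Finset.sum_add_distrib]
      ring)
    (fun c l h => by
      ext p
      simp only [coprimFun_apply, Formal.smul_apply, mul_add, Finset.mul_sum, mul_assoc,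
        mul_left_comm c])
    (fun l h h' => by
      ext p
      simp only [coprimFun_apply, Formal.add_apply, mul_add, Finset.sum_add_distrib]
      ring)
    (fun c l h => by
      ext p
      simp only [coprimFun_apply, Formal.smul_apply, mul_add, Finset.mul_sum, mul_left_comm c])

theorem continuous_coprim (l : PowSer I K) : Continuous (coprim τ l) := by
  classical
  refine Formal.continuous_of_finite _ fun p =>
    ⟨(Finset.range (p.1.length + 1)).image (fun k => (p.1.drop k, p.2))
      ∪ (Finset.range (p.2.length + 1)).image (fun k => (p.1, p.2.drop k)), fun f g h => ?_⟩
  refine congrArg₂ (fun x y : K => x + y) (Finset.sum_congr rfl fun k hk => ?_)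
    (Finset.sum_congr rfl fun k hk => ?_)
  · rw [h _ (Finset.mem_union_left _ (Finset.mem_image_of_mem _ hk))]
  · rw [h _ (Finset.mem_union_right _ (Finset.mem_image_of_mem _ hk))]

theorem continuous_coprim_left (h : Formal (List I × List I) K) :
    Continuous fun l => coprim τ l h := by
  classical
  refine Formal.continuous_of_finite _ fun p =>
    ⟨(Finset.range (p.1.length + 1)).image p.1.take
      ∪ (Finset.range (p.2.length + 1)).image p.2.take, fun f g h => ?_⟩
  refine congrArg₂ (fun x y : K => x + y) (Finset.sum_congr rfl fun k hk => ?_)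
    (Finset.sum_congr rfl fun k hk => ?_)
  · rw [h _ (Finset.mem_union_left _ (Finset.mem_image_of_mem _ hk))]
  · rw [h _ (Finset.mem_union_right _ (Finset.mem_image_of_mem _ hk))]

variable {τ}

theorem Par.coprim_apply {p : ℤ} {l : PowSer I K} (hl : Par τ p l)
    (h : Formal (List I × List I) K) (a b : List I) :
    coprim τ l h (a, b) = (l * Formal.reindex (fun a => (a, b)) h : PowSer I K) a
      + sgn K (p * wdeg τ a) * (l * Formal.reindex (fun b => (a, b)) h : PowSer I K) b := by
  refine congrArg₂ (fun x y : K => x + y) rfl ?_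
  rw [PowSer.mul_apply, Finset.mul_sum]
  refine Finset.sum_congr rfl fun k _ => ?_
  change sgn K (wdeg τ a * wdeg τ (b.take k)) * (l (b.take k) * h (a, b.drop k))
    = sgn K (p * wdeg τ a) * (l (b.take k) * h (a, b.drop k))
  rcases Int.even_or_odd (wdeg τ (b.take k) - p) with hu | hu
  · rw [sgn_congr K (q := p * wdeg τ a)]
    rw [mul_comm p, ← mul_sub]
    exact hu.mul_left _
  · rw [hl _ hu, zero_mul, mul_zero, mul_zero]

theorem Par.coprim_tens {p : ℤ} {l : PowSer I K} (hl : Par τ p l) (f g : PowSer I K) :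
    coprim τ l (tens f g) = tens (l * f) g + tens (HodgeCyclic.sig τ p f) (l * g) := by
  ext ⟨a, b⟩
  have h1 : Formal.reindex (fun a => (a, b)) (tens f g) = g b • f := by
    ext a
    exact mul_comm _ _
  have h2 : Formal.reindex (fun b => (a, b)) (tens f g) = f a • g := rfl
  rw [hl.coprim_apply, h1, h2, mul_smul_comm, mul_smul_comm, Formal.smul_apply, Formal.smul_apply,
    Formal.add_apply, tens_apply, tens_apply, sig_apply]
  ring

end Tensor

/-! ### Homogeneous Lie monomials -/

section Lie

variable {I K : Type*} [CommRing K] (τ : I → ℤ)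

/-- Lie monomials of degree `p` in the basis elements of `W`. -/
inductive IsHomLie (K : Type*) [CommRing K] {I : Type*} (τ : I → ℤ) : ℤ → PowSer I K → Prop
  | gen (i : I) : IsHomLie K τ (τ i) (gen K i)
  | comm {p q : ℤ} {x y : PowSer I K} (hx : IsHomLie K τ p x) (hy : IsHomLie K τ q y) :
      IsHomLie K τ (p + q) (comm τ x y)

variable {τ}

theorem IsHomLie.par {p : ℤ} {x : PowSer I K} (h : IsHomLie K τ p x) : Par τ p x := by
  induction h with
  | gen i => exact par_gen i
  | comm _ _ hx hy => exact hx.comm hy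

variable (τ)

/-- The commutator as a bilinear map. -/
def commMap : PowSer I K →ₗ[K] Module.End K (PowSer I K) :=
  LinearMap.mk₂ K (comm τ) (comm_add_left τ) (comm_smul_left τ) (comm_add_right τ)
    (comm_smul_right τ)

@[simp] theorem commMap_apply (f g : PowSer I K) : commMap τ f g = comm τ f g := rfl

theorem comm_mem_topologicalClosure (s : Set (PowSer I K))
    (hs : ∀ x ∈ s, ∀ y ∈ s, comm τ x y ∈ s) {x y : PowSer I K}
    (hx : x ∈ (Submodule.span K s).topologicalClosure)
    (hy : y ∈ (Submodule.span K s).topologicalClosure) :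
    comm τ x y ∈ (Submodule.span K s).topologicalClosure := by
  have h1 : ∀ x ∈ s, ∀ y ∈ (Submodule.span K s).topologicalClosure,
      comm τ x y ∈ (Submodule.span K s).topologicalClosure := fun x hx => by
    change (Submodule.span K s).topologicalClosure
      ≤ ((Submodule.span K s).topologicalClosure).comap (commMap τ x)
    refine Submodule.topologicalClosure_minimal _ (Submodule.span_le.2 fun y hy => ?_)
      ((Submodule.isClosed_topologicalClosure _).preimage (continuous_comm_right τ x))
    exact Submodule.le_topologicalClosure _ (Submodule.subset_span (hs x hx y hy))
  have h2 : (Submodule.span K s).topologicalClosure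
      ≤ ((Submodule.span K s).topologicalClosure).comap ((commMap τ).flip y) := by
    refine Submodule.topologicalClosure_minimal _ (Submodule.span_le.2 fun x hx => ?_)
      ((Submodule.isClosed_topologicalClosure _).preimage (continuous_comm_left τ y))
    exact h1 x hx y hy
  exact h2 hx

/-- The free Lie algebra is topologically spanned by the homogeneous Lie monomials. -/
theorem lieAlg_le {S : Submodule K (PowSer I K)} (hS : IsClosed (S : Set (PowSer I K)))
    (h : ∀ p x, IsHomLie K τ p x → x ∈ S) : lieAlg K τ ≤ S := by
  let s : Set (PowSer I K) := {x | ∃ p, IsHomLie K τ p x}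
  have hs : ∀ x ∈ s, ∀ y ∈ s, comm τ x y ∈ s := by
    rintro x ⟨p, hx⟩ y ⟨q, hy⟩
    exact ⟨_, hx.comm hy⟩
  have hsS : (Submodule.span K s).topologicalClosure ≤ S :=
    Submodule.topologicalClosure_minimal _ (Submodule.span_le.2 fun x ⟨p, hx⟩ => h p x hx) hS
  refine le_trans (Submodule.topologicalClosure_minimal _ (Submodule.span_le.2 fun x hx => ?_)
    (Submodule.isClosed_topologicalClosure _)) hsS
  induction hx with
  | letter g =>
    refine Formal.mem_of_single_mem ((Submodule.span K s).topologicalClosure.comap letter)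
      ((Submodule.isClosed_topologicalClosure _).preimage continuous_letter) (fun i r => ?_) g
    rw [Formal.single_eq_smul]
    refine Submodule.smul_mem _ r ?_
    rw [Submodule.mem_comap, letter_single]
    exact Submodule.le_topologicalClosure _ (Submodule.subset_span ⟨_, .gen i⟩)
  | comm _ _ hx hy => exact comm_mem_topologicalClosure τ s hs hx hy

variable {τ}

theorem gen_mem_lieAlg (i : I) : gen K i ∈ lieAlg K τ := by
  rw [← letter_single]
  exact letter_mem_lieAlg τ _

theorem IsHomLie.mem_lieAlg {p : ℤ} {x : PowSer I K} (h : IsHomLie K τ p x) : x ∈ lieAlg K τ := by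
  induction h with
  | gen i => exact gen_mem_lieAlg i
  | comm _ _ hx hy => exact comm_mem_lieAlg τ hx hy

/-- The map `l ↦ l ⊗ 1 + 1 ⊗ l` takes graded commutators to graded commutators: the cross terms
cancel. -/
theorem coprim_comm {p q : ℤ} {x y : PowSer I K} (hx : Par τ p x) (hy : Par τ q y)
    (h : Formal (List I × List I) K) :
    coprim τ (comm τ x y) h
      = coprim τ x (coprim τ y h) - sgn K (p * q) • coprim τ y (coprim τ x h) := by
  refine tens_linearMap_ext (φ := coprim τ (comm τ x y))
    (ψ := coprim τ x ∘ₗ coprim τ y - sgn K (p * q) • (coprim τ y ∘ₗ coprim τ x))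
    (continuous_coprim _ _)
    (((continuous_coprim _ _).comp (continuous_coprim _ _)).sub
      (((continuous_coprim _ _).comp (continuous_coprim _ _)).const_smul (sgn K (p * q)))) ?_ h
  intro f g
  rw [(hx.comm hy).coprim_tens, hx.comm_eq, hy.sig]
  simp only [LinearMap.sub_apply, LinearMap.comp_apply, LinearMap.smul_apply]
  rw [hx.coprim_tens, hy.coprim_tens, map_add, map_add]
  simp only [hx.coprim_tens, hy.coprim_tens, sig_mul, sig_sig, hx.sig, hy.sig, sub_mul, mul_assoc,
    smul_mul_assoc, tens_sub_left, tens_sub_right, tens_smul_left, tens_smul_right, smul_add,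
    smul_smul]
  rw [add_comm q p, mul_comm q p, sgn_mul_self, one_smul]
  abel

end Lie

/-! ### The coproduct -/

section Coproduct

variable {I K : Type*} [CommRing K] (τ : I → ℤ)

theorem coprodCoeff_nil_left (f : List I → K) (b : List I) : coprodCoeff τ f [] b = f b := by
  simp [coprodCoeff]

theorem coprodCoeff_cons_cons (f : List I → K) (i : I) (a : List I) (j : I) (b : List I) :
    coprodCoeff τ f (i :: a) (j :: b) = coprodCoeff τ (fun w => f (i :: w)) a (j :: b)
        + sgn K (τ j * wdeg τ (i :: a)) * coprodCoeff τ (fun w => f (j :: w)) (i :: a) b := by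
  simp [coprodCoeff]

theorem coprodCoeff_nil_right (f : List I → K) (a : List I) : coprodCoeff τ f a [] = f a := by
  cases a <;> simp [coprodCoeff]

theorem coprod_nil_left (f : PowSer I K) (b : List I) : coprod K τ f ([], b) = f b :=
  coprodCoeff_nil_left τ f b

theorem coprod_nil_right (f : PowSer I K) (a : List I) : coprod K τ f (a, []) = f a :=
  coprodCoeff_nil_right τ f a

theorem coprod_cons_cons (f : PowSer I K) (i : I) (a : List I) (j : I) (b : List I) :
    coprod K τ f (i :: a, j :: b) = coprod K τ (Formal.reindex (i :: ·) f) (a, j :: b)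
      + sgn K (τ j * wdeg τ (i :: a)) * coprod K τ (Formal.reindex (j :: ·) f) (i :: a, b) :=
  coprodCoeff_cons_cons τ f i a j b

theorem continuous_coprod : Continuous (coprod K τ) := by
  classical
  refine Formal.continuous_of_finite _ fun p => ?_
  suffices h : ∀ a b : List I, ∃ F : Finset (List I), ∀ f g : List I → K,
      (∀ x ∈ F, f x = g x) → coprodCoeff τ f a b = coprodCoeff τ g a b from h p.1 p.2
  have key : ∀ (n : ℕ) (a b : List I), a.length + b.length = n →
      ∃ F : Finset (List I), ∀ f g : List I → K,
      (∀ x ∈ F, f x = g x) → coprodCoeff τ f a b = coprodCoeff τ g a b := by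
    intro n
    induction n with
    | zero =>
      intro a b h
      have hb : b = [] := List.length_eq_zero_iff.1 (by omega)
      subst hb
      exact ⟨{a}, fun f g h => by simpa [coprodCoeff_nil_right] using h⟩
    | succ n ih =>
      intro a b h
      match a, b with
      | [], b => exact ⟨{b}, fun f g h => by simpa [coprodCoeff] using h⟩
      | i :: a, [] => exact ⟨{i :: a}, fun f g h => by simpa [coprodCoeff] using h⟩
      | i :: a, j :: b =>
        obtain ⟨F, hF⟩ := ih a (j :: b) (by simp at h ⊢; omega)
        obtain ⟨G, hG⟩ := ih (i :: a) b (by simp at h ⊢; omega)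
        refine ⟨F.image (i :: ·) ∪ G.image (j :: ·), fun f g h => ?_⟩
        simp only [coprodCoeff]
        rw [hF (fun w => f (i :: w)) (fun w => g (i :: w)) fun x hx =>
            h _ (Finset.mem_union_left _ (Finset.mem_image_of_mem _ hx)),
          hG (fun w => f (j :: w)) (fun w => g (j :: w)) fun x hx =>
            h _ (Finset.mem_union_right _ (Finset.mem_image_of_mem _ hx))]
  exact fun a b => key _ a b rfl

theorem continuous_shuffleOp : Continuous (shuffleOp K τ) :=
  continuous_mulMap.comp (continuous_coprod τ)

theorem coprod_one : coprod K τ 1 = tens 1 1 := by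
  ext ⟨a, b⟩
  rw [tens_apply]
  match a, b with
  | [], b => rw [coprod_nil_left, PowSer.one_def, Formal.single_self, one_mul]
  | i :: a, [] => rw [coprod_nil_right, PowSer.one_def, Formal.single_self, mul_one]
  | i :: a, j :: b =>
    have h : ∀ k : I, Formal.reindex (k :: ·) (1 : PowSer I K) = 0 :=
      fun k => Formal.ext fun w => Formal.single_of_ne (by simp) _
    rw [coprod_cons_cons, h, h, map_zero, PowSer.one_def,
      Formal.single_of_ne (show i :: a ≠ [] by simp)]
    simp

open Classical in
theorem reindex_gen_mul (i k : I) (f : PowSer I K) :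
    Formal.reindex (k :: ·) (gen K i * f) = if k = i then f else 0 := by
  ext w
  change (gen K i * f) (k :: w) = _
  rw [gen_mul_cons]
  split_ifs <;> rfl

theorem coprod_gen_mul (i : I) (f : PowSer I K) :
    coprod K τ (gen K i * f) = coprim τ (gen K i) (coprod K τ f) := by
  classical
  ext ⟨a, b⟩
  rw [(par_gen i).coprim_apply]
  match a, b with
  | [], b =>
    have : Formal.reindex (fun b => (([] : List I), b)) (coprod K τ f) = f :=
      Formal.ext fun b => coprod_nil_left τ f b
    rw [coprod_nil_left, gen_mul_nil, this]
    simp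
  | j :: a, [] =>
    have : Formal.reindex (fun a => (a, ([] : List I))) (coprod K τ f) = f :=
      Formal.ext fun a => coprod_nil_right τ f a
    rw [coprod_nil_right, gen_mul_nil, this, mul_zero, add_zero]
  | j :: a, k :: b =>
    rw [coprod_cons_cons, reindex_gen_mul, reindex_gen_mul, gen_mul_cons, gen_mul_cons]
    refine congrArg₂ (fun x y : K => x + y) ?_ ?_
    · split_ifs
      · rfl
      · rw [map_zero, Formal.zero_apply]
    · split_ifs with hk
      · subst hk
        rfl
      · rw [map_zero, Formal.zero_apply, mul_zero, mul_zero]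

/-- Elements of the free Lie algebra are primitive: `Δ l = l ⊗ 1 + 1 ⊗ l`, stated after
multiplication by `Δ f`. -/
theorem coprod_lie_mul {l : PowSer I K} (hl : l ∈ lieAlg K τ) (f : PowSer I K) :
    coprod K τ (l * f) = coprim τ l (coprod K τ f) := by
  have key : ∀ p x, IsHomLie K τ p x → ∀ f : PowSer I K,
      coprod K τ (x * f) = coprim τ x (coprod K τ f) := fun p x hx => by
    induction hx with
    | gen i => exact coprod_gen_mul τ i
    | comm hx hy ihx ihy =>
      intro f
      rw [coprim_comm hx.par hy.par, ← ihy, ← ihx, ← ihx, ← ihy, hx.par.comm_eq, hy.par.sig,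
        smul_mul_assoc, sub_mul, smul_mul_assoc, map_sub, map_smul, mul_assoc, mul_assoc]
  refine lieAlg_le τ (S := LinearMap.eqLocus (coprod K τ ∘ₗ LinearMap.mulRight K f)
    ((coprim τ).flip (coprod K τ f))) (isClosed_eq ?_ ?_) (fun p x hx => key p x hx f) hl
  · exact (continuous_coprod τ).comp (PowSer.continuous_mul_left f)
  · exact continuous_coprim_left τ _

end Coproduct

/-! ### Derivations preserving the free Lie algebra -/

section Derivations

variable {I K : Type*} [CommRing K] {τ : I → ℤ}

/-- Continuous derivations of `T̂W` of parity `p`; the last two fields say that `D` shifts parities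
by `p`. -/
structure IsDer (τ : I → ℤ) (p : ℤ) (D : Module.End K (PowSer I K)) : Prop where
  cont : Continuous D
  leib : ∀ f g, D (f * g) = D f * g + sig τ p f * D g
  sig : ∀ q f, D (sig τ q f) = sgn K (p * q) • HodgeCyclic.sig τ q (D f)
  par : ∀ i, Par τ (p + τ i) (D (gen K i))

theorem IsDer.map_one {p : ℤ} {D : Module.End K (PowSer I K)} (h : IsDer τ p D) : D 1 = 0 := by
  have := h.leib 1 1
  rw [sig_one, mul_one, one_mul, mul_one] at this
  simpa using this

theorem IsDer.gen_mul {p : ℤ} {D : Module.End K (PowSer I K)} (h : IsDer τ p D) (i : I)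
    (f : PowSer I K) : D (gen K i * f) = D (gen K i) * f + sgn K (p * τ i) • (gen K i * D f) := by
  rw [h.leib, sig_gen, smul_mul_assoc]

/-- The product rule for products with letters implies the product rule. -/
theorem isDer_of_gen {p : ℤ} {D : Module.End K (PowSer I K)} (hD : Continuous D) (h1 : D 1 = 0)
    (hpar : ∀ i, Par τ (p + τ i) (D (gen K i)))
    (hgen : ∀ i f, D (gen K i * f) = D (gen K i) * f + sgn K (p * τ i) • (gen K i * D f)) :
    IsDer τ p D where
  cont := hD
  par := hpar
  leib f g := by
    refine PowSer.linearMap_ext (φ := D ∘ₗ LinearMap.mulRight K g)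
      (ψ := LinearMap.mulRight K g ∘ₗ D + LinearMap.mulRight K (D g) ∘ₗ sig τ p)
      (hD.comp (PowSer.continuous_mul_left g))
      (((PowSer.continuous_mul_left g).comp hD).add
        ((PowSer.continuous_mul_left _).comp (continuous_sig τ p))) ?_ (fun i f ih => ?_) f
    · simp [h1]
    · simp only [LinearMap.comp_apply, LinearMap.add_apply, LinearMap.mulRight_apply] at ih ⊢
      rw [mul_assoc, hgen, ih, hgen, sig_mul, sig_gen]
      simp only [mul_add, add_mul, smul_mul_assoc, smul_add, mul_assoc]
      abel
  sig q f := by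
    refine PowSer.linearMap_ext (φ := D ∘ₗ sig τ q) (ψ := sgn K (p * q) • (sig τ q ∘ₗ D))
      (hD.comp (continuous_sig τ q))
      (((continuous_sig τ q).comp hD).const_smul (sgn K (p * q))) ?_ (fun i f ih => ?_) f
    · simp [h1]
    · simp only [LinearMap.comp_apply, LinearMap.smul_apply] at ih ⊢
      rw [sig_mul, sig_gen, smul_mul_assoc, map_smul, hgen, hgen, ih, map_add, sig_mul,
        (hpar i).sig, map_smul, sig_mul, sig_gen]
      simp only [smul_add, smul_smul, smul_mul_assoc, mul_smul_comm]
      congr 2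
      · rw [← sgn_add]
        apply sgn_congr
        ring_nf
        simp [parity_simps]
      · ring

/-- The operator `D ⊗ 1 + 1 ⊗ D` on `T̂W ⊗̂ T̂W`; its second summand includes the Koszul sign
`(-1)^{p|f|}` on `f ⊗ g`. -/
def IsDer.ext {p : ℤ} {D : Module.End K (PowSer I K)} (_ : IsDer τ p D) :
    Module.End K (Formal (List I × List I) K) :=
  opL D + opL (HodgeCyclic.sig τ p) ∘ₗ opR D

theorem IsDer.ext_tens {p : ℤ} {D : Module.End K (PowSer I K)} (h : IsDer τ p D)
    (f g : PowSer I K) : h.ext (tens f g) = tens (D f) g + tens (HodgeCyclic.sig τ p f) (D g) := by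
  simp [IsDer.ext]

theorem IsDer.continuous_ext {p : ℤ} {D : Module.End K (PowSer I K)} (h : IsDer τ p D) :
    Continuous h.ext :=
  (continuous_opL h.cont).add ((continuous_opL (continuous_sig τ p)).comp (continuous_opR h.cont))

theorem IsDer.ext_coprim {p : ℤ} {D : Module.End K (PowSer I K)} (h : IsDer τ p D) (i : I)
    (x : Formal (List I × List I) K) :
    h.ext (coprim τ (gen K i) x)
      = coprim τ (D (gen K i)) x + sgn K (p * τ i) • coprim τ (gen K i) (h.ext x) := by
  refine tens_linearMap_ext (φ := h.ext ∘ₗ coprim τ (gen K i))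
    (ψ := coprim τ (D (gen K i)) + sgn K (p * τ i) • (coprim τ (gen K i) ∘ₗ h.ext))
    (h.continuous_ext.comp (continuous_coprim _ _))
    ((continuous_coprim _ _).add
      (((continuous_coprim _ _).comp h.continuous_ext).const_smul (sgn K (p * τ i)))) ?_ x
  intro f g
  simp only [LinearMap.comp_apply, LinearMap.add_apply, LinearMap.smul_apply]
  rw [(par_gen i).coprim_tens, (h.par i).coprim_tens, h.ext_tens, map_add, map_add, h.ext_tens,
    h.ext_tens, (par_gen i).coprim_tens, (par_gen i).coprim_tens]
  simp only [h.gen_mul, h.sig, sig_mul, sig_gen, sig_sig, tens_add_left, tens_add_right,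
    tens_smul_left, tens_smul_right, smul_mul_assoc, smul_add, add_comm (τ i) p]
  abel

/-- A derivation mapping `W` to the free Lie algebra is a coderivation of the coproduct. -/
theorem IsDer.coprod {p : ℤ} {D : Module.End K (PowSer I K)} (h : IsDer τ p D)
    (hL : ∀ i, D (gen K i) ∈ lieAlg K τ) (f : PowSer I K) :
    coprod K τ (D f) = h.ext (coprod K τ f) := by
  refine PowSer.linearMap_ext (φ := HodgeCyclic.coprod K τ ∘ₗ D)
    (ψ := h.ext ∘ₗ HodgeCyclic.coprod K τ) ((continuous_coprod τ).comp h.cont)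
    (h.continuous_ext.comp (continuous_coprod τ)) ?_ (fun i f ih => ?_) f
  · simp only [LinearMap.comp_apply]
    rw [h.map_one, map_zero, coprod_one, h.ext_tens, h.map_one]
    ext p
    simp [tens_apply]
  · simp only [LinearMap.comp_apply] at ih ⊢
    rw [h.gen_mul, map_add, map_smul, coprod_gen_mul, coprod_gen_mul, coprod_lie_mul τ (hL i), ih,
      h.ext_coprim]

/-- A derivation mapping `W` to the free Lie algebra commutes with the modified shuffle operator,
as it is compatible with both `μ` and `Δ`. -/
theorem IsDer.shuffleOp {p : ℤ} {D : Module.End K (PowSer I K)} (h : IsDer τ p D)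
    (hL : ∀ i, D (gen K i) ∈ lieAlg K τ) (f : PowSer I K) :
    shuffleOp K τ (D f) = D (shuffleOp K τ f) := by
  have key : ∀ x, mulMap I K (h.ext x) = D (mulMap I K x) := by
    refine tens_linearMap_ext (φ := mulMap I K ∘ₗ h.ext) (ψ := D ∘ₗ mulMap I K)
      (continuous_mulMap.comp h.continuous_ext) (h.cont.comp continuous_mulMap) fun f g => ?_
    simp only [LinearMap.comp_apply]
    rw [h.ext_tens, map_add, mulMap_tens, mulMap_tens, mulMap_tens, h.leib]
  change mulMap I K (HodgeCyclic.coprod K τ (D f)) = D (mulMap I K (HodgeCyclic.coprod K τ f))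
  rw [h.coprod hL, key]

/-- Commutation with a homogeneous element is a derivation. -/
theorem Par.isDer {p : ℤ} {l : PowSer I K} (hl : Par τ p l) : IsDer τ p (commMap τ l) where
  cont := continuous_comm_right τ l
  leib f g := by
    simp only [commMap_apply, hl.comm_eq, sig_mul]
    noncomm_ring
  sig q f := by
    simp only [commMap_apply, hl.comm_eq, sig_mul, map_sub, sig_sig, hl.sig, smul_sub,
      smul_mul_assoc, mul_smul_comm, smul_smul, add_comm q p]
    rw [mul_comm q p, sgn_mul_self, one_smul, one_smul]
  par i := hl.comm (par_gen i)

theorem shuffleOp_comm {p : ℤ} {l : PowSer I K} (hp : Par τ p l) (hl : l ∈ lieAlg K τ)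
    (f : PowSer I K) : HodgeCyclic.shuffleOp K τ (comm τ l f)
      = comm τ l (HodgeCyclic.shuffleOp K τ f) :=
  hp.isDer.shuffleOp (fun i => comm_mem_lieAlg τ hl (gen_mem_lieAlg i)) f

theorem shuffleOp_one : HodgeCyclic.shuffleOp K τ (1 : PowSer I K) = 1 := by
  change mulMap I K (HodgeCyclic.coprod K τ 1) = 1
  rw [coprod_one, mulMap_tens, one_mul]

end Derivations

/-! ### Operators preserving the length of words -/

section Length

variable {I K : Type*} [CommRing K]

/-- The operator preserves `∏_{m ≠ n} W^{⊗m}` for all `n`; when it is continuous, it is a product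
of operators on the modules `W^{⊗n}`. -/
def LenPres (φ : Module.End K (PowSer I K)) : Prop :=
  ∀ n f, (∀ u : List I, u.length = n → f u = 0) → ∀ u : List I, u.length = n → φ f u = 0

theorem LenPres.eq {φ : Module.End K (PowSer I K)} (h : LenPres φ) {u : List I}
    {f g : PowSer I K} (hfg : ∀ v : List I, v.length = u.length → f v = g v) :
    φ f u = φ g u := by
  have := h u.length (f - g) (fun v hv => sub_eq_zero.2 (hfg v hv)) u rfl
  rw [map_sub] at this
  exact sub_eq_zero.1 this

theorem LenPres.one : LenPres (1 : Module.End K (PowSer I K)) := fun _ _ hf => hf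

theorem LenPres.mul {φ ψ : Module.End K (PowSer I K)} (hφ : LenPres φ) (hψ : LenPres ψ) :
    LenPres (φ * ψ) := fun n f hf => hφ n _ (hψ n f hf)

theorem LenPres.sub {φ ψ : Module.End K (PowSer I K)} (hφ : LenPres φ) (hψ : LenPres ψ) :
    LenPres (φ - ψ) := fun n f hf u hu => by
  rw [LinearMap.sub_apply, Formal.sub_apply, hφ n f hf u hu, hψ n f hf u hu, sub_zero]

theorem LenPres.pow {φ : Module.End K (PowSer I K)} (hφ : LenPres φ) (k : ℕ) :
    LenPres (φ ^ k) := by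
  induction k with
  | zero => exact .one
  | succ k ih => rw [pow_succ]; exact ih.mul hφ

theorem LenPres.smul {φ : Module.End K (PowSer I K)} (c : K) (hφ : LenPres φ) :
    LenPres (c • φ) := fun n f hf u hu => by
  rw [LinearMap.smul_apply, Formal.smul_apply, hφ n f hf u hu, mul_zero]

theorem LenPres.sum {ι : Type*} (s : Finset ι) {φ : ι → Module.End K (PowSer I K)}
    (hφ : ∀ i ∈ s, LenPres (φ i)) : LenPres (∑ i ∈ s, φ i) := fun n f hf u hu => by
  rw [LinearMap.sum_apply, Formal.sum_apply]
  exact Finset.sum_eq_zero fun i hi => hφ i hi n f hf u hu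

theorem LenPres.aeval {φ : Module.End K (PowSer I K)} (hφ : LenPres φ) (q : K[X]) :
    LenPres (Polynomial.aeval φ q) := by
  rw [aeval_eq_sum_range]
  exact .sum _ fun i _ => (hφ.pow i).smul _

theorem continuous_pow {φ : Module.End K (PowSer I K)} (hφ : Continuous φ) (k : ℕ) :
    Continuous (φ ^ k : Module.End K (PowSer I K)) := by
  induction k with
  | zero => exact continuous_id
  | succ k ih => rw [pow_succ]; exact ih.comp hφ

theorem continuous_aeval {φ : Module.End K (PowSer I K)} (hφ : Continuous φ) (q : K[X]) :
    Continuous (Polynomial.aeval φ q : Module.End K (PowSer I K)) := by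
  rw [aeval_eq_sum_range]
  have : ⇑(∑ i ∈ Finset.range (q.natDegree + 1), q.coeff i • φ ^ i : Module.End K (PowSer I K))
      = fun f => ∑ i ∈ Finset.range (q.natDegree + 1), q.coeff i • (φ ^ i) f :=
    funext fun f => by simp
  rw [this]
  exact continuous_finsetSum _ fun i _ => (continuous_pow hφ i).const_smul (q.coeff i)

/-- A continuous operator preserving lengths and vanishing on the words of length `n` vanishes on
`W^{⊗n}`. -/
theorem LenPres.eq_zero {φ : Module.End K (PowSer I K)} (h : LenPres φ) (hc : Continuous φ) {n : ℕ}
    (hw : ∀ w : List I, w.length = n → φ (Formal.single w 1) = 0) (f : PowSer I K) (u : List I)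
    (hu : u.length = n) : φ f u = 0 := by
  let π : Module.End K (PowSer I K) := Formal.diag fun w => if w.length = n then 1 else 0
  have hπ : Continuous π := Formal.continuous_diag _
  have key : π ∘ₗ φ = 0 := by
    refine Formal.linearMap_ext (hπ.comp hc) continuous_zero fun w => ?_
    ext v
    change (if v.length = n then 1 else 0) * φ (Formal.single w 1) v = 0
    by_cases hwn : w.length = n
    · rw [hw w hwn, Formal.zero_apply, mul_zero]
    · split_ifs with hv
      · rw [h n _ (fun u hu => Formal.single_of_ne (fun e => hwn (by rw [← e, hu])) _) v hv,
          mul_zero]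
      · rw [zero_mul]
  have := congrArg (fun g : PowSer I K => g u) (LinearMap.congr_fun key f)
  change (if u.length = n then 1 else 0) * φ f u = 0 at this
  rwa [if_pos hu, one_mul] at this

theorem lenPres_shuffleOp (τ : I → ℤ) : LenPres (shuffleOp K τ) := by
  have key : ∀ (f : List I → K) (a b : List I),
      (∀ u : List I, u.length = a.length + b.length → f u = 0) → coprodCoeff τ f a b = 0 := by
    intro f a b
    induction f, a, b using coprodCoeff.induct with
    | case1 f b => intro h; simpa [coprodCoeff] using h b (by simp)
    | case2 f i a => intro h; simpa [coprodCoeff] using h (i :: a) (by simp)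
    | case3 f i a j b h1 h2 =>
      intro h
      rw [coprodCoeff_cons_cons, h1, h2]
      · simp
      · exact fun u hu => h _ (by simp at hu ⊢; omega)
      · exact fun u hu => h _ (by simp at hu ⊢; omega)
  intro n f hf u hu
  change ∑ k ∈ Finset.range (u.length + 1), coprodCoeff τ f (u.take k) (u.drop k) = 0
  refine Finset.sum_eq_zero fun k _ => key f _ _ fun v hv => hf v ?_
  rw [hv, ← List.length_append, List.take_append_drop, hu]

end Length

/-! ### The spectrum of the modified shuffle operator -/

section Spectrum

variable {I K : Type*} [CommRing K] {τ : I → ℤ}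

/-- Products of `k` homogeneous Lie monomials. -/
inductive IsLieProd (K : Type*) [CommRing K] {I : Type*} (τ : I → ℤ) : ℕ → PowSer I K → Prop
  | one : IsLieProd K τ 0 1
  | mul {p : ℤ} {k : ℕ} {l x : PowSer I K} (hl : IsHomLie K τ p l) (hx : IsLieProd K τ k x) :
      IsLieProd K τ (k + 1) (l * x)

theorem IsLieProd.par {k : ℕ} {x : PowSer I K} (h : IsLieProd K τ k x) : ∃ p, Par τ p x := by
  induction h with
  | one => exact ⟨0, par_single []⟩
  | mul hl _ ih =>
    obtain ⟨q, hq⟩ := ih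
    exact ⟨_, hl.par.mul hq⟩

theorem IsLieProd.mul_mul {k k' : ℕ} {x y : PowSer I K} (hx : IsLieProd K τ k x)
    (hy : IsLieProd K τ k' y) : IsLieProd K τ (k + k') (x * y) := by
  induction hx with
  | one => simpa using hy
  | mul hl _ ih => rw [mul_assoc, add_right_comm]; exact .mul hl ih

theorem isLieProd_single (w : List I) : IsLieProd K τ w.length (Formal.single w 1) := by
  induction w with
  | nil => exact .one
  | cons i w ih => rw [single_cons]; exact .mul (.gen i) ih

/-- The span of the products of `k` Lie monomials; for `k = 0` it is set to zero, so that it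
contains no constants. -/
def lieProds (K : Type*) [CommRing K] {I : Type*} (τ : I → ℤ) (k : ℕ) :
    Submodule K (PowSer I K) :=
  Submodule.span K {x | 1 ≤ k ∧ IsLieProd K τ k x}

/-- The span of the products of at least one and at most `r` Lie monomials. -/
def lieFil (K : Type*) [CommRing K] {I : Type*} (τ : I → ℤ) (r : ℕ) : Submodule K (PowSer I K) :=
  Submodule.span K {x | ∃ k, 1 ≤ k ∧ k ≤ r ∧ IsLieProd K τ k x}

theorem lieProds_le_lieFil (k : ℕ) : lieProds K τ k ≤ lieFil K τ k :=
  Submodule.span_mono fun _ hx => ⟨k, hx.1, le_rfl, hx.2⟩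

theorem lieFil_mono {r r' : ℕ} (h : r ≤ r') : lieFil K τ r ≤ lieFil K τ r' :=
  Submodule.span_mono fun _ ⟨k, h1, h2, h3⟩ => ⟨k, h1, h2.trans h, h3⟩

theorem mul_mem_lieFil {p : ℤ} {l : PowSer I K} (hl : IsHomLie K τ p l) {r : ℕ} {x : PowSer I K}
    (hx : x ∈ lieFil K τ r) : l * x ∈ lieFil K τ (r + 1) := by
  have : lieFil K τ r ≤ (lieFil K τ (r + 1)).comap (LinearMap.mulLeft K l) :=
    Submodule.span_le.2 fun x ⟨k, h1, h2, h3⟩ =>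
      Submodule.subset_span ⟨k + 1, by omega, by omega, .mul hl h3⟩
  exact this hx

/-- The derivation `ad l` does not change the number of Lie factors of a product. -/
theorem comm_lieProd {p : ℤ} {l : PowSer I K} (hl : IsHomLie K τ p l) {k : ℕ} {x : PowSer I K}
    (hx : IsLieProd K τ k x) : comm τ l x ∈ lieProds K τ k := by
  induction hx with
  | one =>
    rw [hl.par.comm_eq]
    simp
  | @mul q k l' x hl' hx ih =>
    have h := hl.par.isDer.leib l' x
    simp only [commMap_apply] at h
    rw [h, hl'.par.sig, smul_mul_assoc]
    refine add_mem (Submodule.subset_span ⟨by omega, .mul (hl.comm hl') hx⟩)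
      (Submodule.smul_mem _ _ ?_)
    have : lieProds K τ k ≤ (lieProds K τ (k + 1)).comap (LinearMap.mulLeft K l') :=
      Submodule.span_le.2 fun x hx => Submodule.subset_span ⟨by omega, .mul hl' hx.2⟩
    exact this ih

/-- As Lie elements are primitive, the coproduct of a product of `k` Lie elements distributes these
over the two tensor factors. -/
theorem coprod_lieProd {k : ℕ} {x : PowSer I K} (hx : IsLieProd K τ k x) :
    coprod K τ x ∈ Submodule.span K {h | ∃ a b f g, a + b = k ∧ IsLieProd K τ a f ∧
      IsLieProd K τ b g ∧ h = tens f g} := by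
  induction hx with
  | one =>
    rw [coprod_one]
    exact Submodule.subset_span ⟨0, 0, 1, 1, rfl, .one, .one, rfl⟩
  | @mul p k l x hl hx ih =>
    rw [coprod_lie_mul τ hl.mem_lieAlg]
    refine (Submodule.span_le (p := Submodule.comap (coprim τ l) (Submodule.span K {h | ∃ a b f g,
      a + b = k + 1 ∧ IsLieProd K τ a f ∧ IsLieProd K τ b g ∧ h = tens f g}))).2 ?_ ih
    rintro _ ⟨a, b, f, g, hab, hf, hg, rfl⟩
    obtain ⟨q, hq⟩ := hf.par
    change coprim τ l (tens f g) ∈ Submodule.span _ _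
    rw [hl.par.coprim_tens, hq.sig, tens_smul_left]
    exact add_mem (Submodule.subset_span ⟨a + 1, b, _, _, by omega, .mul hl hf, hg, rfl⟩)
      (Submodule.smul_mem _ _
        (Submodule.subset_span ⟨a, b + 1, _, _, by omega, hf, .mul hl hg, rfl⟩))

/-- On products of `k` Lie elements, `s` is multiplication by `2^k` up to products with fewer
factors. -/
theorem shuffleOp_lieProd {k : ℕ} {x : PowSer I K} (hx : IsLieProd K τ k x) :
    shuffleOp K τ x - (2 : K) ^ k • x ∈ lieFil K τ (k - 1) := by
  induction hx with
  | one => rw [shuffleOp_one]; simp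
  | @mul p k l x hl hx ih =>
    -- `s (l x) = ∑ l x' x'' ± x' l x''`, and moving `l` to the front in `x' l x''` costs
    -- `[l, x'] x''`
    have h1 : shuffleOp K τ (l * x) - (2 : K) • (l * shuffleOp K τ x) ∈ lieProds K τ k := by
      change mulMap I K (coprod K τ (l * x)) - (2 : K) • (l * mulMap I K (coprod K τ x)) ∈ _
      rw [coprod_lie_mul τ hl.mem_lieAlg]
      refine (Submodule.span_le (p := (lieProds K τ k).comap (mulMap I K ∘ₗ coprim τ l
        - (2 : K) • (LinearMap.mulLeft K l ∘ₗ mulMap I K)))).2 ?_ (coprod_lieProd hx)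
      rintro _ ⟨a, b, f, g, hab, hf, hg, rfl⟩
      have h2 : (mulMap I K ∘ₗ coprim τ l - (2 : K) • (LinearMap.mulLeft K l ∘ₗ mulMap I K))
          (tens f g) = -(comm τ l f * g) := by
        change mulMap I K (coprim τ l (tens f g)) - (2 : K) • (l * mulMap I K (tens f g)) = _
        simp only [hl.par.coprim_tens, map_add, mulMap_tens, hl.par.comm_eq, sub_mul, mul_assoc,
          two_smul]
        abel
      change _ ∈ lieProds K τ k
      rw [h2]
      refine neg_mem ?_
      have : lieProds K τ a ≤ (lieProds K τ k).comap (LinearMap.mulRight K g) :=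
        Submodule.span_le.2 fun x hx =>
          Submodule.subset_span ⟨by have := hx.1; omega, hab ▸ hx.2.mul_mul hg⟩
      exact this (comm_lieProd hl hf)
    have h2 : l * (shuffleOp K τ x - (2 : K) ^ k • x) ∈ lieFil K τ k := by
      cases hx with
      | one => rw [shuffleOp_one]; simp
      | mul _ _ => exact mul_mem_lieFil hl ih
    have h3 := add_mem (lieProds_le_lieFil k h1) (Submodule.smul_mem _ (2 : K) h2)
    rw [Nat.add_sub_cancel]
    convert h3 using 1
    rw [mul_sub, smul_sub, mul_smul_comm, smul_smul, ← pow_succ']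
    abel

/-- On the span of the products of at most `r + 1` Lie elements, `s` is multiplication by `2^(r+1)`
up to products of at most `r` Lie elements. -/
theorem shuffleOp_sub_mem {r : ℕ} {x : PowSer I K} (hx : x ∈ lieFil K τ (r + 1)) :
    shuffleOp K τ x - (2 : K) ^ (r + 1) • x ∈ lieFil K τ r := by
  have : lieFil K τ (r + 1)
      ≤ (lieFil K τ r).comap (shuffleOp K τ - (2 : K) ^ (r + 1) • LinearMap.id) := by
    refine Submodule.span_le.2 ?_
    rintro x ⟨k, h1, h2, h3⟩
    change shuffleOp K τ x - (2 : K) ^ (r + 1) • x ∈ lieFil K τ r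
    have h4 := shuffleOp_lieProd h3
    rcases h2.eq_or_lt with rfl | h2
    · exact h4
    · have h5 : x ∈ lieFil K τ r := Submodule.subset_span ⟨k, h1, by omega, h3⟩
      have h6 := add_mem (lieFil_mono (show k - 1 ≤ r by omega) h4)
        (Submodule.smul_mem _ ((2 : K) ^ k) h5)
      rw [sub_add_cancel] at h6
      exact sub_mem h6 (Submodule.smul_mem _ _ h5)
  exact this hx

theorem aeval_shuffleOp_lieFil {n : ℕ} {x : PowSer I K} (hx : x ∈ lieFil K τ n) :
    aeval (shuffleOp K τ) (∏ r ∈ Finset.Icc 1 n, (X - C ((2 : K) ^ r))) x = 0 := by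
  induction n generalizing x with
  | zero =>
    have : lieFil K τ 0 = ⊥ := by
      refine Submodule.span_eq_bot.2 ?_
      rintro x ⟨k, h1, h2, h3⟩
      omega
    rw [this, Submodule.mem_bot] at hx
    rw [hx, map_zero]
  | succ n ih =>
    rw [Finset.prod_Icc_succ_top (by omega), map_mul, Module.End.mul_apply]
    refine ih ?_
    have := shuffleOp_sub_mem hx
    rw [aeval_sub, aeval_X, aeval_C, LinearMap.sub_apply, Module.algebraMap_end_apply]
    exact this

/-- The eigenvalues of `s` on `W^{⊗n}`, `n ≥ 1`, are among `2, 4, …, 2^n`: words of length `n` are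
products of `n` Lie elements. -/
theorem aeval_shuffleOp_eq_zero (τ : I → ℤ) (f : PowSer I K) {u : List I} (hu : u ≠ []) :
    aeval (shuffleOp K τ) (∏ r ∈ Finset.Icc 1 u.length, (X - C ((2 : K) ^ r))) f u = 0 := by
  refine ((lenPres_shuffleOp τ).aeval _).eq_zero (continuous_aeval (continuous_shuffleOp τ) _)
    (fun w hw => aeval_shuffleOp_lieFil ?_) f u rfl
  have := isLieProd_single (K := K) (τ := τ) w
  rw [hw] at this
  exact Submodule.subset_span ⟨_, List.length_pos_iff.2 hu, le_rfl, this⟩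

theorem shuffleOp_nil (τ : I → ℤ) (f : PowSer I K) : shuffleOp K τ f [] = f [] := by
  change ∑ k ∈ Finset.range 1, coprod K τ f (([] : List I).take k, ([] : List I).drop k) = f []
  simp [coprod_nil_left]

end Spectrum

/-! ### The cyclic operators -/

section Cyclic

variable {I K : Type*} [CommRing K] (τ : I → ℤ)

theorem cyc_nil (f : PowSer I K) : cyc K τ f [] = f [] := rfl

theorem cyc_concat (f : PowSer I K) (v : List I) (j : I) :
    cyc K τ f (v ++ [j]) = sgn K (τ j * wdeg τ v) * f (j :: v) := by
  change (if h : v ++ [j] = [] then f [] else sgn K (τ ((v ++ [j]).getLast h)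
    * wdeg τ (v ++ [j]).dropLast) * f ((v ++ [j]).getLast h :: (v ++ [j]).dropLast)) = _
  simp

theorem continuous_cyc : Continuous (cyc K τ) := by
  refine Formal.continuous_of_finite _ fun u => ?_
  rcases List.eq_nil_or_concat u with rfl | ⟨v, j, rfl⟩
  · exact ⟨{[]}, fun f g h => by rw [cyc_nil, cyc_nil, h _ (by simp)]⟩
  · exact ⟨{j :: v}, fun f g h => by
      rw [List.concat_eq_append, cyc_concat, cyc_concat, h _ (by simp)]⟩

theorem lenPres_cyc : LenPres (cyc K τ) := fun n f hf u hu => by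
  rcases List.eq_nil_or_concat u with rfl | ⟨v, j, rfl⟩
  · rw [cyc_nil, hf _ hu]
  · rw [List.concat_eq_append] at hu ⊢
    rw [cyc_concat, hf _ (by simpa using hu), mul_zero]

theorem mul_gen_nil (f : PowSer I K) (i : I) : (f * gen K i) [] = 0 := by
  rw [PowSer.mul_nil, gen, Formal.single_of_ne (by simp), mul_zero]

open Classical in
theorem mul_gen_concat (f : PowSer I K) (i : I) (v : List I) (j : I) :
    (f * gen K i) (v ++ [j]) = if j = i then f v else 0 := by
  induction v generalizing f with
  | nil =>
    rw [List.nil_append, PowSer.mul_cons, PowSer.mul_nil]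
    by_cases h : j = i
    · subst h
      rw [if_pos rfl, gen, Formal.single_self, Formal.single_of_ne (show [] ≠ [j] by simp)]
      simp
    · rw [if_neg h, gen, Formal.single_of_ne (by simp [h]),
        Formal.single_of_ne (show [] ≠ [i] by simp)]
      simp
  | cons k v ih =>
    rw [List.cons_append, PowSer.mul_cons, ih, gen, Formal.single_of_ne (by simp), mul_zero,
      zero_add]
    rfl

/-- The cyclic operator maps `x ⊗ y`, `x ∈ W`, to `± y ⊗ x`. -/
theorem cyc_gen_mul (i : I) (f : PowSer I K) :
    cyc K τ (gen K i * f) = sig τ (τ i) f * gen K i := by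
  ext u
  rcases List.eq_nil_or_concat u with rfl | ⟨v, j, rfl⟩
  · rw [cyc_nil, gen_mul_nil, mul_gen_nil]
  · rw [List.concat_eq_append, cyc_concat, mul_gen_concat, gen_mul_cons]
    split_ifs with h
    · rw [h, sig_apply]
    · rw [mul_zero]

theorem one_sub_cyc_gen_mul (i : I) (f : PowSer I K) :
    (1 - cyc K τ) (gen K i * f) = comm τ (gen K i) f := by
  rw [LinearMap.sub_apply, Module.End.one_apply, cyc_gen_mul, (par_gen i).comm_eq]

theorem cyc_mem_pos {f : PowSer I K} (hf : f ∈ pos I K) : cyc K τ f ∈ pos I K :=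
  (cyc_nil τ f).trans hf

theorem continuous_one_sub_cyc : Continuous (1 - cyc K τ : Module.End K (PowSer I K)) :=
  continuous_id.sub (continuous_cyc τ)

theorem lenPres_one_sub_cyc : LenPres (1 - cyc K τ : Module.End K (PowSer I K)) :=
  LenPres.one.sub (lenPres_cyc τ)

theorem cyc_pow_single (a b : List I) :
    (cyc K τ ^ a.length) (Formal.single (a ++ b) 1)
      = sgn K (wdeg τ a * wdeg τ b) • (Formal.single (b ++ a) 1 : PowSer I K) := by
  induction a generalizing b with
  | nil => simp
  | cons i a ih =>
    have h : (Formal.single (a ++ b) 1 : PowSer I K) * gen K i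
        = Formal.single (a ++ (b ++ [i])) 1 := by
      classical
      ext u
      rcases List.eq_nil_or_concat u with rfl | ⟨v, j, rfl⟩
      · rw [mul_gen_nil, Formal.single_of_ne (by simp)]
      · rw [List.concat_eq_append, mul_gen_concat, Formal.single_apply, Formal.single_apply,
          ← List.append_assoc a b [i]]
        by_cases hj : j = i <;> simp [hj, -List.append_assoc]
    rw [List.length_cons, pow_succ, Module.End.mul_apply, List.cons_append, single_cons,
      cyc_gen_mul, (par_single _).sig, smul_mul_assoc, h, map_smul, ih, smul_smul, ← sgn_add,
      List.append_assoc, List.singleton_append]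
    congr 1
    apply sgn_congr
    simp only [wdeg_append, wdeg_cons, wdeg_nil]
    ring_nf
    simp [parity_simps]

/-- On `W^{⊗n}`, `z^n = 1`. -/
theorem cyc_pow_length (f : PowSer I K) (u : List I) : (cyc K τ ^ u.length) f u = f u := by
  have h : LenPres (cyc K τ ^ u.length - 1) := ((lenPres_cyc τ).pow _).sub .one
  have hc : Continuous (cyc K τ ^ u.length - 1 : Module.End K (PowSer I K)) :=
    (continuous_pow (continuous_cyc τ) _).sub continuous_id
  refine sub_eq_zero.1 (h.eq_zero hc (fun w hw => ?_) f u rfl)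
  have := cyc_pow_single (K := K) τ w []
  rw [LinearMap.sub_apply, Module.End.one_apply, ← hw]
  simpa [sub_eq_zero] using this

theorem normOp_apply (f : PowSer I K) (u : List I) :
    normOp K τ f u = ∑ k ∈ Finset.range u.length, (cyc K τ ^ k) f u := rfl

/-- On `W^{⊗n}` the norm operator is a polynomial in `z`. -/
theorem normOp_apply' (f : PowSer I K) (u : List I) {n : ℕ} (hn : u.length = n) :
    normOp K τ f u = (∑ k ∈ Finset.range n, cyc K τ ^ k) f u := by
  rw [normOp_apply, hn, LinearMap.sum_apply, Formal.sum_apply]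

theorem normOp_nil (f : PowSer I K) : normOp K τ f [] = 0 := by
  rw [normOp_apply]; simp

theorem normOp_mem_pos (f : PowSer I K) : normOp K τ f ∈ pos I K := normOp_nil τ f

theorem continuous_normOp : Continuous (normOp K τ) := by
  refine Formal.continuous_iff.2 fun u => ?_
  let _ : TopologicalSpace K := ⊥
  have _ : DiscreteTopology K := ⟨rfl⟩
  change Continuous fun f => ∑ k ∈ Finset.range u.length, (cyc K τ ^ k) f u
  exact continuous_finsetSum _ fun k _ =>
    Formal.continuous_iff.1 (continuous_pow (K := K) (continuous_cyc τ) k) u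

theorem lenPres_normOp : LenPres (normOp K τ) := fun n f hf u hu => by
  rw [normOp_apply' τ f u hu]
  exact LenPres.sum _ (fun k _ => (lenPres_cyc τ).pow k) n f hf u hu

theorem sum_cyc_pow_mul (n : ℕ) : (∑ k ∈ Finset.range n, cyc K τ ^ k) * (1 - cyc K τ)
    = (1 - cyc K τ ^ n : Module.End K (PowSer I K)) := by
  have := geom_sum_mul (cyc K τ) n
  rw [← neg_inj, ← mul_neg, neg_sub, neg_sub, this]

theorem normOp_one_sub_cyc (f : PowSer I K) : normOp K τ ((1 - cyc K τ) f) = 0 := by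
  ext u
  rw [normOp_apply' τ _ u rfl, ← Module.End.mul_apply, sum_cyc_pow_mul, LinearMap.sub_apply,
    Formal.sub_apply, cyc_pow_length, Module.End.one_apply, sub_self, Formal.zero_apply]

theorem normOp_cyc (f : PowSer I K) : normOp K τ (cyc K τ f) = normOp K τ f := by
  have := normOp_one_sub_cyc τ f
  rw [LinearMap.sub_apply, Module.End.one_apply, map_sub, sub_eq_zero] at this
  exact this.symm

theorem normOp_cyc_pow (k : ℕ) (f : PowSer I K) :
    normOp K τ ((cyc K τ ^ k) f) = normOp K τ f := by
  induction k with
  | zero => rfl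
  | succ k ih => rw [pow_succ', Module.End.mul_apply, normOp_cyc, ih]

theorem one_sub_cyc_normOp (f : PowSer I K) : (1 - cyc K τ) (normOp K τ f) = 0 := by
  ext u
  rw [(lenPres_one_sub_cyc τ).eq (g := (∑ k ∈ Finset.range u.length, cyc K τ ^ k) f)
    (fun v hv => normOp_apply' τ f v hv), ← Module.End.mul_apply]
  have : (1 - cyc K τ) * (∑ k ∈ Finset.range u.length, cyc K τ ^ k)
      = (1 - cyc K τ ^ u.length : Module.End K (PowSer I K)) := by
    have := mul_geom_sum (cyc K τ) u.length
    rw [← neg_inj, ← neg_mul, neg_sub, neg_sub, this]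
  rw [this, LinearMap.sub_apply, Formal.sub_apply, cyc_pow_length, Module.End.one_apply, sub_self,
    Formal.zero_apply]

/-- On cyclic invariants of `W^{⊗n}`, the norm operator is multiplication by `n`. -/
theorem normOp_of_invariant {f : PowSer I K} (hf : (1 - cyc K τ) f = 0) (u : List I) :
    normOp K τ f u = u.length * f u := by
  have h1 : cyc K τ f = f := by
    rw [LinearMap.sub_apply, Module.End.one_apply, sub_eq_zero] at hf
    exact hf.symm
  have h2 : ∀ k, (cyc K τ ^ k) f = f := fun k => by
    induction k with
    | zero => rfl
    | succ k ih => rw [pow_succ, Module.End.mul_apply, h1, ih]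
  simp [normOp_apply, h2]

theorem normOp_single_append (a b : List I) :
    normOp K τ (Formal.single (a ++ b) 1)
      = sgn K (wdeg τ a * wdeg τ b) • normOp K τ (Formal.single (b ++ a) 1) := by
  rw [← normOp_cyc_pow τ a.length, cyc_pow_single, map_smul]

end Cyclic

/-! ### The operator `1 ⊗ φ` -/

section OneTensor

variable {I K : Type*} [CommRing K]

theorem oneTensor_nil (φ : Module.End K (PowSer I K)) (f : PowSer I K) :
    oneTensor φ f [] = 0 := rfl

theorem oneTensor_cons (φ : Module.End K (PowSer I K)) (f : PowSer I K) (i : I) (w : List I) :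
    oneTensor φ f (i :: w) = φ (Formal.reindex (i :: ·) f) w := rfl

theorem reindex_oneTensor (φ : Module.End K (PowSer I K)) (f : PowSer I K) (i : I) :
    Formal.reindex (i :: ·) (oneTensor φ f) = φ (Formal.reindex (i :: ·) f) := rfl

theorem oneTensor_gen_mul (φ : Module.End K (PowSer I K)) (i : I) (f : PowSer I K) :
    oneTensor φ (gen K i * f) = gen K i * φ f := by
  ext u
  match u with
  | [] => rw [oneTensor_nil, gen_mul_nil]
  | j :: w =>
    rw [oneTensor_cons, reindex_gen_mul, gen_mul_cons]
    split_ifs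
    · rfl
    · rw [map_zero, Formal.zero_apply]

theorem continuous_oneTensor {φ : Module.End K (PowSer I K)} (hφ : Continuous φ) :
    Continuous (oneTensor φ) := by
  refine Formal.continuous_iff.2 fun u => ?_
  match u with
  | [] =>
    let _ : TopologicalSpace K := ⊥
    exact continuous_const
  | i :: w => exact Formal.continuous_iff.1 (hφ.comp (Formal.continuous_reindex (i :: ·))) w

end OneTensor

/-! ### The modified shuffle operator and the cyclic operators -/

section ShuffleCyclic

variable {I K : Type*} [CommRing K] (τ : I → ℤ)

/-- `s (1 - z) = (1 - z) (1 ⊗ s)`: for `x ∈ W`, `(1 - z) (x ⊗ y) = [x, y]`, and `s` commutes with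
the commutator with `x`. -/
theorem shuffleOp_one_sub_cyc {f : PowSer I K} (hf : f ∈ pos I K) :
    shuffleOp K τ ((1 - cyc K τ) f) = (1 - cyc K τ) (oneTensor (shuffleOp K τ) f) := by
  refine PowSer.linearMap_ext_pos (φ := shuffleOp K τ ∘ₗ (1 - cyc K τ))
    (ψ := (1 - cyc K τ) ∘ₗ oneTensor (shuffleOp K τ))
    ((continuous_shuffleOp τ).comp (continuous_one_sub_cyc τ))
    ((continuous_one_sub_cyc τ).comp (continuous_oneTensor (continuous_shuffleOp τ)))
    (fun i f => ?_) hf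
  rw [LinearMap.comp_apply, LinearMap.comp_apply, oneTensor_gen_mul, one_sub_cyc_gen_mul,
    one_sub_cyc_gen_mul, shuffleOp_comm (par_gen i) (gen_mem_lieAlg i)]

/-- The graded interchange of the factors of `T̂W ⊗̂ T̂W`. -/
def swapOp : Module.End K (Formal (List I × List I) K) :=
  Formal.diag (fun p => sgn K (wdeg τ p.1 * wdeg τ p.2)) ∘ₗ Formal.reindex Prod.swap

theorem continuous_swapOp : Continuous (swapOp (K := K) τ) :=
  (Formal.continuous_diag _).comp (Formal.continuous_reindex _)

theorem swapOp_apply (h : Formal (List I × List I) K) (a b : List I) :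
    swapOp τ h (a, b) = sgn K (wdeg τ a * wdeg τ b) * h (b, a) := rfl

theorem swapOp_tens {p q : ℤ} {f g : PowSer I K} (hf : Par τ p f) (hg : Par τ q g) :
    swapOp τ (tens f g) = sgn K (p * q) • tens g f := by
  ext ⟨a, b⟩
  rw [swapOp_apply, tens_apply, Formal.smul_apply, tens_apply]
  rcases Int.even_or_odd (wdeg τ b - p) with hb | hb
  · rcases Int.even_or_odd (wdeg τ a - q) with ha | ha
    · rw [sgn_congr K (q := p * q)]
      · ring
      · have : wdeg τ a * wdeg τ b - p * q
            = wdeg τ a * (wdeg τ b - p) + (wdeg τ a - q) * p := by ring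
        rw [this]
        exact (hb.mul_left _).add (ha.mul_right _)
    · simp [hg _ ha]
  · simp [hf _ hb]

/-- The shuffle coproduct is cocommutative. -/
theorem swapOp_coprod (f : PowSer I K) : swapOp τ (coprod K τ f) = coprod K τ f := by
  have h1 : ∀ i x, swapOp τ (coprim τ (gen K i) x) = coprim τ (gen K i) (swapOp τ x) := by
    intro i x
    refine LinearMap.congr_fun (f := swapOp τ ∘ₗ coprim τ (gen K i))
      (g := coprim τ (gen K i) ∘ₗ swapOp τ) (Formal.linearMap_ext
        ((continuous_swapOp τ).comp (continuous_coprim τ _))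
        ((continuous_coprim τ _).comp (continuous_swapOp τ)) ?_) x
    rintro ⟨a, b⟩
    have ha := par_single (K := K) (τ := τ) a
    have hb := par_single (K := K) (τ := τ) b
    have hi := par_gen (K := K) (τ := τ) i
    rw [LinearMap.comp_apply, LinearMap.comp_apply, single_pair, hi.coprim_tens, map_add,
      swapOp_tens τ (hi.mul ha) hb, ha.sig, tens_smul_left, map_smul,
      swapOp_tens τ ha (hi.mul hb), swapOp_tens τ ha hb, map_smul, hi.coprim_tens, hb.sig,
      tens_smul_left, smul_add, smul_smul, smul_smul, ← sgn_add, ← sgn_add, add_comm]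
    congr 2
    · apply sgn_congr
      ring_nf
      simp [parity_simps]
    · congr 1
      ring
  refine PowSer.linearMap_ext (φ := swapOp τ ∘ₗ coprod K τ) (ψ := coprod K τ)
    ((continuous_swapOp τ).comp (continuous_coprod τ)) (continuous_coprod τ) ?_ (fun i f ih => ?_) f
  · rw [LinearMap.comp_apply, coprod_one]
    have h0 := par_single (K := K) (τ := τ) []
    exact (swapOp_tens τ h0 h0).trans (by simp; rfl)
  · rw [LinearMap.comp_apply] at ih ⊢
    rw [coprod_gen_mul, h1, ih]

/-- `N s = 2 N (1 ⊗ s)` on `x ⊗ y`, `x ∈ W`: in `s (x ⊗ y) = ∑ x y' y'' ± y' x y''` the two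
summands become equal after cyclic rotation, by cocommutativity. -/
theorem normOp_shuffleOp_gen_mul (i : I) (f : PowSer I K) :
    normOp K τ (shuffleOp K τ (gen K i * f))
      = (2 : K) • normOp K τ (gen K i * shuffleOp K τ f) := by
  have key : ∀ x, normOp K τ (mulMap I K (coprim τ (gen K i) x))
      = normOp K τ (gen K i * mulMap I K x) + normOp K τ (gen K i * mulMap I K (swapOp τ x)) := by
    have hm : Continuous fun x => normOp K τ (gen K i * mulMap I K x) :=
      (continuous_normOp τ).comp ((PowSer.continuous_mul_right _).comp continuous_mulMap)
    refine fun x => LinearMap.congr_fun (f := normOp K τ ∘ₗ mulMap I K ∘ₗ coprim τ (gen K i))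
      (g := normOp K τ ∘ₗ LinearMap.mulLeft K (gen K i) ∘ₗ mulMap I K
        + normOp K τ ∘ₗ LinearMap.mulLeft K (gen K i) ∘ₗ mulMap I K ∘ₗ swapOp τ)
      (Formal.linearMap_ext
        ((continuous_normOp τ).comp (continuous_mulMap.comp (continuous_coprim τ _)))
        (hm.add (hm.comp (continuous_swapOp τ))) ?_) x
    rintro ⟨a, b⟩
    have ha := par_single (K := K) (τ := τ) a
    have hb := par_single (K := K) (τ := τ) b
    have hi := par_gen (K := K) (τ := τ) i
    have hmul : ∀ a b : List I, (Formal.single a 1 : PowSer I K) * Formal.single b 1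
        = Formal.single (a ++ b) 1 := fun a b => by
      induction a with
      | nil => exact one_mul _
      | cons i a ih => rw [single_cons, mul_assoc, ih, List.cons_append, single_cons]
    change normOp K τ (mulMap I K (coprim τ (gen K i) _)) = normOp K τ (gen K i * mulMap I K _)
      + normOp K τ (gen K i * mulMap I K (swapOp τ _))
    rw [single_pair, hi.coprim_tens, swapOp_tens τ ha hb, map_add, map_smul, mulMap_tens,
      mulMap_tens, mulMap_tens, mulMap_tens, map_add, mul_assoc, ha.sig, smul_mul_assoc, map_smul,
      mul_smul_comm, map_smul, hmul b a, ← single_cons i b, ← single_cons i (b ++ a),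
      hmul a (i :: b), normOp_single_append, smul_smul, List.cons_append, ← sgn_add]
    congr 2
    apply sgn_congr
    rw [wdeg_cons]
    ring_nf
    simp [parity_simps]
  change normOp K τ (mulMap I K (coprod K τ (gen K i * f)))
    = (2 : K) • normOp K τ (gen K i * mulMap I K (coprod K τ f))
  rw [coprod_gen_mul, key, swapOp_coprod, two_smul]

/-- `N s = 2 N (1 ⊗ s)`. -/
theorem normOp_shuffleOp' {f : PowSer I K} (hf : f ∈ pos I K) :
    normOp K τ (shuffleOp K τ f) = (2 : K) • normOp K τ (oneTensor (shuffleOp K τ) f) := by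
  refine PowSer.linearMap_ext_pos (φ := normOp K τ ∘ₗ shuffleOp K τ)
    (ψ := (2 : K) • (normOp K τ ∘ₗ oneTensor (shuffleOp K τ)))
    ((continuous_normOp τ).comp (continuous_shuffleOp τ))
    (((continuous_normOp τ).comp
      (continuous_oneTensor (continuous_shuffleOp τ))).const_smul (2 : K))
    (fun i f => ?_) hf
  change normOp K τ (shuffleOp K τ (gen K i * f))
    = (2 : K) • normOp K τ (oneTensor (shuffleOp K τ) (gen K i * f))
  rw [oneTensor_gen_mul, normOp_shuffleOp_gen_mul]

theorem natCast_mul_cancel [Algebra ℚ K] {n : ℕ} (hn : n ≠ 0) {a b : K}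
    (h : (n : K) * a = n * b) : a = b := by
  have hu : IsUnit (n : K) := by
    have := (IsUnit.mk0 (n : ℚ) (by exact_mod_cast hn)).map (algebraMap ℚ K)
    simpa using this
  exact hu.mul_left_cancel h

/-- `N s = 2 (1 ⊗ s) N`: multiplied by `n` on `W^{⊗n}`, both sides equal `N s N`, since
`N s z = N s` and since `(1 ⊗ s) N` has cyclically invariant values. -/
theorem normOp_shuffleOp [Algebra ℚ K] {f : PowSer I K} (hf : f ∈ pos I K) :
    normOp K τ (shuffleOp K τ f) = (2 : K) • oneTensor (shuffleOp K τ) (normOp K τ f) := by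
  have hz : ∀ {f : PowSer I K}, f ∈ pos I K →
      normOp K τ (shuffleOp K τ (cyc K τ f)) = normOp K τ (shuffleOp K τ f) := fun {f} hf => by
    have h := normOp_one_sub_cyc τ (oneTensor (shuffleOp K τ) f)
    rw [← shuffleOp_one_sub_cyc τ hf, LinearMap.sub_apply, Module.End.one_apply, map_sub, map_sub,
      sub_eq_zero] at h
    exact h.symm
  have hpos : ∀ k, (cyc K τ ^ k) f ∈ pos I K := fun k => by
    induction k with
    | zero => exact hf
    | succ k ih => rw [pow_succ', Module.End.mul_apply]; exact cyc_mem_pos τ ih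
  have hzk : ∀ k, normOp K τ (shuffleOp K τ ((cyc K τ ^ k) f)) = normOp K τ (shuffleOp K τ f) :=
    fun k => by
      induction k with
      | zero => rfl
      | succ k ih => rw [pow_succ', Module.End.mul_apply, hz (hpos k), ih]
  have hinv : (1 - cyc K τ) (oneTensor (shuffleOp K τ) (normOp K τ f)) = 0 := by
    rw [← shuffleOp_one_sub_cyc τ (normOp_mem_pos τ f), one_sub_cyc_normOp, map_zero]
  ext u
  rcases eq_or_ne u [] with rfl | hu
  · rw [normOp_nil, Formal.smul_apply, oneTensor_nil, mul_zero]
  refine natCast_mul_cancel (n := u.length) (by simpa using hu) ?_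
  have h1 := normOp_of_invariant τ hinv u
  have h2 := congrArg (fun g : PowSer I K => g u) (normOp_shuffleOp' τ (normOp_mem_pos τ f))
  have h3 : (normOp K τ * shuffleOp K τ) (normOp K τ f) u
      = (normOp K τ * shuffleOp K τ) ((∑ k ∈ Finset.range u.length, cyc K τ ^ k) f) u :=
    ((lenPres_normOp τ).mul (lenPres_shuffleOp τ)).eq fun v hv => normOp_apply' τ f v hv
  simp only [Module.End.mul_apply, LinearMap.sum_apply, map_sum, hzk] at h3
  rw [Finset.sum_const, Finset.card_range, ← Nat.cast_smul_eq_nsmul K, Formal.smul_apply] at h3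
  simp only [Formal.smul_apply] at h2
  rw [← h3, h2, h1, Formal.smul_apply]
  ring

end ShuffleCyclic

/-! ### The derivation of `T̂W` extending a map on `W` -/

section DerExt

variable {I K : Type*} [CommRing K] {τ : I → ℤ}

theorem continuous_derExt {ξ : Formal I K →ₗ[K] PowSer I K} (hξ : Continuous ξ) :
    Continuous (derExt τ ξ) := by
  refine Formal.continuous_iff.2 fun u => ?_
  let _ : TopologicalSpace K := ⊥
  have _ : DiscreteTopology K := ⟨rfl⟩
  change Continuous fun f => ∑ k ∈ Finset.range (u.length + 1),
    ∑ l ∈ Finset.range ((u.drop k).length + 1), sgn K (wdeg τ (u.take k)) *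
      ξ (Formal.reindex (fun i => u.take k ++ i :: (u.drop k).drop l) f) ((u.drop k).take l)
  exact continuous_finsetSum _ fun k _ => continuous_finsetSum _ fun l _ =>
    continuous_const.mul (Formal.continuous_iff.1 (hξ.comp (Formal.continuous_reindex
      fun i => u.take k ++ i :: (u.drop k).drop l)) ((u.drop k).take l))

theorem derExt_apply (ξ : Formal I K →ₗ[K] PowSer I K) (f : PowSer I K) (u : List I) :
    derExt τ ξ f u =
      ∑ k ∈ Finset.range (u.length + 1), ∑ l ∈ Finset.range ((u.drop k).length + 1),
        sgn K (wdeg τ (u.take k)) *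
          ξ (Formal.reindex (fun i => u.take k ++ i :: (u.drop k).drop l) f) ((u.drop k).take l) :=
  rfl

theorem derExt_one (ξ : Formal I K →ₗ[K] PowSer I K) : derExt τ ξ 1 = 0 := by
  ext u
  rw [derExt_apply]
  refine Finset.sum_eq_zero fun k _ => Finset.sum_eq_zero fun l _ => ?_
  have : Formal.reindex (fun i => u.take k ++ i :: (u.drop k).drop l) (1 : PowSer I K) = 0 :=
    Formal.ext fun i => Formal.single_of_ne (by simp) _
  rw [this, map_zero, Formal.zero_apply, mul_zero]

theorem derExt_gen_mul' (ξ : Formal I K →ₗ[K] PowSer I K) (i : I) (f : PowSer I K) :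
    derExt τ ξ (gen K i * f)
      = ξ (Formal.single i 1) * f + sgn K (τ i) • (gen K i * derExt τ ξ f) := by
  classical
  ext u
  -- the terms with `k = 0` replace the letter `t i`, those with `k > 0` a letter of `f`
  have h0 : ∑ l ∈ Finset.range ((u.drop 0).length + 1), sgn K (wdeg τ (u.take 0)) *
      ξ (Formal.reindex (fun j => u.take 0 ++ j :: (u.drop 0).drop l) (gen K i * f))
        ((u.drop 0).take l) = (ξ (Formal.single i 1) * f) u := by
    rw [PowSer.mul_apply]
    refine Finset.sum_congr rfl fun l _ => ?_
    have : Formal.reindex (fun j => u.take 0 ++ j :: (u.drop 0).drop l) (gen K i * f)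
        = f (u.drop l) • Formal.single i 1 := by
      ext j
      change (gen K i * f) (j :: u.drop l) = f (u.drop l) * (Formal.single i 1 : Formal I K) j
      rw [gen_mul_cons, Formal.single_apply]
      simp
    rw [this, map_smul, Formal.smul_apply]
    simp [mul_comm]
  rw [derExt_apply, Finset.sum_range_succ', h0, add_comm, Formal.add_apply, Formal.smul_apply]
  congr 1
  match u with
  | [] => simp [gen_mul_nil]
  | j :: u =>
    have h1 : ∀ k l, Formal.reindex (fun i => (j :: u).take (k + 1) ++ i :: ((j :: u).drop
        (k + 1)).drop l) (gen K i * f) = if j = i then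
          Formal.reindex (fun i => u.take k ++ i :: (u.drop k).drop l) f else 0 := fun k l => by
      ext i'
      change (gen K i * f) (j :: (u.take k ++ i' :: (u.drop k).drop l)) = _
      rw [gen_mul_cons]
      split_ifs <;> rfl
    rw [gen_mul_cons]
    simp only [h1]
    split_ifs with hj
    · subst hj
      rw [derExt_apply, Finset.mul_sum]
      refine Finset.sum_congr rfl fun k _ => ?_
      rw [Finset.mul_sum]
      refine Finset.sum_congr rfl fun l _ => ?_
      rw [List.take_succ_cons, List.drop_succ_cons, wdeg_cons, sgn_add, mul_assoc]
    · simp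

theorem derExt_gen (ξ : Formal I K →ₗ[K] PowSer I K) (i : I) :
    derExt τ ξ (gen K i) = ξ (Formal.single i 1) := by
  have := derExt_gen_mul' (τ := τ) ξ i 1
  rwa [mul_one, mul_one, derExt_one, mul_zero, smul_zero, add_zero] at this

theorem isDer_derExt {ξ : Formal I K →ₗ[K] PowSer I K} (hξ : Continuous ξ)
    (hpar : ∀ i, Par τ (1 + τ i) (ξ (Formal.single i 1))) : IsDer τ 1 (derExt τ ξ) :=
  isDer_of_gen (continuous_derExt hξ) (derExt_one ξ) (fun i => by rw [derExt_gen]; exact hpar i)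
    fun i f => by rw [derExt_gen, one_mul, derExt_gen_mul']

theorem IsDer.map_comm {p q : ℤ} {D : Module.End K (PowSer I K)} (h : IsDer τ p D)
    {x : PowSer I K} (hx : Par τ q x) (hDx : Par τ (p + q) (D x)) (y : PowSer I K) :
    D (comm τ x y) = comm τ (D x) y + sgn K (p * q) • comm τ x (D y) := by
  rw [hx.comm_eq, hx.comm_eq, hDx.comm_eq, map_sub, h.leib, h.leib, h.sig, hx.sig, sig_sig,
    smul_sub, smul_mul_assoc, smul_mul_assoc]
  abel

end DerExt

/-! ### The differential `b'` -/

section BPrime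

variable {I K : Type*} [CommRing K] {𝒜 : ℤ → AddSubgroup K} {d : I → ℤ}

/-- Since the ground ring is evenly graded, the coefficients do not contribute to parities. -/
theorem par_of_homog (h𝒜 : ∀ n, Odd n → 𝒜 n = ⊥) {τ : I → ℤ} {n : ℤ} {f : PowSer I K}
    (hf : f ∈ homog 𝒜 τ n) : Par τ n f := fun w hw => by
  have h := hf w
  rw [h𝒜 _ (by rw [← neg_sub]; exact hw.neg), AddSubgroup.mem_bot] at h
  exact h

theorem gen_mem_homog [GradedRing 𝒜] (τ : I → ℤ) (i : I) : gen K i ∈ homog 𝒜 τ (τ i) := fun w => by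
  classical
  rw [gen, Formal.single_apply]
  split_ifs with h
  · subst h
    simpa using SetLike.GradedOne.one_mem (A := 𝒜)
  · exact zero_mem _

theorem sgn_mul_mem {p n : ℤ} {x : K} (hx : x ∈ 𝒜 n) : sgn K p * x ∈ 𝒜 n := by
  rcases Int.even_or_odd p with h | h
  · rwa [sgn_of_even K h, one_mul]
  · rw [sgn_of_odd K h, neg_one_mul]
    exact neg_mem hx

theorem mem_of_eq {m n : ℤ} {x : K} (hx : x ∈ 𝒜 n) (h : n = m) : x ∈ 𝒜 m := h ▸ hx

theorem comm_mem_homog [GradedRing 𝒜] {τ : I → ℤ} {p q : ℤ} {x y : PowSer I K}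
    (hx : x ∈ homog 𝒜 τ p) (hy : y ∈ homog 𝒜 τ q) : comm τ x y ∈ homog 𝒜 τ (p + q) := fun u => by
  refine sum_mem fun k _ => sub_mem ?_ (sgn_mul_mem ?_)
  · refine mem_of_eq (SetLike.GradedMul.mul_mem (hx _) (hy _)) ?_
    rw [wdeg_split τ u k]; ring
  · refine mem_of_eq (SetLike.GradedMul.mul_mem (hy _) (hx _)) ?_
    rw [wdeg_split τ u k]; ring

theorem IsHomLie.mem_homog [GradedRing 𝒜] {τ : I → ℤ} {p : ℤ} {x : PowSer I K}
    (h : IsHomLie K τ p x) : x ∈ homog 𝒜 τ p := by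
  induction h with
  | gen i => exact gen_mem_homog τ i
  | comm _ _ hx hy => exact comm_mem_homog hx hy

variable (m : CInftyStructure 𝒜 d)

theorem CInftyStructure.onLetters_single (i : I) :
    m.onLetters (Formal.single i 1) = m.m ⟨gen K i, gen_mem_lieAlg i⟩ := by
  change ((m.m ⟨letter (Formal.single i 1), _⟩ : lieAlg K (dualDeg d)) : PowSer I K) = _
  congr 3
  exact letter_single i

theorem CInftyStructure.continuous_onLetters : Continuous m.onLetters :=
  continuous_subtype_val.comp (m.continuous_m.comp
    (continuous_letter.subtype_mk (letter_mem_lieAlg (dualDeg d))))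

theorem CInftyStructure.isDer_bPrime [GradedRing 𝒜] (h𝒜 : ∀ n, Odd n → 𝒜 n = ⊥) :
    IsDer (dualDeg d) 1 m.bPrime := by
  refine isDer_derExt m.continuous_onLetters fun i => ?_
  rw [m.onLetters_single, add_comm]
  exact par_of_homog h𝒜 (m.degree_one _ _ (gen_mem_homog (dualDeg d) i))

theorem CInftyStructure.bPrime_gen (i : I) :
    m.bPrime (gen K i) = m.m ⟨gen K i, gen_mem_lieAlg i⟩ :=
  (derExt_gen _ i).trans (m.onLetters_single i)

theorem CInftyStructure.bPrime_gen_mem (i : I) : m.bPrime (gen K i) ∈ lieAlg K (dualDeg d) := by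
  rw [m.bPrime_gen]
  exact (m.m _).2

/-- The derivation `b'` of `T̂W`, determined by the values of `m` on letters, extends `m`. -/
theorem CInftyStructure.bPrime_lie [GradedRing 𝒜] (h𝒜 : ∀ n, Odd n → 𝒜 n = ⊥)
    (x : lieAlg K (dualDeg d)) : m.bPrime x = m.m x := by
  have hD := m.isDer_bPrime h𝒜
  let E : Submodule K (lieAlg K (dualDeg d)) :=
    LinearMap.eqLocus (m.bPrime ∘ₗ (lieAlg K (dualDeg d)).subtype)
      ((lieAlg K (dualDeg d)).subtype ∘ₗ m.m)
  have hE : IsClosed (E : Set (lieAlg K (dualDeg d))) :=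
    isClosed_eq (hD.cont.comp continuous_subtype_val) (continuous_subtype_val.comp m.continuous_m)
  have hle : lieAlg K (dualDeg d) ≤ E.map (lieAlg K (dualDeg d)).subtype := by
    have hemb : Topology.IsClosedEmbedding (Subtype.val : lieAlg K (dualDeg d) → PowSer I K) :=
      (Submodule.isClosed_topologicalClosure _).isClosedEmbedding_subtypeVal
    refine lieAlg_le _ (hemb.isClosedMap _ hE) fun p x hx => ?_
    suffices h : m.bPrime x = m.m ⟨x, hx.mem_lieAlg⟩ from ⟨⟨x, hx.mem_lieAlg⟩, h, rfl⟩
    induction hx with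
    | gen i => exact m.bPrime_gen i
    | @comm p q x y hx hy ihx ihy =>
      have h1 := m.leibniz p ⟨x, hx.mem_lieAlg⟩ ⟨y, hy.mem_lieAlg⟩ hx.mem_homog
      have h2 : Par (dualDeg d) (1 + p) (m.bPrime x) := by
        rw [ihx, add_comm]
        exact par_of_homog h𝒜 (m.degree_one _ _ hx.mem_homog)
      rw [hD.map_comm hx.par h2, ihx, ihy, one_mul]
      exact h1.symm
  obtain ⟨y, hy, hyx⟩ := hle x.2
  have : y = x := Subtype.ext hyx
  rw [← this]
  exact hy

theorem CInftyStructure.bPrime_bPrime_gen [GradedRing 𝒜] (h𝒜 : ∀ n, Odd n → 𝒜 n = ⊥) (i : I) :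
    m.bPrime (m.bPrime (gen K i)) = 0 := by
  rw [m.bPrime_gen, m.bPrime_lie h𝒜, m.square_zero]
  rfl

/-- `b' b'` satisfies the product rule, as `b'` is odd, and it vanishes on letters. -/
theorem CInftyStructure.bPrime_bPrime [GradedRing 𝒜] (h𝒜 : ∀ n, Odd n → 𝒜 n = ⊥)
    (f : PowSer I K) : m.bPrime (m.bPrime f) = 0 := by
  have hD := m.isDer_bPrime h𝒜
  refine PowSer.linearMap_ext (φ := m.bPrime ∘ₗ m.bPrime) (ψ := 0) (hD.cont.comp hD.cont)
    continuous_zero ?_ (fun i f ih => ?_) f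
  · simp [hD.map_one]
  · rw [LinearMap.comp_apply, LinearMap.zero_apply] at ih ⊢
    rw [hD.gen_mul, map_add, map_smul, hD.gen_mul, ih, hD.leib, m.bPrime_bPrime_gen h𝒜,
      (hD.par i).sig, smul_mul_assoc, mul_zero, smul_zero, zero_mul, zero_add, add_zero, ← add_smul,
      one_mul, one_mul, sgn_add, sgn_one, neg_one_mul, neg_add_cancel, zero_smul]

end BPrime

/-! ### One-forms and cyclic derivatives -/

section Forms

variable {I K : Type*} [CommRing K] (τ : I → ℤ)

/-- The product of a one-form and a power series. -/
def rmulFun (ω : OneForms I K) (v : PowSer I K) : OneForms I K := fun p =>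
  ∑ l ∈ Finset.range (p.2.2.length + 1), ω (p.1, p.2.1, p.2.2.take l) * v (p.2.2.drop l)

theorem rmulFun_apply (ω : OneForms I K) (v : PowSer I K) (a : List I) (i : I) (c : List I) :
    rmulFun ω v (a, i, c)
      = (Formal.reindex (fun c => (a, i, c)) ω * v : PowSer I K) c := rfl

/-- Right multiplication of one-forms by power series. -/
def rmul : OneForms I K →ₗ[K] PowSer I K →ₗ[K] OneForms I K :=
  LinearMap.mk₂ K rmulFun
    (fun ω ω' v => by
      ext ⟨a, i, c⟩
      simp only [rmulFun_apply, map_add, add_mul, Formal.add_apply])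
    (fun r ω v => by
      ext ⟨a, i, c⟩
      simp only [rmulFun_apply, map_smul, smul_mul_assoc, Formal.smul_apply])
    (fun ω v v' => by
      ext ⟨a, i, c⟩
      simp only [rmulFun_apply, mul_add, Formal.add_apply])
    (fun r ω v => by
      ext ⟨a, i, c⟩
      simp only [rmulFun_apply, mul_smul_comm, Formal.smul_apply])

theorem rmul_apply (ω : OneForms I K) (v : PowSer I K) (a : List I) (i : I) (c : List I) :
    rmul ω v (a, i, c) = (Formal.reindex (fun c => (a, i, c)) ω * v : PowSer I K) c := rfl

/-- Left multiplication of one-forms by power series. -/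
def lmul (g : PowSer I K) : OneForms I K →ₗ[K] OneForms I K :=
  Formal.lin (fun ω p => (g * Formal.reindex (fun a => (a, p.2.1, p.2.2)) ω : PowSer I K) p.1)
    (fun ω ω' p => by simp only [map_add, mul_add, Formal.add_apply])
    (fun r ω p => by simp only [map_smul, mul_smul_comm, Formal.smul_apply])

theorem lmul_apply (g : PowSer I K) (ω : OneForms I K) (a : List I) (i : I) (c : List I) :
    lmul g ω (a, i, c) = (g * Formal.reindex (fun a => (a, i, c)) ω : PowSer I K) a := rfl

/-- The operator `ω ↦ (-1)^{p|ω|} ω` on one-forms. -/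
def sigForm (p : ℤ) : OneForms I K →ₗ[K] OneForms I K :=
  Formal.diag fun x => sgn K (p * (wdeg τ x.1 + (τ x.2.1 + 1) + wdeg τ x.2.2))

theorem continuous_rmul_left (v : PowSer I K) : Continuous fun ω : OneForms I K => rmul ω v := by
  classical
  refine Formal.continuous_of_finite _ fun p =>
    ⟨(Finset.range (p.2.2.length + 1)).image fun l => (p.1, p.2.1, p.2.2.take l),
      fun f g h => Finset.sum_congr (M := K) (s₁ := Finset.range (p.2.2.length + 1)) rfl
        fun l hl => ?_⟩
  rw [h _ (Finset.mem_image_of_mem _ hl)]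

theorem continuous_rmul_right (ω : OneForms I K) : Continuous (rmul ω) :=
  Formal.continuous_iff.2 fun p =>
    Formal.continuous_iff.1 (PowSer.continuous_mul_right
      (Formal.reindex (fun c => (p.1, p.2.1, c)) ω)) p.2.2

theorem continuous_dForm : Continuous (dForm (K := K) τ) :=
  Formal.continuous_of_finite _ fun p => ⟨{p.1 ++ p.2.1 :: p.2.2}, fun f g h => by
    change sgn K (wdeg τ p.1) * f _ = sgn K (wdeg τ p.1) * g _
    rw [h _ (by simp)]⟩

theorem rmul_rmul (ω : OneForms I K) (v v' : PowSer I K) :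
    rmul (rmul ω v) v' = rmul ω (v * v') := by
  ext ⟨a, i, c⟩
  rw [rmul_apply, rmul_apply, ← mul_assoc]
  rfl

theorem rmul_lmul (g v : PowSer I K) (ω : OneForms I K) :
    rmul (lmul g ω) v = lmul g (rmul ω v) := by
  ext ⟨a, i, c⟩
  rw [rmul_apply, lmul_apply, PowSer.mul_apply, PowSer.mul_apply]
  change ∑ l ∈ Finset.range (c.length + 1), (∑ k ∈ Finset.range (a.length + 1),
      g (a.take k) * ω (a.drop k, i, c.take l)) * v (c.drop l)
    = ∑ k ∈ Finset.range (a.length + 1), g (a.take k) *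
      ∑ l ∈ Finset.range (c.length + 1), ω (a.drop k, i, c.take l) * v (c.drop l)
  simp only [Finset.sum_mul, Finset.mul_sum, mul_assoc]
  exact Finset.sum_comm

theorem sigForm_rmul (p : ℤ) (ω : OneForms I K) (v : PowSer I K) :
    sigForm τ p (rmul ω v) = rmul (sigForm τ p ω) (sig τ p v) := by
  ext ⟨a, i, c⟩
  change sgn K (p * (wdeg τ a + (τ i + 1) + wdeg τ c)) * ∑ l ∈ Finset.range (c.length + 1),
      ω (a, i, c.take l) * v (c.drop l)
    = ∑ l ∈ Finset.range (c.length + 1),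
      (sgn K (p * (wdeg τ a + (τ i + 1) + wdeg τ (c.take l))) * ω (a, i, c.take l))
        * (sgn K (p * wdeg τ (c.drop l)) * v (c.drop l))
  rw [Finset.mul_sum]
  refine Finset.sum_congr rfl fun l _ => ?_
  have : p * (wdeg τ a + (τ i + 1) + wdeg τ c)
      = p * (wdeg τ a + (τ i + 1) + wdeg τ (c.take l)) + p * wdeg τ (c.drop l) := by
    rw [wdeg_split τ c l]; ring
  rw [this, sgn_add]
  ring

theorem sigForm_dForm (p : ℤ) (g : PowSer I K) :
    sigForm τ p (dForm τ g) = sgn K p • dForm τ (sig τ p g) := by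
  ext ⟨a, i, c⟩
  change sgn K (p * (wdeg τ a + (τ i + 1) + wdeg τ c)) * (sgn K (wdeg τ a) * g (a ++ i :: c))
    = sgn K p * (sgn K (wdeg τ a) * (sgn K (p * wdeg τ (a ++ i :: c)) * g (a ++ i :: c)))
  have : p * (wdeg τ a + (τ i + 1) + wdeg τ c) = p + p * wdeg τ (a ++ i :: c) := by
    rw [wdeg_append, wdeg_cons]; ring
  rw [this, sgn_add]
  ring

variable {τ} in
theorem Par.rotForm_lmul {p : ℤ} {g : PowSer I K} (hg : Par τ p g) (ω : OneForms I K) :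
    rotForm K τ (lmul g ω) = rotForm K τ (rmul (sigForm τ p ω) g) := by
  have : commForm τ g ω = lmul g ω - rmul (sigForm τ p ω) g := by
    ext ⟨a, i, c⟩
    refine congrArg₂ (fun x y : K => x - y) rfl (Finset.sum_congr rfl fun l _ => ?_)
    change sgn K (wdeg τ (c.drop l) * (wdeg τ a + (τ i + 1) + wdeg τ (c.take l))) *
        (ω (a, i, c.take l) * g (c.drop l))
      = (sgn K (p * (wdeg τ a + (τ i + 1) + wdeg τ (c.take l))) * ω (a, i, c.take l))
        * g (c.drop l)
    rcases Int.even_or_odd (wdeg τ (c.drop l) - p) with hu | hu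
    · rw [sgn_congr K (q := p * (wdeg τ a + (τ i + 1) + wdeg τ (c.take l))), mul_assoc]
      rw [← sub_mul]
      exact hu.mul_right _
    · rw [hg _ hu, mul_zero, mul_zero, mul_zero]
  have h := rotForm_commForm τ g ω
  rwa [this, map_sub, sub_eq_zero] at h

theorem dForm_one : dForm τ (1 : PowSer I K) = 0 := by
  ext ⟨a, i, c⟩
  change sgn K (wdeg τ a) * (1 : PowSer I K) (a ++ i :: c) = 0
  rw [PowSer.one_def, Formal.single_of_ne (by simp), mul_zero]

theorem dForm_gen_mul (j : I) (g : PowSer I K) :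
    dForm τ (gen K j * g)
      = thetaForm I K (gen K j * g) + sgn K (τ j) • lmul (gen K j) (dForm τ g) := by
  classical
  ext ⟨a, i, c⟩
  rw [Formal.add_apply, Formal.smul_apply, lmul_apply]
  match a with
  | [] =>
    change sgn K (wdeg τ []) * (gen K j * g) (i :: c) = (gen K j * g) (i :: c) + _
    rw [gen_mul_nil]
    simp
  | k :: a =>
    change sgn K (wdeg τ (k :: a)) * (gen K j * g) (k :: (a ++ i :: c)) = 0 + _
    rw [gen_mul_cons, gen_mul_cons]
    split_ifs with h
    · subst h
      change sgn K (wdeg τ (k :: a)) * g (a ++ i :: c)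
        = 0 + sgn K (τ k) * (sgn K (wdeg τ a) * g (a ++ i :: c))
      rw [wdeg_cons, sgn_add]
      ring
    · simp

theorem rmul_thetaForm {f : PowSer I K} (hf : f ∈ pos I K) (v : PowSer I K) :
    rmul (thetaForm I K f) v = thetaForm I K (f * v) := by
  have hf : f [] = 0 := hf
  ext ⟨a, i, c⟩
  rw [rmul_apply]
  match a with
  | [] =>
    change _ = (f * v) (i :: c)
    rw [PowSer.mul_cons, hf, zero_mul, zero_add]
    rfl
  | k :: a =>
    have : Formal.reindex (fun c => (k :: a, i, c)) (thetaForm I K f) = 0 := rfl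
    rw [this, zero_mul]
    rfl

/-- The class of `d l · v` in `DR¹`, as an element of `W ⊗̂ T̂W`; the map `rotForm` induces the
inverse of `Θ`. -/
def cycDeriv : PowSer I K →ₗ[K] PowSer I K →ₗ[K] PowSer I K :=
  LinearMap.compr₂ (rmul ∘ₗ dForm τ) (rotForm K τ)

theorem cycDeriv_apply (l v : PowSer I K) :
    cycDeriv τ l v = rotForm K τ (rmul (dForm τ l) v) := rfl

theorem cycDeriv_mem_pos (l v : PowSer I K) : cycDeriv τ l v ∈ pos I K := rfl

theorem continuous_cycDeriv (l : PowSer I K) : Continuous (cycDeriv τ l) :=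
  (continuous_rotForm τ).comp (continuous_rmul_right _)

theorem continuous_cycDeriv_left (v : PowSer I K) : Continuous fun l => cycDeriv τ l v :=
  (continuous_rotForm τ).comp ((continuous_rmul_left v).comp (continuous_dForm τ))

theorem continuous_cycDeriv_flip (v : PowSer I K) : Continuous ((cycDeriv τ).flip v) :=
  continuous_cycDeriv_left τ v

theorem cycDeriv_one (v : PowSer I K) : cycDeriv τ 1 v = 0 := by
  rw [cycDeriv_apply, dForm_one, map_zero, LinearMap.zero_apply, map_zero]

/-- `d(t g) · v = dt · g v ± t · dg · v`, and `t` can be moved to the end in `DR¹`. -/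
theorem cycDeriv_gen_mul (j : I) (g v : PowSer I K) :
    cycDeriv τ (gen K j * g) v
      = gen K j * g * v + cycDeriv τ (sig τ (τ j) g) (sig τ (τ j) v * gen K j) := by
  have hpos : ∀ f : PowSer I K, gen K j * f ∈ pos I K := gen_mul_nil j
  rw [cycDeriv_apply, dForm_gen_mul, map_add, map_smul, LinearMap.add_apply, map_add,
    rmul_thetaForm (hpos g), mul_assoc, rotForm_thetaForm τ (hpos _), LinearMap.smul_apply,
    map_smul, rmul_lmul, (par_gen j).rotForm_lmul, sigForm_rmul, sigForm_dForm, map_smul,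
    LinearMap.smul_apply, map_smul, LinearMap.smul_apply, map_smul, smul_smul, sgn_mul_self,
    one_smul, rmul_rmul]
  rfl

theorem cycDeriv_gen (j : I) (v : PowSer I K) : cycDeriv τ (gen K j) v = gen K j * v := by
  have := cycDeriv_gen_mul τ j 1 v
  rwa [mul_one, sig_one, cycDeriv_one, add_zero] at this

variable {τ} in
/-- Continuous linear maps agree on power series of parity `p` if they agree on words of
parity `p`. -/
theorem Par.linearMap_ext {Y : Type*} {p : ℤ} {f : PowSer I K} (hf : Par τ p f)
    {φ ψ : PowSer I K →ₗ[K] Formal Y K} (hφ : Continuous φ) (hψ : Continuous ψ)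
    (h : ∀ w, Even (wdeg τ w - p) → φ (Formal.single w 1) = ψ (Formal.single w 1)) :
    φ f = ψ f := by
  classical
  let π : Module.End K (PowSer I K) := Formal.diag fun w => if Even (wdeg τ w - p) then 1 else 0
  have hπ : Continuous π := Formal.continuous_diag _
  have hπf : π f = f := by
    ext w
    change (if Even (wdeg τ w - p) then 1 else 0) * f w = f w
    split_ifs with hw
    · exact one_mul _
    · rw [hf w (Int.not_even_iff_odd.1 hw), mul_zero]
  have key : φ ∘ₗ π = ψ ∘ₗ π := by
    refine Formal.linearMap_ext (hφ.comp hπ) (hψ.comp hπ) fun w => ?_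
    have hw : π (Formal.single w 1)
        = (if Even (wdeg τ w - p) then (1 : K) else 0) • Formal.single w 1 := by
      ext v
      change (if Even (wdeg τ v - p) then 1 else 0) * (Formal.single w 1 : PowSer I K) v = _
      rw [Formal.smul_apply]
      by_cases hv : v = w
      · rw [hv]
      · rw [Formal.single_of_ne hv, mul_zero, mul_zero]
    rw [LinearMap.comp_apply, LinearMap.comp_apply, hw, map_smul, map_smul]
    split_ifs with he
    · rw [h w he]
    · rw [zero_smul, zero_smul]
  have := LinearMap.congr_fun key f
  rwa [LinearMap.comp_apply, LinearMap.comp_apply, hπf] at this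

theorem cycDeriv_single_mul (w : List I) (g v : PowSer I K) :
    cycDeriv τ (Formal.single w 1 * g) v = cycDeriv τ (Formal.single w 1) (g * v)
      + cycDeriv τ (sig τ (wdeg τ w) g) (sig τ (wdeg τ w) v * Formal.single w 1) := by
  induction w generalizing g v with
  | nil =>
    rw [← PowSer.one_def, one_mul, cycDeriv_one, wdeg_nil, sig_zero, sig_zero, mul_one, zero_add]
  | cons j w ih =>
    have hw := par_single (K := K) (τ := τ) w
    rw [single_cons, mul_assoc, cycDeriv_gen_mul, cycDeriv_gen_mul, sig_mul, hw.sig, sig_mul,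
      smul_mul_assoc, map_smul, map_smul, LinearMap.smul_apply, LinearMap.smul_apply, ih, sig_mul,
      sig_gen, sig_sig, sig_sig, smul_add, mul_smul_comm, smul_mul_assoc, map_smul, smul_smul,
      mul_comm (wdeg τ w), sgn_mul_self, one_smul, wdeg_cons, add_comm (wdeg τ w), add_assoc]
    simp only [mul_assoc]

variable {τ} in
/-- The product rule for cyclic derivatives. -/
theorem Par.cycDeriv_mul {p : ℤ} {f : PowSer I K} (hf : Par τ p f) (g v : PowSer I K) :
    cycDeriv τ (f * g) v
      = cycDeriv τ f (g * v) + cycDeriv τ (HodgeCyclic.sig τ p g) (HodgeCyclic.sig τ p v * f) := by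
  have h1 : Continuous ((cycDeriv τ).flip v ∘ₗ LinearMap.mulRight K g) := by
    rw [LinearMap.coe_comp]
    exact (continuous_cycDeriv_flip τ v).comp (PowSer.continuous_mul_left g)
  have h2 : Continuous (cycDeriv τ (HodgeCyclic.sig τ p g) ∘ₗ
      LinearMap.mulLeft K (HodgeCyclic.sig τ p v)) := by
    rw [LinearMap.coe_comp]
    exact (continuous_cycDeriv τ _).comp (PowSer.continuous_mul_right _)
  have h3 : Continuous ((cycDeriv τ).flip (g * v) + cycDeriv τ (HodgeCyclic.sig τ p g) ∘ₗ
      LinearMap.mulLeft K (HodgeCyclic.sig τ p v)) := by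
    change Continuous fun f => (cycDeriv τ).flip (g * v) f +
      (cycDeriv τ (HodgeCyclic.sig τ p g) ∘ₗ LinearMap.mulLeft K (HodgeCyclic.sig τ p v)) f
    exact (continuous_cycDeriv_flip τ (g * v)).add h2
  have key := hf.linearMap_ext h1 h3 fun w hw => by
    rw [LinearMap.comp_apply, LinearMap.add_apply, LinearMap.comp_apply, LinearMap.flip_apply,
      LinearMap.flip_apply, LinearMap.mulRight_apply, LinearMap.mulLeft_apply,
      cycDeriv_single_mul τ w g v, sig_congr τ hw, sig_congr τ hw]
  rwa [LinearMap.comp_apply, LinearMap.add_apply, LinearMap.comp_apply, LinearMap.flip_apply,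
    LinearMap.flip_apply, LinearMap.mulRight_apply, LinearMap.mulLeft_apply] at key

/-- `d[x, y] · v = dx · [y, v] - (-1)^{|x||y|} dy · [x, v]` in `DR¹`. -/
theorem cycDeriv_comm {p q : ℤ} {x y : PowSer I K} (hx : Par τ p x) (hy : Par τ q y)
    (v : PowSer I K) : cycDeriv τ (comm τ x y) v
      = cycDeriv τ x (comm τ y v) - sgn K (p * q) • cycDeriv τ y (comm τ x v) := by
  rw [hx.comm_eq, hy.comm_eq, hx.comm_eq, hy.sig, smul_mul_assoc, map_sub, map_smul,
    LinearMap.sub_apply, LinearMap.smul_apply, hx.cycDeriv_mul, hy.cycDeriv_mul, hy.sig, hx.sig,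
    map_smul, map_smul, LinearMap.smul_apply, LinearMap.smul_apply, map_sub, map_sub, smul_sub,
    smul_add, smul_smul, mul_comm q p, sgn_mul_self, one_smul]
  abel

/-- For `l` in the free Lie algebra, `d l · v` is a combination of the forms `dx · ad(…)(v)`, and
`s` commutes with the adjoint action of the free Lie algebra. -/
theorem oneTensor_shuffleOp_cycDeriv {l : PowSer I K} (hl : l ∈ lieAlg K τ) (v : PowSer I K) :
    oneTensor (shuffleOp K τ) (cycDeriv τ l v) = cycDeriv τ l (shuffleOp K τ v) := by
  have key : ∀ p x, IsHomLie K τ p x → ∀ v : PowSer I K,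
      oneTensor (shuffleOp K τ) (cycDeriv τ x v) = cycDeriv τ x (shuffleOp K τ v) := by
    intro p x hx
    induction hx with
    | gen i =>
      intro v
      rw [cycDeriv_gen, cycDeriv_gen, oneTensor_gen_mul]
    | comm hx hy ihx ihy =>
      intro v
      rw [cycDeriv_comm τ hx.par hy.par, cycDeriv_comm τ hx.par hy.par, map_sub, map_smul, ihx, ihy,
        shuffleOp_comm hx.par hx.mem_lieAlg, shuffleOp_comm hy.par hy.mem_lieAlg]
  refine lieAlg_le τ (S := LinearMap.eqLocus (oneTensor (shuffleOp K τ) ∘ₗ (cycDeriv τ).flip v)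
    ((cycDeriv τ).flip (shuffleOp K τ v))) (isClosed_eq ?_ ?_) (fun p x hx => key p x hx v) hl
  · exact (continuous_oneTensor (continuous_shuffleOp τ)).comp (continuous_cycDeriv_left τ v)
  · exact continuous_cycDeriv_left τ _

/-- The map `d l · v ↦ [l, v]` corresponds to `1 - z`. -/
theorem one_sub_cyc_cycDeriv (l v : PowSer I K) :
    (1 - cyc K τ) (cycDeriv τ l v) = comm τ l v := by
  have key : ∀ (w : List I) (v : PowSer I K),
      (1 - cyc K τ) (cycDeriv τ (Formal.single w 1) v) = comm τ (Formal.single w 1) v := by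
    intro w
    induction w with
    | nil =>
      intro v
      rw [(par_single _).comm_eq, ← PowSer.one_def, cycDeriv_one, map_zero]
      simp
    | cons j w ih =>
      intro v
      have hw := par_single (K := K) (τ := τ) w
      have hjw : Par τ (τ j + wdeg τ w) (gen K j * Formal.single w 1) := (par_gen j).mul hw
      rw [single_cons, cycDeriv_gen_mul, mul_assoc, map_add, one_sub_cyc_gen_mul, hw.sig, map_smul,
        LinearMap.smul_apply, map_smul, ih, (par_gen j).comm_eq, hw.comm_eq, hjw.comm_eq, sig_mul,
        hw.sig, sig_mul, sig_gen, sig_sig, smul_sub, mul_smul_comm, smul_mul_assoc, smul_mul_assoc,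
        smul_mul_assoc, smul_smul, mul_comm (wdeg τ w), sgn_mul_self, one_smul,
        add_comm (wdeg τ w)]
      simp only [mul_assoc]
      abel
  refine LinearMap.congr_fun (f := (1 - cyc K τ) ∘ₗ (cycDeriv τ).flip v) (g := (commMap τ).flip v)
    (Formal.linearMap_ext ?_ ?_ fun w => key w v) l
  · exact (continuous_one_sub_cyc τ).comp (continuous_cycDeriv_left τ v)
  · exact continuous_comm_left τ v

/-- Each of the letters of `w` contributes a cyclic rotation of `w v` to `dw · v`. -/
theorem normOp_cycDeriv_single (w : List I) (v : PowSer I K) :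
    normOp K τ (cycDeriv τ (Formal.single w 1) v)
      = (w.length : K) • normOp K τ (Formal.single w 1 * v) := by
  induction w generalizing v with
  | nil =>
    rw [← PowSer.one_def, cycDeriv_one, map_zero]
    simp
  | cons j w ih =>
    have hw := par_single (K := K) (τ := τ) w
    have h := normOp_cyc τ (gen K j * (Formal.single w 1 * v))
    rw [cyc_gen_mul, sig_mul, hw.sig, smul_mul_assoc, smul_mul_assoc, map_smul, mul_assoc] at h
    rw [single_cons, cycDeriv_gen_mul, map_add, hw.sig, map_smul, LinearMap.smul_apply, map_smul,
      ih, smul_comm, h, mul_assoc, List.length_cons, Nat.cast_succ, add_smul, one_smul, add_comm]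

/-- Under the isomorphism `Θ`, the de Rham differential `DR⁰ → DR¹` is the norm operator: both
sides are cyclically invariant and have the same image under `N`. -/
theorem cycDeriv_one_right [Algebra ℚ K] (f : PowSer I K) : cycDeriv τ f 1 = normOp K τ f := by
  suffices h : (cycDeriv τ).flip 1 = normOp K τ by
    rw [← LinearMap.flip_apply, h]
  refine Formal.linearMap_ext (continuous_cycDeriv_flip τ 1) (continuous_normOp τ) fun w => ?_
  rw [LinearMap.flip_apply]
  have hinv : (1 - cyc K τ) (cycDeriv τ (Formal.single w 1) 1) = 0 := by
    rw [one_sub_cyc_cycDeriv, (par_single w).comm_eq]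
    simp
  ext u
  rcases eq_or_ne u [] with rfl | hu
  · rw [normOp_nil]
    rfl
  refine natCast_mul_cancel (n := u.length) (by simpa using hu) ?_
  rw [← normOp_of_invariant τ hinv, normOp_cycDeriv_single, mul_one, Formal.smul_apply]
  by_cases hl : u.length = w.length
  · rw [hl]
  · rw [lenPres_normOp τ u.length (Formal.single w 1) (fun v hv => Formal.single_of_ne
      (fun e => hl (by rw [← hv, e])) _) u rfl, mul_zero, mul_zero]

end Forms

/-! ### The Hochschild differential -/

section LieForm

variable {I K : Type*} [CommRing K] {τ : I → ℤ}

theorem lieForm_apply (ξ : Formal I K →ₗ[K] PowSer I K) (ω : OneForms I K) (a : List I) (j : I)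
    (c : List I) : lieForm τ ξ ω (a, j, c) =
      derExt τ ξ (Formal.reindex (fun a => (a, j, c)) ω) a
        + sgn K (wdeg τ a + (τ j + 1)) * derExt τ ξ (Formal.reindex (fun c => (a, j, c)) ω) c
        - ∑ k ∈ Finset.range (a.length + 1), ∑ l ∈ Finset.range (c.length + 1),
            sgn K (wdeg τ (a.take k)) *
              dForm τ (ξ (Formal.reindex (fun i => (a.take k, i, c.drop l)) ω))
                (a.drop k, j, c.take l) := rfl

theorem continuous_lieForm {ξ : Formal I K →ₗ[K] PowSer I K} (hξ : Continuous ξ) :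
    Continuous (lieForm τ ξ) := by
  refine Formal.continuous_iff.2 ?_
  rintro ⟨a, j, c⟩
  let _ : TopologicalSpace K := ⊥
  have _ : DiscreteTopology K := ⟨rfl⟩
  have hD := continuous_derExt (τ := τ) hξ
  have h1 : Continuous fun ω : OneForms I K =>
      derExt τ ξ (Formal.reindex (fun a => (a, j, c)) ω) a :=
    Formal.continuous_iff.1 (hD.comp (Formal.continuous_reindex _)) a
  have h2 : Continuous fun ω : OneForms I K =>
      derExt τ ξ (Formal.reindex (fun c => (a, j, c)) ω) c :=
    Formal.continuous_iff.1 (hD.comp (Formal.continuous_reindex _)) c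
  have h3 : ∀ k l, Continuous fun ω : OneForms I K =>
      dForm τ (ξ (Formal.reindex (fun i => (a.take k, i, c.drop l)) ω)) (a.drop k, j, c.take l) :=
    fun k l => Formal.continuous_iff.1 ((continuous_dForm τ).comp
      (hξ.comp (Formal.continuous_reindex _))) _
  simp only [lieForm_apply]
  exact (h1.add (continuous_const.mul h2)).sub (continuous_finsetSum _ fun k _ =>
    continuous_finsetSum _ fun l _ => continuous_const.mul (h3 k l))

/-- `L_m (dx · v) = -d (m x) · v + (-1)^{|x| + 1} dx · m v` for `x ∈ W`. -/
theorem lieForm_thetaForm (ξ : Formal I K →ₗ[K] PowSer I K) (i : I) (v : PowSer I K) :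
    lieForm τ ξ (thetaForm I K (gen K i * v))
      = -rmul (dForm τ (ξ (Formal.single i 1))) v
        - sgn K (τ i) • thetaForm I K (gen K i * derExt τ ξ v) := by
  classical
  ext ⟨a, j, c⟩
  have h1 : Formal.reindex (fun a => (a, j, c)) (thetaForm I K (gen K i * v))
      = (gen K i * v) (j :: c) • (1 : PowSer I K) := by
    ext a
    match a with
    | [] =>
      rw [Formal.smul_apply, PowSer.one_def, Formal.single_self, mul_one]
      rfl
    | _ :: _ =>
      rw [Formal.smul_apply, PowSer.one_def, Formal.single_of_ne (by simp), mul_zero]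
      rfl
  have h2 : sgn K (wdeg τ a + (τ j + 1)) *
      derExt τ ξ (Formal.reindex (fun c => (a, j, c)) (thetaForm I K (gen K i * v))) c
      = -(sgn K (τ i) * thetaForm I K (gen K i * derExt τ ξ v) (a, j, c)) := by
    match a with
    | [] =>
      change sgn K (wdeg τ [] + (τ j + 1)) * derExt τ ξ (Formal.reindex (j :: ·) (gen K i * v)) c
        = -(sgn K (τ i) * (gen K i * derExt τ ξ v) (j :: c))
      rw [reindex_gen_mul, gen_mul_cons]
      split_ifs with h
      · rw [h, wdeg_nil, zero_add, sgn_add, sgn_one]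
        ring
      · rw [map_zero, Formal.zero_apply, mul_zero, mul_zero, neg_zero]
    | b :: a =>
      have h : Formal.reindex (fun c => (b :: a, j, c)) (thetaForm I K (gen K i * v)) = 0 := rfl
      have h' : thetaForm I K (gen K i * derExt τ ξ v) (b :: a, j, c) = 0 := rfl
      rw [h, h', map_zero, Formal.zero_apply, mul_zero, mul_zero, neg_zero]
  have h3 : ∑ k ∈ Finset.range (a.length + 1), ∑ l ∈ Finset.range (c.length + 1),
      sgn K (wdeg τ (a.take k)) * dForm τ (ξ (Formal.reindex (fun i => (a.take k, i, c.drop l))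
        (thetaForm I K (gen K i * v)))) (a.drop k, j, c.take l)
      = rmul (dForm τ (ξ (Formal.single i 1))) v (a, j, c) := by
    rw [Finset.sum_eq_single 0]
    · rw [rmul_apply, PowSer.mul_apply]
      refine Finset.sum_congr rfl fun l _ => ?_
      have : Formal.reindex (fun i => (a.take 0, i, c.drop l)) (thetaForm I K (gen K i * v))
          = v (c.drop l) • Formal.single i 1 := by
        ext i'
        change (gen K i * v) (i' :: c.drop l) = v (c.drop l) * (Formal.single i 1 : Formal I K) i'
        rw [gen_mul_cons, Formal.single_apply]
        simp
      rw [this, map_smul, map_smul, Formal.smul_apply, List.take_zero, List.drop_zero, wdeg_nil,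
        sgn_zero, one_mul, mul_comm]
      rfl
    · intro k hk hk0
      have ha : a.take k ≠ [] := by
        rw [ne_eq, List.take_eq_nil_iff, not_or]
        refine ⟨hk0, ?_⟩
        rintro rfl
        simp at hk
        omega
      obtain ⟨b, a', h⟩ := List.exists_cons_of_ne_nil ha
      refine Finset.sum_eq_zero fun l _ => ?_
      have : Formal.reindex (fun i => (a.take k, i, c.drop l))
          (thetaForm I K (gen K i * v)) = 0 := by
        rw [h]
        rfl
      rw [this, map_zero, map_zero, Formal.zero_apply, mul_zero]
    · simp
  rw [lieForm_apply, h1, h2, h3, map_smul, derExt_one, smul_zero, Formal.zero_apply, zero_add,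
    Formal.sub_apply, Formal.neg_apply, Formal.smul_apply]
  ring

end LieForm

section Hochschild

variable {I K : Type*} [CommRing K] {𝒜 : ℤ → AddSubgroup K} {d : I → ℤ}
  (m : CInftyStructure 𝒜 d)

theorem CInftyStructure.b_apply (f : PowSer I K) :
    m.b f = rotForm K (dualDeg d) (lieForm (dualDeg d) m.onLetters (thetaForm I K f)) := by
  set ω := lieForm (dualDeg d) m.onLetters (thetaForm I K f) with hω
  have h : (theta K (dualDeg d)).symm ((formCommutators K (dualDeg d)).mkQ ω)
      = ⟨rotForm K (dualDeg d) ω, rfl⟩ :=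
    (LinearEquiv.symm_apply_eq _).2 ((Submodule.Quotient.eq _).2 (sub_theta_rot_mem _ ω))
  change (((theta K (dualDeg d)).symm ((formCommutators K (dualDeg d)).mkQ ω) : pos I K) :
    PowSer I K) = _
  rw [h]

theorem CInftyStructure.b_mem_pos (f : PowSer I K) : m.b f ∈ pos I K := by
  rw [m.b_apply]
  rfl

theorem CInftyStructure.continuous_b : Continuous m.b := by
  have : ⇑m.b = fun f =>
      rotForm K (dualDeg d) (lieForm (dualDeg d) m.onLetters (thetaForm I K f)) :=
    funext m.b_apply
  rw [this]
  exact (continuous_rotForm _).comp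
    ((continuous_lieForm m.continuous_onLetters).comp continuous_thetaForm)

/-- `b (x ⊗ v) = -d (m x) · v - (-1)^{|x|} x ⊗ m v` for `x ∈ W`. -/
theorem CInftyStructure.b_gen_mul (i : I) (v : PowSer I K) :
    m.b (gen K i * v) = -cycDeriv (dualDeg d) (m.bPrime (gen K i)) v
      - sgn K (dualDeg d i) • (gen K i * m.bPrime v) := by
  have hpos : gen K i * m.bPrime v ∈ pos I K := gen_mul_nil _ _
  rw [m.b_apply, lieForm_thetaForm, map_sub, map_neg, map_smul]
  change _ - sgn K (dualDeg d i) • rotForm K (dualDeg d) (thetaForm I K (gen K i * m.bPrime v)) = _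
  rw [rotForm_thetaForm _ hpos]
  congr 2
  rw [cycDeriv_apply, m.bPrime_gen, m.onLetters_single]

variable [GradedRing 𝒜]

theorem CInftyStructure.shuffleOp_bPrime (h𝒜 : ∀ n, Odd n → 𝒜 n = ⊥)
    (f : PowSer I K) :
    shuffleOp K (dualDeg d) (m.bPrime f) = m.bPrime (shuffleOp K (dualDeg d) f) :=
  (m.isDer_bPrime h𝒜).shuffleOp m.bPrime_gen_mem f

theorem CInftyStructure.shuffleOp_b (h𝒜 : ∀ n, Odd n → 𝒜 n = ⊥)
    {f : PowSer I K} (hf : f ∈ pos I K) :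
    oneTensor (shuffleOp K (dualDeg d)) (m.b f)
      = m.b (oneTensor (shuffleOp K (dualDeg d)) f) := by
  have hs := continuous_oneTensor (continuous_shuffleOp (K := K) (dualDeg d))
  refine PowSer.linearMap_ext_pos (φ := oneTensor (shuffleOp K (dualDeg d)) ∘ₗ m.b)
    (ψ := m.b ∘ₗ oneTensor (shuffleOp K (dualDeg d))) (hs.comp m.continuous_b)
    (m.continuous_b.comp hs) (fun i v => ?_) hf
  rw [LinearMap.comp_apply, LinearMap.comp_apply, oneTensor_gen_mul, m.b_gen_mul, m.b_gen_mul,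
    map_sub, map_neg, map_smul, oneTensor_shuffleOp_cycDeriv _ (m.bPrime_gen_mem i),
    oneTensor_gen_mul, m.shuffleOp_bPrime h𝒜]

/-- `(1 - z) b = -b' (1 - z)`: on `t v`, both sides are computed from `(1 - z) (t v) = [t, v]` and
`b' [t, v] = [b' t, v] ± [t, b' v]`. -/
theorem CInftyStructure.one_sub_cyc_b (h𝒜 : ∀ n, Odd n → 𝒜 n = ⊥) {f : PowSer I K}
    (hf : f ∈ pos I K) :
    (1 - cyc K (dualDeg d)) (m.b f) + m.bPrime ((1 - cyc K (dualDeg d)) f) = 0 := by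
  have hD := m.isDer_bPrime h𝒜
  have hz := continuous_one_sub_cyc (K := K) (dualDeg d)
  have hc : Continuous fun f => (1 - cyc K (dualDeg d)) (m.b f)
      + m.bPrime ((1 - cyc K (dualDeg d)) f) :=
    (hz.comp m.continuous_b).add (hD.cont.comp hz)
  refine PowSer.linearMap_ext_pos
    (φ := (1 - cyc K (dualDeg d)) ∘ₗ m.b + m.bPrime ∘ₗ (1 - cyc K (dualDeg d))) (ψ := 0)
    hc continuous_zero (fun i v => ?_) hf
  rw [LinearMap.add_apply, LinearMap.comp_apply, LinearMap.comp_apply, LinearMap.zero_apply,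
    m.b_gen_mul, map_sub, map_neg, map_smul, one_sub_cyc_cycDeriv, one_sub_cyc_gen_mul,
    one_sub_cyc_gen_mul, hD.map_comm (par_gen i) (hD.par i), one_mul]
  abel

theorem CInftyStructure.b_cycDeriv_single (h𝒜 : ∀ n, Odd n → 𝒜 n = ⊥)
    (w : List I) (v : PowSer I K) :
    m.b (cycDeriv (dualDeg d) (Formal.single w 1) v)
      = -cycDeriv (dualDeg d) (m.bPrime (Formal.single w 1)) v
        - sgn K (wdeg (dualDeg d) w) •
          cycDeriv (dualDeg d) (Formal.single w 1) (m.bPrime v) := by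
  have hD := m.isDer_bPrime h𝒜
  induction w generalizing v with
  | nil =>
    rw [← PowSer.one_def, cycDeriv_one, cycDeriv_one, hD.map_one, map_zero, map_zero]
    simp
  | cons j w ih =>
    have hw := par_single (K := K) (τ := dualDeg d) w
    rw [single_cons, cycDeriv_gen_mul, cycDeriv_gen_mul, hD.gen_mul, map_add, map_add, map_smul,
      LinearMap.add_apply, LinearMap.smul_apply, (hD.par j).cycDeriv_mul, cycDeriv_gen_mul,
      mul_assoc, m.b_gen_mul, hw.sig, hw.sig, hD.leib, hw.sig, map_smul, map_smul,
      LinearMap.smul_apply, LinearMap.smul_apply, map_smul, ih, hD.leib, sig_sig]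
    have h1 := hD.sig (dualDeg d j) (Formal.single w 1)
    rw [hw.sig, map_smul] at h1
    have h2 : sig (dualDeg d) (dualDeg d j) (m.bPrime (Formal.single w 1))
        = (sgn K (dualDeg d j) * sgn K (dualDeg d j * wdeg (dualDeg d) w)) •
          m.bPrime (Formal.single w 1) := by
      rw [mul_smul, h1, one_mul, smul_smul, sgn_mul_self, one_smul]
    rw [h2, hD.sig]
    simp only [map_smul, map_add, LinearMap.smul_apply, smul_add, smul_sub, smul_neg, smul_smul,
      wdeg_cons, sgn_add, one_mul, add_mul, smul_mul_assoc, mul_smul_comm, mul_assoc, mul_add]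
    have h3 : ∀ x : K, sgn K (dualDeg d j) * (sgn K (dualDeg d j) * x) = x := fun x => by
      rw [← mul_assoc, sgn_mul_self, one_mul]
    rw [h3]
    module

/-- `L_m (df · v) = -d (m f) · v - (-1)^{|f|} df · m v`. -/
theorem CInftyStructure.b_cycDeriv (h𝒜 : ∀ n, Odd n → 𝒜 n = ⊥) {p : ℤ} {f : PowSer I K}
    (hf : Par (dualDeg d) p f) (v : PowSer I K) :
    m.b (cycDeriv (dualDeg d) f v) = -cycDeriv (dualDeg d) (m.bPrime f) v
      - sgn K p • cycDeriv (dualDeg d) f (m.bPrime v) := by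
  have hD := m.isDer_bPrime h𝒜
  have h1 := continuous_cycDeriv_flip (K := K) (dualDeg d) v
  have h2 := continuous_cycDeriv_flip (K := K) (dualDeg d) (m.bPrime v)
  have hc : Continuous fun f => m.b ((cycDeriv (dualDeg d)).flip v f)
      + (cycDeriv (dualDeg d)).flip v (m.bPrime f)
      + sgn K p • (cycDeriv (dualDeg d)).flip (m.bPrime v) f :=
    ((m.continuous_b.comp h1).add (h1.comp hD.cont)).add (h2.const_smul (sgn K p))
  have key := hf.linearMap_ext (φ := m.b ∘ₗ (cycDeriv (dualDeg d)).flip v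
    + (cycDeriv (dualDeg d)).flip v ∘ₗ m.bPrime
    + sgn K p • (cycDeriv (dualDeg d)).flip (m.bPrime v)) (ψ := 0) hc continuous_zero
    fun w hw => by
      rw [LinearMap.add_apply, LinearMap.add_apply, LinearMap.smul_apply, LinearMap.comp_apply,
        LinearMap.comp_apply, LinearMap.zero_apply, LinearMap.flip_apply, LinearMap.flip_apply,
        LinearMap.flip_apply, m.b_cycDeriv_single h𝒜, sgn_congr K hw]
      abel
  rw [LinearMap.add_apply, LinearMap.add_apply, LinearMap.smul_apply, LinearMap.comp_apply,
    LinearMap.comp_apply, LinearMap.zero_apply, LinearMap.flip_apply, LinearMap.flip_apply,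
    LinearMap.flip_apply] at key
  rw [← sub_eq_zero, ← key]
  abel

theorem CInftyStructure.b_b (h𝒜 : ∀ n, Odd n → 𝒜 n = ⊥) {f : PowSer I K} (hf : f ∈ pos I K) :
    m.b (m.b f) = 0 := by
  have hD := m.isDer_bPrime h𝒜
  refine PowSer.linearMap_ext_pos (φ := m.b ∘ₗ m.b) (ψ := 0) (m.continuous_b.comp m.continuous_b)
    continuous_zero (fun i v => ?_) hf
  rw [LinearMap.comp_apply, LinearMap.zero_apply, m.b_gen_mul, map_sub, map_neg, map_smul,
    m.b_cycDeriv h𝒜 (hD.par i), m.b_gen_mul, m.bPrime_bPrime h𝒜, m.bPrime_bPrime h𝒜, map_zero,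
    LinearMap.zero_apply, mul_zero, smul_zero, sgn_add, sgn_one]
  module

/-- `b N = -N b'`: the operator `L_m` anticommutes with `d : DR⁰ → DR¹`. -/
theorem CInftyStructure.b_normOp [Algebra ℚ K] (h𝒜 : ∀ n, Odd n → 𝒜 n = ⊥) (f : PowSer I K) :
    m.b (normOp K (dualDeg d) f) + normOp K (dualDeg d) (m.bPrime f) = 0 := by
  have hD := m.isDer_bPrime h𝒜
  have hN := continuous_normOp (K := K) (dualDeg d)
  have hc : Continuous fun f => m.b (normOp K (dualDeg d) f) + normOp K (dualDeg d) (m.bPrime f) :=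
    (m.continuous_b.comp hN).add (hN.comp hD.cont)
  refine LinearMap.congr_fun (f := m.b ∘ₗ normOp K (dualDeg d) + normOp K (dualDeg d) ∘ₗ m.bPrime)
    (g := 0) (Formal.linearMap_ext hc continuous_zero fun w => ?_) f
  rw [LinearMap.add_apply, LinearMap.comp_apply, LinearMap.comp_apply, LinearMap.zero_apply,
    ← cycDeriv_one_right, ← cycDeriv_one_right, m.b_cycDeriv_single h𝒜, hD.map_one, map_zero]
  simp

end Hochschild

/-! ### Degrees -/

section Degrees

variable {I K : Type*} [CommRing K] {𝒜 : ℤ → AddSubgroup K} {τ : I → ℤ}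

theorem cyc_mem_homog {n : ℤ} {f : PowSer I K} (hf : f ∈ homog 𝒜 τ n) :
    cyc K τ f ∈ homog 𝒜 τ n := fun u => by
  rcases List.eq_nil_or_concat u with rfl | ⟨v, j, rfl⟩
  · exact hf []
  · rw [List.concat_eq_append, cyc_concat]
    refine sgn_mul_mem (mem_of_eq (hf _) ?_)
    simp [wdeg_append, add_comm]

theorem normOp_mem_homog {n : ℤ} {f : PowSer I K} (hf : f ∈ homog 𝒜 τ n) :
    normOp K τ f ∈ homog 𝒜 τ n := fun u => by
  have h : ∀ k, (cyc K τ ^ k) f ∈ homog 𝒜 τ n := fun k => by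
    induction k with
    | zero => exact hf
    | succ k ih => rw [pow_succ', Module.End.mul_apply]; exact cyc_mem_homog ih
  exact sum_mem (t := Finset.range u.length) fun k _ => h k u

theorem shuffleOp_mem_homog {n : ℤ} {f : PowSer I K} (hf : f ∈ homog 𝒜 τ n) :
    shuffleOp K τ f ∈ homog 𝒜 τ n := fun u => by
  have key : ∀ (f : List I → K) (a b : List I) (n : ℤ), (∀ w, f w ∈ 𝒜 (n - wdeg τ w)) →
      coprodCoeff τ f a b ∈ 𝒜 (n - (wdeg τ a + wdeg τ b)) := by
    intro f a b
    induction f, a, b using coprodCoeff.induct with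
    | case1 f b => intro n h; simpa [coprodCoeff] using h b
    | case2 f i a => intro n h; simpa [coprodCoeff] using h (i :: a)
    | case3 f i a j b h1 h2 =>
      intro n h
      rw [coprodCoeff_cons_cons]
      refine add_mem (mem_of_eq (h1 (n - τ i) fun w => mem_of_eq (h (i :: w)) ?_) ?_)
        (sgn_mul_mem (mem_of_eq (h2 (n - τ j) fun w => mem_of_eq (h (j :: w)) ?_) ?_))
      all_goals simp only [wdeg_cons]; ring
  refine sum_mem (t := Finset.range (u.length + 1)) fun k _ => ?_
  exact mem_of_eq (key f _ _ n hf) (by rw [wdeg_split τ u k])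

/-- The derivation extending a map of degree one on `W` has degree one. -/
theorem derExt_mem {ξ : Formal I K →ₗ[K] PowSer I K}
    (hξ : ∀ N g, (∀ i, g i ∈ 𝒜 (N - τ i)) → ξ g ∈ homog 𝒜 τ (N + 1)) {n : ℤ} {f : PowSer I K}
    (hf : f ∈ homog 𝒜 τ n) : derExt τ ξ f ∈ homog 𝒜 τ (n + 1) := fun u => by
  rw [derExt_apply]
  refine sum_mem fun k _ => sum_mem fun l _ => sgn_mul_mem ?_
  refine mem_of_eq (hξ (n - wdeg τ (u.take k) - wdeg τ ((u.drop k).drop l)) _ (fun i => ?_) _) ?_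
  · refine mem_of_eq (hf _) ?_
    rw [wdeg_append, wdeg_cons]
    ring
  · rw [wdeg_split τ u k, wdeg_split τ (u.drop k) l]
    ring

variable {d : I → ℤ} (m : CInftyStructure 𝒜 d)

theorem CInftyStructure.onLetters_mem (N : ℤ) (g : Formal I K)
    (hg : ∀ i, g i ∈ 𝒜 (N - dualDeg d i)) : m.onLetters g ∈ homog 𝒜 (dualDeg d) (N + 1) := by
  refine m.degree_one N ⟨letter g, letter_mem_lieAlg _ g⟩ fun w => ?_
  match w with
  | [] => exact zero_mem _
  | [i] => exact mem_of_eq (hg i) (by simp)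
  | _ :: _ :: _ => exact zero_mem _

theorem CInftyStructure.bPrime_mem_homog {n : ℤ} {f : PowSer I K}
    (hf : f ∈ homog 𝒜 (dualDeg d) n) : m.bPrime f ∈ homog 𝒜 (dualDeg d) (n + 1) :=
  derExt_mem m.onLetters_mem hf

theorem isClosed_pos : IsClosed (pos I K : Set (PowSer I K)) := by
  let _ : TopologicalSpace K := ⊥
  have _ : DiscreteTopology K := ⟨rfl⟩
  exact isClosed_singleton.preimage (Formal.continuous_eval (K := K) ([] : List I))

theorem lieAlg_le_pos (τ : I → ℤ) : lieAlg K τ ≤ pos I K := by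
  refine lieAlg_le τ isClosed_pos fun p x hx => ?_
  cases hx with
  | gen i => exact Formal.single_of_ne (by simp) _
  | @comm p q x y _ _ =>
    change ∑ k ∈ Finset.range 1, (x (([] : List I).take k) * y (([] : List I).drop k)
      - sgn K (wdeg τ (([] : List I).take k) * wdeg τ (([] : List I).drop k))
        * (y (([] : List I).take k) * x (([] : List I).drop k))) = 0
    simp [mul_comm]

theorem CInftyStructure.bPrime_mem_pos (f : PowSer I K) : m.bPrime f ∈ pos I K := by
  change derExt (dualDeg d) m.onLetters f [] = 0
  rw [derExt_apply]
  refine Finset.sum_eq_zero fun k _ => Finset.sum_eq_zero fun l _ => ?_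
  have h : ∀ g, m.onLetters g ((([] : List I).drop k).take l) = 0 := fun g => by
    rw [List.drop_nil, List.take_nil]
    exact lieAlg_le_pos (dualDeg d) (m.m _).2
  exact mul_eq_zero_of_right _ (h _)

theorem CInftyStructure.b_mem_homog {n : ℤ} {f : PowSer I K}
    (hf : f ∈ homog 𝒜 (dualDeg d) n) : m.b f ∈ homog 𝒜 (dualDeg d) (n + 1) := by
  set τ := dualDeg d with hτ
  have hθ : ∀ a i c, thetaForm I K f (a, i, c) ∈ 𝒜 (n - (wdeg τ a + τ i + wdeg τ c)) := by
    intro a i c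
    match a with
    | [] => exact mem_of_eq (hf (i :: c)) (by simp)
    | _ :: _ => exact zero_mem _
  have hL : ∀ a i c, lieForm τ m.onLetters (thetaForm I K f) (a, i, c)
      ∈ 𝒜 (n + 1 - (wdeg τ a + τ i + wdeg τ c)) := by
    intro a j c
    rw [lieForm_apply]
    refine sub_mem (add_mem ?_ (sgn_mul_mem ?_)) (sum_mem fun k _ => sum_mem fun l _ =>
      sgn_mul_mem (sgn_mul_mem ?_))
    · refine mem_of_eq (derExt_mem (n := n - τ j - wdeg τ c) m.onLetters_mem (fun a' => ?_) a) ?_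
      · exact mem_of_eq (hθ a' j c) (by ring)
      · ring
    · refine mem_of_eq (derExt_mem (n := n - τ j - wdeg τ a) m.onLetters_mem (fun c' => ?_) c) ?_
      · exact mem_of_eq (hθ a j c') (by ring)
      · ring
    · refine mem_of_eq (m.onLetters_mem (n - wdeg τ (a.take k) - wdeg τ (c.drop l)) _
        (fun i => ?_) _) ?_
      · exact mem_of_eq (hθ _ i _) (by ring)
      · rw [← hτ, wdeg_append, wdeg_cons, wdeg_split τ a k, wdeg_split τ c l]
        ring
  rw [m.b_apply]
  intro u
  match u with
  | [] => exact zero_mem _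
  | i :: w =>
    refine sum_mem (t := Finset.range (w.length + 1)) fun l _ => sgn_mul_mem ?_
    refine mem_of_eq (hL _ i _) ?_
    rw [wdeg_cons, wdeg_split τ w l]
    ring

end Degrees

/-! ### The Hodge operators -/

section Hodge

variable {I K : Type*} [CommRing K]

theorem aeval_apply_of_eigen {φ : Module.End K (PowSer I K)} {c : K} {f : PowSer I K}
    (h : φ f = c • f) (q : K[X]) : aeval φ q f = q.eval c • f := by
  induction q using Polynomial.induction_on' with
  | add p q hp hq => rw [map_add, LinearMap.add_apply, hp, hq, eval_add, add_smul]
  | monomial n a =>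
    rw [aeval_monomial, Module.End.mul_apply, Module.algebraMap_end_apply, eval_monomial, mul_smul]
    congr 1
    induction n with
    | zero => simp
    | succ n ih => rw [pow_succ, Module.End.mul_apply, h, map_smul, ih, smul_smul, ← pow_succ']

/-- A family converges to its sum if it is finite at each coordinate. -/
theorem Formal.hasSum {X ι : Type*} {g : ι → Formal X K} {f : Formal X K}
    (h : ∀ x, ∃ F : Finset ι, (∀ j ∉ F, g j x = 0) ∧ f x = ∑ j ∈ F, g j x) : HasSum g f := by
  classical
  let _ : TopologicalSpace K := ⊥
  have _ : DiscreteTopology K := ⟨rfl⟩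
  refine tendsto_pi_nhds (A := fun _ : X => K) |>.2 fun x => ?_
  obtain ⟨F, hF, hx⟩ := h x
  refine tendsto_const_nhds.congr' ?_
  rw [SummationFilter.unconditional_filter]
  filter_upwards [Filter.eventually_ge_atTop F] with G hG
  rw [Formal.sum_apply, hx]
  exact Finset.sum_subset hG fun j _ hj => hF j hj

theorem aeval_shuffleOp_range (τ : I → ℤ) (f : PowSer I K) (u : List I) :
    aeval (shuffleOp K τ) (∏ r ∈ Finset.range (u.length + 1), (X - C ((2 : K) ^ r))) f u = 0 := by
  rcases eq_or_ne u [] with rfl | hu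
  · simp [shuffleOp_nil]
  · have h : Finset.range (u.length + 1) = insert 0 (Finset.Icc 1 u.length) := by
      ext r
      simp only [Finset.mem_range, Finset.mem_insert, Finset.mem_Icc]
      omega
    rw [h, Finset.prod_insert (by simp), mul_comm, map_mul, Module.End.mul_apply]
    exact aeval_shuffleOp_eq_zero τ _ hu

variable [Algebra ℚ K] (τ : I → ℤ)

theorem algebraMap_mul_cancel {q : ℚ} (hq : q ≠ 0) {x : K} (h : algebraMap ℚ K q * x = 0) :
    x = 0 := by
  have hu : IsUnit (algebraMap ℚ K q) := (IsUnit.mk0 q hq).map _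
  exact hu.mul_right_eq_zero.1 h

theorem two_pow_ne {j r : ℕ} (h : j ≠ r) : (2 : ℚ) ^ j - 2 ^ r ≠ 0 :=
  sub_ne_zero.2 fun e => h (pow_right_injective₀ (by norm_num) (by norm_num) e)

/-- The eigenvalue `2^j` does not occur on `W^{⊗n}` for `j > n`, nor does `1` for `n > 0`. -/
theorem eigen_apply_eq_zero {j : ℕ} {f : PowSer I K} (hf : shuffleOp K τ f = (2 : K) ^ j • f)
    {u : List I} (hu : u.length < j ∨ j = 0 ∧ u ≠ []) : f u = 0 := by
  by_cases hnil : u = []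
  · subst hnil
    have hj : j ≠ 0 := by simpa [Nat.pos_iff_ne_zero] using hu
    have h := congrArg (fun g : PowSer I K => g []) hf
    simp only [shuffleOp_nil, Formal.smul_apply] at h
    refine algebraMap_mul_cancel (two_pow_ne hj) ?_
    rw [map_sub, map_pow, pow_zero, map_ofNat, map_one, sub_mul, one_mul, ← h, sub_self]
  · have h := aeval_shuffleOp_eq_zero τ f hnil
    rw [aeval_apply_of_eigen hf, Formal.smul_apply, eval_prod] at h
    refine algebraMap_mul_cancel (q := ∏ r ∈ Finset.Icc 1 u.length, ((2 : ℚ) ^ j - 2 ^ r))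
      (Finset.prod_ne_zero_iff.2 fun r hr => two_pow_ne ?_) ?_
    · rw [Finset.mem_Icc] at hr
      omega
    · simp only [eval_sub, eval_X, eval_C] at h
      rw [map_prod]
      simp only [map_sub, map_pow, map_ofNat]
      exact h

theorem hodgeProj_apply (j : ℕ) (f : PowSer I K) (u : List I) : hodgeProj τ j f u
    = aeval (shuffleOp K τ) ((lagrangePoly u.length j).map (algebraMap ℚ K)) f u := rfl

theorem hodgeProj_apply' {n : ℕ} (j : ℕ) (f : PowSer I K) (u : List I) (hu : u.length = n) :
    hodgeProj τ j f u = aeval (shuffleOp K τ) ((lagrangePoly n j).map (algebraMap ℚ K)) f u := by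
  rw [hodgeProj_apply, hu]

theorem hodgeProj_of_lt {j : ℕ} (f : PowSer I K) {u : List I} (hu : u.length < j) :
    hodgeProj τ j f u = 0 := by
  rw [hodgeProj_apply, lagrangePoly, if_neg (by omega)]
  simp

theorem continuous_hodgeProj (j : ℕ) : Continuous (hodgeProj (K := K) τ j) :=
  Formal.continuous_iff.2 fun u =>
    Formal.continuous_iff.1 (continuous_aeval (continuous_shuffleOp τ) _) u

theorem lenPres_hodgeProj (j : ℕ) : LenPres (hodgeProj (K := K) τ j) := fun n f hf u hu => by
  rw [hodgeProj_apply]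
  exact (lenPres_shuffleOp τ).aeval _ n f hf u hu

/-- The values of `e(j)` are `2^j`-eigenvectors of `s`: `(X - 2^j) e_n(j)` is a multiple of a
polynomial annihilating `s_n`. -/
theorem shuffleOp_hodgeProj (j : ℕ) (f : PowSer I K) :
    shuffleOp K τ (hodgeProj τ j f) = (2 : K) ^ j • hodgeProj τ j f := by
  ext u
  rw [(lenPres_shuffleOp τ).eq
    (g := aeval (shuffleOp K τ) ((lagrangePoly u.length j).map (algebraMap ℚ K)) f)
    (fun v hv => hodgeProj_apply' τ j f v hv), Formal.smul_apply, hodgeProj_apply]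
  by_cases hj : j ≤ u.length
  · rw [lagrangePoly, if_pos hj]
    set q := Lagrange.basis (Finset.range (u.length + 1)) (fun r => (2 : ℚ) ^ r) j with hq
    have h1 : (X - C ((2 : ℚ) ^ j)) * q
        = C (∏ r ∈ (Finset.range (u.length + 1)).erase j, ((2 : ℚ) ^ j - 2 ^ r)⁻¹)
          * ∏ r ∈ Finset.range (u.length + 1), (X - C ((2 : ℚ) ^ r)) := by
      have hmem : j ∈ Finset.range (u.length + 1) := Finset.mem_range.2 (by omega)
      rw [← Finset.mul_prod_erase _ _ hmem, hq, Lagrange.basis, map_prod]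
      simp only [Lagrange.basisDivisor, Finset.prod_mul_distrib]
      ring
    have h2 := congrArg (fun q : ℚ[X] => aeval (shuffleOp K τ) (q.map (algebraMap ℚ K)) f u) h1
    simp only [Polynomial.map_mul, Polynomial.map_sub, Polynomial.map_X, Polynomial.map_C,
      Polynomial.map_prod] at h2
    rw [map_mul, map_mul, Module.End.mul_apply, Module.End.mul_apply, aeval_C,
      Module.algebraMap_end_apply, Formal.smul_apply, map_sub, aeval_X, aeval_C,
      LinearMap.sub_apply, Module.algebraMap_end_apply, Formal.sub_apply, Formal.smul_apply] at h2
    simp only [map_pow, map_ofNat] at h2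
    have h3 := aeval_shuffleOp_range τ f u
    simp only [map_pow, map_ofNat] at h3
    rw [h3, mul_zero] at h2
    exact sub_eq_zero.1 h2
  · rw [lagrangePoly, if_neg hj]
    simp

/-- `e(k)` is the projection onto the `2^k`-eigenspace of `s`. -/
theorem hodgeProj_of_eigen {j : ℕ} {f : PowSer I K} (hf : shuffleOp K τ f = (2 : K) ^ j • f)
    (k : ℕ) : hodgeProj τ k f = if k = j then f else 0 := by
  ext u
  rw [hodgeProj_apply, aeval_apply_of_eigen hf, Formal.smul_apply]
  have h2 : (2 : K) ^ j = algebraMap ℚ K (2 ^ j) := by rw [map_pow, map_ofNat]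
  have hinj : Set.InjOn (fun r : ℕ => (2 : ℚ) ^ r) (Finset.range (u.length + 1)) :=
    (pow_right_injective₀ (by norm_num) (by norm_num)).injOn
  by_cases hj : u.length < j
  · rw [eigen_apply_eq_zero τ hf (Or.inl hj), mul_zero]
    split_ifs
    · exact (eigen_apply_eq_zero τ hf (Or.inl hj)).symm
    · rfl
  · have hj' : j ∈ Finset.range (u.length + 1) := Finset.mem_range.2 (by omega)
    rw [h2, eval_map_algebraMap, aeval_algebraMap_apply, lagrangePoly]
    split_ifs with h h' h'
    · subst h'
      rw [coe_aeval_eq_eval, Lagrange.eval_basis_self hinj hj', map_one, one_mul]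
    · rw [coe_aeval_eq_eval, Lagrange.eval_basis_of_ne h' hj', map_zero, zero_mul,
        Formal.zero_apply]
    · omega
    · simp

theorem hodgeProj_hodgeProj (j k : ℕ) (f : PowSer I K) :
    hodgeProj τ k (hodgeProj τ j f) = if k = j then hodgeProj τ j f else 0 :=
  hodgeProj_of_eigen τ (shuffleOp_hodgeProj τ j f) k

/-- The idempotents `e(j)` resolve the identity: only `e(0), …, e(n)` are nonzero on `W^{⊗n}`. -/
theorem sum_hodgeProj (f : PowSer I K) {u : List I} {n : ℕ} (hn : u.length ≤ n) :
    f u = ∑ j ∈ Finset.range (n + 1), hodgeProj τ j f u := by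
  have hinj : Set.InjOn (fun r : ℕ => (2 : ℚ) ^ r) (Finset.range (u.length + 1)) :=
    (pow_right_injective₀ (by norm_num) (by norm_num)).injOn
  have h1 := Lagrange.sum_basis hinj ⟨0, by simp⟩
  have h2 := congrArg (fun q : ℚ[X] => aeval (shuffleOp K τ) (q.map (algebraMap ℚ K)) f u) h1
  simp only [Polynomial.map_sum, map_sum, LinearMap.sum_apply, Formal.sum_apply,
    Polynomial.map_one, map_one, Module.End.one_apply] at h2
  rw [← Finset.sum_subset (Finset.range_mono (Nat.succ_le_succ hn))
    fun j _ hj => hodgeProj_of_lt τ f (by simpa using hj), ← h2]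
  refine Finset.sum_congr rfl fun j hj => ?_
  rw [hodgeProj_apply, lagrangePoly, if_pos (by simp at hj; omega)]

theorem hasSum_hodgeProj (f : PowSer I K) : HasSum (fun j => hodgeProj τ j f) f :=
  Formal.hasSum fun u => ⟨Finset.range (u.length + 1), fun _ hj =>
    hodgeProj_of_lt τ f (by simpa using hj), sum_hodgeProj τ f le_rfl⟩

theorem hodgeProj_mem_pos {f : PowSer I K} (hf : f ∈ pos I K) (j : ℕ) :
    hodgeProj τ j f ∈ pos I K :=
  lenPres_hodgeProj τ j 0 f (fun u hu => by rw [List.length_eq_zero_iff.1 hu]; exact hf) [] rfl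

theorem eigen_zero {f : PowSer I K} (hf : f ∈ pos I K) (hs : shuffleOp K τ f = (2 : K) ^ 0 • f) :
    f = 0 := by
  ext u
  by_cases hu : u = []
  · rw [hu]
    exact hf
  · exact eigen_apply_eq_zero τ hs (Or.inr ⟨rfl, hu⟩)

/-- Since `s` has no eigenvalue `1` on `W^{⊗n}`, `n ≥ 1`, the operator `e(0)` vanishes there. -/
theorem hodgeProj_zero {f : PowSer I K} (hf : f ∈ pos I K) : hodgeProj τ 0 f = 0 :=
  eigen_zero τ (hodgeProj_mem_pos τ hf 0) (shuffleOp_hodgeProj τ 0 f)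

theorem hodgeProjTilde_apply (j : ℕ) (f : PowSer I K) (i : I) (w : List I) :
    hodgeProjTilde τ j f (i :: w) = hodgeProj τ j (Formal.reindex (i :: ·) f) w := rfl

theorem oneTensor_hodgeProjTilde (j : ℕ) (f : PowSer I K) :
    oneTensor (shuffleOp K τ) (hodgeProjTilde τ j f) = (2 : K) ^ j • hodgeProjTilde τ j f := by
  ext u
  match u with
  | [] => exact (mul_zero _).symm
  | i :: w =>
    rw [oneTensor_cons, hodgeProjTilde, reindex_oneTensor, shuffleOp_hodgeProj]
    rfl

theorem hodgeProjTilde_of_eigen {j : ℕ} {f : PowSer I K} (hpos : f ∈ pos I K)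
    (hf : oneTensor (shuffleOp K τ) f = (2 : K) ^ j • f) (k : ℕ) :
    hodgeProjTilde τ k f = if k = j then f else 0 := by
  ext u
  match u with
  | [] =>
    have : f [] = 0 := hpos
    split_ifs
    · exact this.symm
    · rfl
  | i :: w =>
    have h : shuffleOp K τ (Formal.reindex (i :: ·) f)
        = (2 : K) ^ j • Formal.reindex (i :: ·) f := by
      rw [← reindex_oneTensor, hf, map_smul]
    rw [hodgeProjTilde_apply, hodgeProj_of_eigen τ h]
    split_ifs <;> rfl

theorem hodgeProjTilde_mem_pos (j : ℕ) (f : PowSer I K) : hodgeProjTilde τ j f ∈ pos I K := rfl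

theorem hodgeProjTilde_of_lt {j : ℕ} (f : PowSer I K) {u : List I} (hu : u.length < j) :
    hodgeProjTilde τ j f u = 0 := by
  match u with
  | [] => rfl
  | i :: w => exact hodgeProj_of_lt τ _ (by simp at hu; omega)

theorem continuous_hodgeProjTilde (j : ℕ) : Continuous (hodgeProjTilde (K := K) τ j) :=
  continuous_oneTensor (continuous_hodgeProj τ j)

theorem hasSum_hodgeProjTilde {f : PowSer I K} (hf : f ∈ pos I K) :
    HasSum (fun j => hodgeProjTilde τ j f) f := by
  refine Formal.hasSum fun u => ⟨Finset.range (u.length + 1), fun j hj =>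
    hodgeProjTilde_of_lt τ f (by simpa using hj), ?_⟩
  match u with
  | [] =>
    have : f [] = 0 := hf
    rw [this, Finset.sum_eq_zero]
    exact fun j _ => hodgeProjTilde_mem_pos τ j f
  | i :: w =>
    exact sum_hodgeProj τ (Formal.reindex (i :: ·) f) (Nat.le_succ _)

/-- `e(j) (1 - z) = (1 - z) ẽ(j)`: by `s (1 - z) = (1 - z) s̃`, `1 - z` maps eigenvectors of `s̃` to
eigenvectors of `s`. -/
theorem hodgeProj_one_sub_cyc (j : ℕ) {f : PowSer I K} (hf : f ∈ pos I K) :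
    hodgeProj τ j ((1 - cyc K τ) f) = (1 - cyc K τ) (hodgeProjTilde τ j f) := by
  have h1 := ((hasSum_hodgeProjTilde τ hf).map (1 - cyc K τ) (continuous_one_sub_cyc τ)).map
    (hodgeProj τ j) (continuous_hodgeProj τ j)
  refine h1.unique ?_
  have h2 : ∀ k, hodgeProj τ j ((1 - cyc K τ) (hodgeProjTilde τ k f))
      = if j = k then (1 - cyc K τ) (hodgeProjTilde τ k f) else 0 := fun k => by
    refine hodgeProj_of_eigen τ ?_ j
    rw [shuffleOp_one_sub_cyc τ (hodgeProjTilde_mem_pos τ k f), oneTensor_hodgeProjTilde, map_smul]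
  have h3 := hasSum_single
    (f := ⇑(hodgeProj τ j) ∘ ⇑(1 - cyc K τ) ∘ fun k => hodgeProjTilde τ k f) j fun k hk => by
      rw [Function.comp_apply, Function.comp_apply, h2, if_neg (Ne.symm hk)]
  rw [Function.comp_apply, Function.comp_apply, h2, if_pos rfl] at h3
  exact h3

end Hodge

/-! ### Cyclic coinvariants and commutators -/

section Coinvariants

variable {I K : Type*} [CommRing K] (τ : I → ℤ)

theorem isClosed_ker_normOp :
    IsClosed ((pos I K ⊓ LinearMap.ker (normOp K τ) : Submodule K (PowSer I K)) :
      Set (PowSer I K)) := by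
  have : IsClosed (LinearMap.ker (normOp K τ) : Set (PowSer I K)) :=
    isClosed_singleton.preimage (continuous_normOp τ)
  exact isClosed_pos.inter this

theorem normOp_of_mem_commutators {f : PowSer I K} (hf : f ∈ commutators K τ) :
    f ∈ pos I K ⊓ LinearMap.ker (normOp K τ) := by
  refine Submodule.topologicalClosure_minimal _ (Submodule.span_le.2 ?_) (isClosed_ker_normOp τ) hf
  rintro _ ⟨⟨l, v⟩, rfl⟩
  change comm τ l v ∈ pos I K ⊓ LinearMap.ker (normOp K τ)
  rw [Submodule.mem_inf, LinearMap.mem_ker, ← one_sub_cyc_cycDeriv τ l v]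
  refine ⟨?_, normOp_one_sub_cyc τ _⟩
  exact sub_mem (cycDeriv_mem_pos τ l v) (cyc_mem_pos τ (cycDeriv_mem_pos τ l v))

theorem one_sub_cyc_mem_commutators {f : PowSer I K} (hf : f ∈ pos I K) :
    (1 - cyc K τ) f ∈ commutators K τ := by
  refine pos_le (S := (commutators K τ).comap (1 - cyc K τ))
    ((Submodule.isClosed_topologicalClosure _).preimage (continuous_one_sub_cyc τ))
    (fun i f => ?_) hf
  rw [Submodule.mem_comap, one_sub_cyc_gen_mul]
  exact Submodule.le_topologicalClosure _ (Submodule.subset_span ⟨(gen K i, f), rfl⟩)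

theorem continuous_mkQ : Continuous (commutators K τ).mkQ := continuous_quot_mk

variable [Algebra ℚ K]

/-- The projection `N / n` on `W^{⊗n}`, `n ≥ 1`, onto the cyclic invariants, extended by the
identity to constants. -/
def cycAvg : Module.End K (PowSer I K) :=
  Formal.lin
    (fun f u => if u = [] then f [] else algebraMap ℚ K (u.length : ℚ)⁻¹ * normOp K τ f u)
    (fun f g u => by split_ifs <;> simp [mul_add])
    (fun c f u => by split_ifs <;> simp [mul_left_comm])

theorem cycAvg_nil (f : PowSer I K) : cycAvg τ f [] = f [] := rfl

theorem cycAvg_of_ne (f : PowSer I K) {u : List I} (hu : u ≠ []) :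
    cycAvg τ f u = algebraMap ℚ K (u.length : ℚ)⁻¹ * normOp K τ f u := if_neg hu

theorem inv_length_mul {u : List I} (hu : u ≠ []) (x : K) :
    algebraMap ℚ K (u.length : ℚ)⁻¹ * (u.length * x) = x := by
  have h : ((u.length : ℚ)⁻¹ * u.length) = 1 :=
    inv_mul_cancel₀ (by simpa using hu)
  rw [← mul_assoc, ← map_natCast (algebraMap ℚ K), ← map_mul, h, map_one, one_mul]

theorem continuous_cycAvg : Continuous (cycAvg (K := K) τ) := by
  let _ : TopologicalSpace K := ⊥
  have _ : DiscreteTopology K := ⟨rfl⟩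
  refine Formal.continuous_iff.2 fun u => ?_
  by_cases hu : u = []
  · subst hu
    exact Formal.continuous_eval []
  · change Continuous fun f : PowSer I K => if u = [] then f [] else _
    simp only [if_neg hu]
    exact continuous_of_discreteTopology.comp (Formal.continuous_iff.1 (continuous_normOp τ) u)

theorem lenPres_cycAvg : LenPres (cycAvg (K := K) τ) := fun n f hf u hu => by
  by_cases h : u = []
  · rw [h, cycAvg_nil, hf [] (by rw [← hu, h])]
  · rw [cycAvg_of_ne τ f h, lenPres_normOp τ n f hf u hu, mul_zero]

/-- A preimage under `1 - z` of the part of `f` in the kernel of `N`: on `W^{⊗n}` it is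
`-(1 / n) ∑_{k < n} k z^k f`. -/
def cycPrimitive : Module.End K (PowSer I K) :=
  Formal.lin
    (fun f u => -(algebraMap ℚ K (u.length : ℚ)⁻¹
      * ∑ k ∈ Finset.range u.length, (k : K) * (cyc K τ ^ k) f u))
    (fun f g u => by simp only [map_add, Formal.add_apply, mul_add, Finset.sum_add_distrib]; ring)
    (fun c f u => by
      simp only [map_smul, Formal.smul_apply, mul_left_comm _ c, ← Finset.mul_sum]; ring)

theorem cycPrimitive_mem_pos (f : PowSer I K) : cycPrimitive τ f ∈ pos I K := by
  change -(_ * ∑ k ∈ Finset.range 0, _) = (0 : K)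
  rw [Finset.sum_range_zero, mul_zero, neg_zero]

/-- `1 - N / n` factors through `1 - z`, because `∑_{k < n} k (z^{k+1} - z^k) = n - N` on
`W^{⊗n}`. -/
theorem one_sub_cyc_cycPrimitive (f : PowSer I K) :
    (1 - cyc K τ) (cycPrimitive τ f) = f - cycAvg τ f := by
  ext u
  by_cases hu : u = []
  · subst hu
    rw [LinearMap.sub_apply, Formal.sub_apply, Formal.sub_apply, cyc_nil, cycAvg_nil, sub_self]
    exact sub_self _
  set n := u.length with hn
  have h1 : (1 - cyc K τ) (cycPrimitive τ f) u = (1 - cyc K τ)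
      (-(algebraMap ℚ K (n : ℚ)⁻¹ • ∑ k ∈ Finset.range n, (k : K) • (cyc K τ ^ k) f)) u := by
    refine (lenPres_one_sub_cyc τ).eq fun v hv => ?_
    rw [Formal.neg_apply, Formal.smul_apply, Formal.sum_apply]
    simp only [Formal.smul_apply, hn, ← hv]
    rfl
  have h2 : ∀ n : ℕ, (1 - cyc K τ) (∑ k ∈ Finset.range n, (k : K) • (cyc K τ ^ k) f)
      + (n : K) • (cyc K τ ^ n) f = (∑ k ∈ Finset.range n, (cyc K τ ^ (k + 1)) f) := fun n => by
    induction n with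
    | zero => simp
    | succ n ih =>
      rw [Finset.sum_range_succ, Finset.sum_range_succ, ← ih, map_add, map_smul,
        LinearMap.sub_apply _ _ ((cyc K τ ^ n) f), Module.End.one_apply,
        ← Module.End.mul_apply, ← pow_succ', Nat.cast_succ]
      module
  have h3 : (∑ k ∈ Finset.range n, (cyc K τ ^ (k + 1)) f) u = normOp K τ f u := by
    rw [← normOp_cyc τ f, normOp_apply, Formal.sum_apply]
    simp only [pow_succ, Module.End.mul_apply, ← hn]
  have h4 := congrArg (fun g : PowSer I K => g u) (h2 n)
  simp only [Formal.add_apply, Formal.smul_apply, h3] at h4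
  rw [hn, cyc_pow_length, ← hn] at h4
  rw [h1, map_neg, map_smul, Formal.neg_apply, Formal.smul_apply, Formal.sub_apply,
    cycAvg_of_ne τ f hu, eq_sub_of_add_eq h4, mul_sub, hn, inv_length_mul hu]
  ring

theorem cycAvg_of_mem_commutators {f : PowSer I K} (hf : f ∈ commutators K τ) :
    cycAvg τ f = 0 := by
  obtain ⟨h1, h2⟩ := normOp_of_mem_commutators τ hf
  ext u
  by_cases hu : u = []
  · subst hu
    exact h1
  · rw [cycAvg_of_ne τ f hu, LinearMap.mem_ker.1 h2, Formal.zero_apply, mul_zero]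

/-- The 0-forms vanishing at zero are the cyclic coinvariants. -/
theorem commutators_eq_map : commutators K τ = (pos I K).map (1 - cyc K τ) := by
  refine le_antisymm (fun f hf => ?_) ?_
  · refine ⟨cycPrimitive τ f, cycPrimitive_mem_pos τ f, ?_⟩
    rw [one_sub_cyc_cycPrimitive, cycAvg_of_mem_commutators τ hf, sub_zero]
  · rintro _ ⟨f, hf, rfl⟩
    exact one_sub_cyc_mem_commutators τ hf

theorem mkQ_cycAvg (f : PowSer I K) :
    (commutators K τ).mkQ (cycAvg τ f) = (commutators K τ).mkQ f := by
  rw [eq_comm, ← sub_eq_zero, ← map_sub, ← one_sub_cyc_cycPrimitive, Submodule.mkQ_apply,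
    Submodule.Quotient.mk_eq_zero]
  exact one_sub_cyc_mem_commutators τ (cycPrimitive_mem_pos τ f)

/-- The section of `T̂W → DR⁰(T̂W)` whose image is the module of cyclic invariants. -/
def zeroFormsLift : ZeroForms K τ →ₗ[K] PowSer I K :=
  (commutators K τ).liftQ (cycAvg τ) fun _ hf => cycAvg_of_mem_commutators τ hf

theorem mkQ_zeroFormsLift (x : ZeroForms K τ) :
    (commutators K τ).mkQ (zeroFormsLift τ x) = x := by
  obtain ⟨f, rfl⟩ := (commutators K τ).mkQ_surjective x
  exact mkQ_cycAvg τ f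

theorem continuous_zeroFormsLift : Continuous (zeroFormsLift (K := K) τ) :=
  Continuous.quotient_lift (continuous_cycAvg τ) _

end Coinvariants

/-! ### Direct products -/

section DirectProduct

/-- A criterion for direct products of subgroups of a retract `M` of a module of formal linear
combinations: the projections onto the factors are given, the elements of all factors but finitely
many vanish at any given coordinate, and membership in `A` is implied by conditions on the single
coordinates which the elements of the factors satisfy. -/
theorem isDirectProduct_of_projections {X K M ι : Type*} [DecidableEq ι] [CommRing K]
    [AddCommGroup M] [TopologicalSpace M] [IsTopologicalAddGroup M]
    {A : AddSubgroup M} {S : ι → AddSubgroup M}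
    (lift : M →+ Formal X K) (hlift : Continuous lift)
    (proj : Formal X K →+ M) (hproj : Continuous proj) (hpl : ∀ x, proj (lift x) = x)
    (π : ι → M →+ M) (hπ : ∀ j, Continuous (π j)) (hmem : ∀ j, ∀ x ∈ A, π j x ∈ S j)
    (horth : ∀ j k, ∀ y ∈ S j, π k y = if k = j then y else 0)
    (hsum : ∀ x ∈ A, HasSum (fun j => π j x) x)
    (F : X → Finset ι) (hF : ∀ p, ∀ j ∉ F p, ∀ y ∈ S j, lift y p = 0)
    (B : X → AddSubgroup K) (hB : ∀ j, ∀ y ∈ S j, ∀ p, lift y p ∈ B p)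
    (hA : ∀ f : Formal X K, (∀ p, f p ∈ B p) → proj f ∈ A) :
    IsDirectProduct A S := by
  have hinj : Function.Injective lift := Function.LeftInverse.injective (g := proj) hpl
  have hT2 : T2Space M := T2Space.of_injective_continuous hinj hlift
  -- `c y` is the coordinatewise finite sum of the lifts of the `y j`
  let c : (∀ j, S j) → Formal X K := fun y p => ∑ j ∈ F p, lift (y j : M) p
  have hc : ∀ y, HasSum (fun j => (y j : M)) (proj (c y)) := fun y => by
    have h : HasSum (fun j => lift (y j : M)) (c y) := Formal.hasSum fun p =>
      ⟨F p, fun j hj => hF p j hj _ (y j).2, rfl⟩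
    have h' := h.map proj hproj
    simpa only [Function.comp_def, hpl] using h'
  -- each coordinate of `c y` is a finite sum of continuous functions of `y`
  have hcont : Continuous c := by
    let _ : TopologicalSpace K := ⊥
    have _ : DiscreteTopology K := ⟨rfl⟩
    refine Formal.continuous_iff.2 fun p => continuous_finsetSum _ fun j _ => ?_
    exact (Formal.continuous_eval p).comp
      (hlift.comp (continuous_subtype_val.comp (continuous_apply j)))
  have hcA : ∀ y, proj (c y) ∈ A := fun y =>
    hA _ fun p => sum_mem fun j _ => hB j _ (y j).2 p
  refine ⟨
    { toFun := fun y => ⟨proj (c y), hcA y⟩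
      invFun := fun x j => ⟨π j x, hmem j x x.2⟩
      left_inv := fun y => ?_
      right_inv := fun x => Subtype.ext ((hc _).unique (hsum x x.2))
      map_add' := fun x y => Subtype.ext ((hc (x + y)).unique ((hc x).add (hc y)))
      continuous_toFun := (hproj.comp hcont).subtype_mk _
      continuous_invFun := continuous_pi fun j =>
        ((hπ j).comp continuous_subtype_val).subtype_mk _ }, hc⟩
  funext k
  refine Subtype.ext (((hc y).map (π k) (hπ k)).unique ?_)
  have h := hasSum_single (f := fun j => π k (y j : M)) k fun j hj => by
    rw [horth j k _ (y j).2, if_neg (Ne.symm hj)]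
  rw [horth k k _ (y k).2, if_pos rfl] at h
  exact h

end DirectProduct

/-! ### Graded pieces -/

section Columns

variable {I K : Type*} [CommRing K] {𝒜 : ℤ → AddSubgroup K} {τ : I → ℤ}

theorem one_sub_cyc_mem_column {n : ℤ} {f : PowSer I K} (hf : f ∈ column 𝒜 τ n) :
    (1 - cyc K τ) f ∈ column 𝒜 τ n :=
  sub_mem hf ⟨cyc_mem_pos τ hf.1, cyc_mem_homog hf.2⟩

theorem normOp_mem_column {n : ℤ} {f : PowSer I K} (hf : f ∈ column 𝒜 τ n) :
    normOp K τ f ∈ column 𝒜 τ n :=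
  ⟨normOp_mem_pos τ f, normOp_mem_homog hf.2⟩

theorem CInftyStructure.bPrime_mem_column {d : I → ℤ} (m : CInftyStructure 𝒜 d)
    {n : ℤ} {f : PowSer I K} (hf : f ∈ column 𝒜 (dualDeg d) n) :
    m.bPrime f ∈ column 𝒜 (dualDeg d) (n + 1) :=
  ⟨m.bPrime_mem_pos f, m.bPrime_mem_homog hf.2⟩

theorem CInftyStructure.b_mem_column {d : I → ℤ} (m : CInftyStructure 𝒜 d)
    {n : ℤ} {f : PowSer I K} (hf : f ∈ column 𝒜 (dualDeg d) n) :
    m.b f ∈ column 𝒜 (dualDeg d) (n + 1) :=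
  ⟨m.b_mem_pos f, m.b_mem_homog hf.2⟩

variable [Algebra ℚ K] [GradedRing 𝒜]

/-- Rational numbers have degree zero, because projections to graded pieces are `ℚ`-linear. -/
theorem algebraMap_mul_mem (q : ℚ) {n : ℤ} {x : K} (hx : x ∈ 𝒜 n) :
    algebraMap ℚ K q * x ∈ 𝒜 n := by
  have h1 : GradedRing.proj 𝒜 n x = x := by
    rw [GradedRing.proj_apply, DirectSum.decompose_of_mem_same 𝒜 hx]
  have h2 := map_rat_smul (GradedRing.proj 𝒜 n) q x
  rw [h1, Algebra.smul_def] at h2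
  rw [← h2, GradedRing.proj_apply]
  exact SetLike.coe_mem _

theorem aeval_shuffleOp_mem_homog (q : ℚ[X]) {n : ℤ} {f : PowSer I K} (hf : f ∈ homog 𝒜 τ n) :
    aeval (shuffleOp K τ) (q.map (algebraMap ℚ K)) f ∈ homog 𝒜 τ n := by
  induction q using Polynomial.induction_on' with
  | add p q hp hq =>
    rw [Polynomial.map_add, map_add, LinearMap.add_apply]
    exact add_mem hp hq
  | monomial k a =>
    rw [map_monomial, aeval_monomial, Module.End.mul_apply, Module.algebraMap_end_apply]
    have h : ((shuffleOp K τ) ^ k) f ∈ homog 𝒜 τ n := by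
      induction k with
      | zero => exact hf
      | succ k ih => rw [pow_succ', Module.End.mul_apply]; exact shuffleOp_mem_homog ih
    exact fun u => algebraMap_mul_mem a (h u)

theorem hodgeProj_mem_homog (j : ℕ) {n : ℤ} {f : PowSer I K} (hf : f ∈ homog 𝒜 τ n) :
    hodgeProj τ j f ∈ homog 𝒜 τ n := fun u =>
  aeval_shuffleOp_mem_homog (lagrangePoly u.length j) hf u

theorem hodgeProjTilde_mem_homog (j : ℕ) {n : ℤ} {f : PowSer I K} (hf : f ∈ homog 𝒜 τ n) :
    hodgeProjTilde τ j f ∈ homog 𝒜 τ n := fun u => by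
  match u with
  | [] => exact zero_mem _
  | i :: w =>
    rw [hodgeProjTilde_apply]
    refine mem_of_eq (hodgeProj_mem_homog (n := n - τ i) j (fun v => ?_) w) ?_
    · exact mem_of_eq (hf (i :: v)) (by rw [wdeg_cons]; ring)
    · rw [wdeg_cons]; ring

theorem cycAvg_mem_homog {n : ℤ} {f : PowSer I K} (hf : f ∈ homog 𝒜 τ n) :
    cycAvg τ f ∈ homog 𝒜 τ n := fun u => by
  by_cases hu : u = []
  · subst hu
    exact hf []
  · rw [cycAvg_of_ne τ f hu]
    exact algebraMap_mul_mem _ (normOp_mem_homog hf u)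

theorem hodgeProj_mem_column (j : ℕ) {n : ℤ} {f : PowSer I K} (hf : f ∈ column 𝒜 τ n) :
    hodgeProj τ j f ∈ column 𝒜 τ n :=
  ⟨hodgeProj_mem_pos τ hf.1 j, hodgeProj_mem_homog j hf.2⟩

theorem hodgeProjTilde_mem_column (j : ℕ) {n : ℤ} {f : PowSer I K} (hf : f ∈ column 𝒜 τ n) :
    hodgeProjTilde τ j f ∈ column 𝒜 τ n :=
  ⟨hodgeProjTilde_mem_pos τ j f, hodgeProjTilde_mem_homog j hf.2⟩

theorem cycAvg_mem_column {n : ℤ} {f : PowSer I K} (hf : f ∈ column 𝒜 τ n) :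
    cycAvg τ f ∈ column 𝒜 τ n :=
  ⟨hf.1, cycAvg_mem_homog hf.2⟩

/-- `Q_j` is the `2^j`-eigenspace of `s`. -/
theorem mem_hodgeQ {j : ℕ} {n : ℤ} {f : PowSer I K} :
    f ∈ hodgeQ 𝒜 τ j n ↔ f ∈ column 𝒜 τ n ∧ shuffleOp K τ f = (2 : K) ^ j • f := by
  constructor
  · rintro ⟨g, hg, rfl⟩
    exact ⟨hodgeProj_mem_column j hg, shuffleOp_hodgeProj τ j g⟩
  · rintro ⟨hf, hs⟩
    exact ⟨f, hf, (hodgeProj_of_eigen τ hs j).trans (if_pos rfl)⟩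

/-- `Q̃_j` is the `2^j`-eigenspace of `1 ⊗̂ s`. -/
theorem mem_hodgeQTilde {j : ℕ} {n : ℤ} {f : PowSer I K} :
    f ∈ hodgeQTilde 𝒜 τ j n
      ↔ f ∈ column 𝒜 τ n ∧ oneTensor (shuffleOp K τ) f = (2 : K) ^ j • f := by
  constructor
  · rintro ⟨g, hg, rfl⟩
    exact ⟨hodgeProjTilde_mem_column j hg, oneTensor_hodgeProjTilde τ j g⟩
  · rintro ⟨hf, hs⟩
    exact ⟨f, hf, (hodgeProjTilde_of_eigen τ hf.1 hs j).trans (if_pos rfl)⟩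

theorem one_sub_cyc_mem_hodgeQ {j : ℕ} {n : ℤ} {f : PowSer I K} (hf : f ∈ hodgeQTilde 𝒜 τ j n) :
    (1 - cyc K τ) f ∈ hodgeQ 𝒜 τ j n := by
  rw [mem_hodgeQTilde] at hf
  rw [mem_hodgeQ, shuffleOp_one_sub_cyc τ hf.1.1, hf.2, map_smul]
  exact ⟨one_sub_cyc_mem_column hf.1, rfl⟩

theorem hodgeQ_zero (n : ℤ) : hodgeQ (K := K) 𝒜 τ 0 n = ⊥ := by
  refine (AddSubgroup.eq_bot_iff_forall _).2 fun f hf => ?_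
  rw [mem_hodgeQ] at hf
  exact eigen_zero τ hf.1.1 hf.2

/-- `N` lowers the Hodge weight by one, since `N s = 2 s̃ N`. -/
theorem normOp_mem_hodgeQTilde {j : ℕ} {n : ℤ} {f : PowSer I K}
    (hf : f ∈ hodgeQ 𝒜 τ (j + 1) n) : normOp K τ f ∈ hodgeQTilde 𝒜 τ j n := by
  rw [mem_hodgeQ] at hf
  rw [mem_hodgeQTilde]
  refine ⟨normOp_mem_column hf.1, ?_⟩
  have h := normOp_shuffleOp τ hf.1.1
  rw [hf.2, map_smul, pow_succ', mul_smul] at h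
  ext u
  have h' := congrArg (fun g : PowSer I K => g u) h
  simp only [Formal.smul_apply] at h'
  refine (natCast_mul_cancel (n := 2) two_ne_zero ?_).symm
  rw [Nat.cast_ofNat, Formal.smul_apply]
  exact h'

variable {d : I → ℤ} (m : CInftyStructure 𝒜 d)

theorem CInftyStructure.bPrime_mem_hodgeQ (h𝒜 : ∀ n, Odd n → 𝒜 n = ⊥) {j : ℕ} {n : ℤ}
    {f : PowSer I K} (hf : f ∈ hodgeQ 𝒜 (dualDeg d) j n) :
    m.bPrime f ∈ hodgeQ 𝒜 (dualDeg d) j (n + 1) := by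
  rw [mem_hodgeQ] at hf ⊢
  refine ⟨m.bPrime_mem_column hf.1, ?_⟩
  rw [m.shuffleOp_bPrime h𝒜, hf.2, map_smul]

theorem CInftyStructure.b_mem_hodgeQTilde (h𝒜 : ∀ n, Odd n → 𝒜 n = ⊥) {j : ℕ} {n : ℤ}
    {f : PowSer I K} (hf : f ∈ hodgeQTilde 𝒜 (dualDeg d) j n) :
    m.b f ∈ hodgeQTilde 𝒜 (dualDeg d) j (n + 1) := by
  rw [mem_hodgeQTilde] at hf ⊢
  refine ⟨m.b_mem_column hf.1, ?_⟩
  rw [m.shuffleOp_b h𝒜 hf.1.1, hf.2, map_smul]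

end Columns

/-! ### The Tsygan bicomplex -/

section Tsygan

variable {I K : Type*} [CommRing K] [Algebra ℚ K] {𝒜 : ℤ → AddSubgroup K} [GradedRing 𝒜]
  {d : I → ℤ} (m : CInftyStructure 𝒜 d)

theorem CInftyStructure.isBicomplex_tsygan (h𝒜 : ∀ n, Odd n → 𝒜 n = ⊥) :
    IsBicomplex (tsygan 𝒜 (dualDeg d)) m.tsyganV (tsyganH K (dualDeg d)) := by
  intro p q x hx
  change x ∈ column 𝒜 (dualDeg d) q at hx
  by_cases hp : Even p
  · have hp' : ¬Even (p + 1) := by simpa [Nat.even_add_one] using hp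
    simp only [tsyganV, tsyganH, if_pos hp, if_neg hp']
    refine ⟨m.b_mem_column hx, one_sub_cyc_mem_column hx, m.b_b h𝒜 hx.1,
      normOp_one_sub_cyc _ x, ?_⟩
    rw [add_comm]
    exact m.one_sub_cyc_b h𝒜 hx.1
  · have hp' : Even (p + 1) := by simpa [Nat.even_add_one] using hp
    simp only [tsyganV, tsyganH, if_neg hp, if_pos hp']
    exact ⟨m.bPrime_mem_column hx, normOp_mem_column hx, m.bPrime_bPrime h𝒜 x,
      one_sub_cyc_normOp _ x, m.b_normOp h𝒜 x⟩

theorem CInftyStructure.isSubbicomplex_strip (h𝒜 : ∀ n, Odd n → 𝒜 n = ⊥) (j : ℕ) :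
    IsSubbicomplex (strip 𝒜 (dualDeg d) j) (tsygan 𝒜 (dualDeg d)) m.tsyganV
      (tsyganH K (dualDeg d)) := by
  intro p q
  obtain ⟨k, rfl | rfl⟩ := Nat.even_or_odd' p
  · have h1 : Even (2 * k) := even_two_mul k
    have h2 : ¬Even (2 * k + 1) := by simp
    have h3 : (2 * k + 1) / 2 = k := by omega
    have h4 : 2 * k / 2 = k := by omega
    simp only [strip, tsyganV, tsyganH, tsygan, if_pos h1, if_neg h2, h3, h4]
    by_cases hk : k ≤ j
    · simp only [if_pos hk]
      refine ⟨fun f hf => (mem_hodgeQTilde.1 hf).1, fun f hf =>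
        ⟨m.b_mem_hodgeQTilde h𝒜 hf, ?_⟩⟩
      have h := one_sub_cyc_mem_hodgeQ hf
      split_ifs with hk'
      · exact h
      · rwa [show j - k = 0 by omega, hodgeQ_zero] at h
    · simp only [if_neg hk, if_neg (show ¬k < j by omega)]
      refine ⟨bot_le, fun f hf => ?_⟩
      rw [AddSubgroup.mem_bot] at hf
      rw [hf, map_zero, map_zero]
      exact ⟨zero_mem _, zero_mem _⟩
  · have h1 : ¬Even (2 * k + 1) := by simp
    have h2 : Even (2 * k + 1 + 1) := ⟨k + 1, by ring⟩
    have h3 : (2 * k + 1) / 2 = k := by omega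
    have h4 : (2 * k + 1 + 1) / 2 = k + 1 := by omega
    simp only [strip, tsyganV, tsyganH, tsygan, if_neg h1, if_pos h2, h3, h4]
    by_cases hk : k < j
    · simp only [if_pos hk, if_pos (show k + 1 ≤ j by omega)]
      refine ⟨fun f hf => (mem_hodgeQ.1 hf).1, fun f hf =>
        ⟨m.bPrime_mem_hodgeQ h𝒜 hf, ?_⟩⟩
      rw [show j - k = j - (k + 1) + 1 by omega] at hf
      exact normOp_mem_hodgeQTilde hf
    · simp only [if_neg hk, if_neg (show ¬k + 1 ≤ j by omega)]
      refine ⟨bot_le, fun f hf => ?_⟩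
      rw [AddSubgroup.mem_bot] at hf
      rw [hf, map_zero, map_zero]
      exact ⟨zero_mem _, zero_mem _⟩

end Tsygan

/-! ### The Hodge decompositions -/

section Decomposition

variable {I K : Type*} [CommRing K] {𝒜 : ℤ → AddSubgroup K} {τ : I → ℤ}

/-- The condition on the coefficient of the word `u` of the elements of `column 𝒜 τ n`. -/
def columnCoeff (𝒜 : ℤ → AddSubgroup K) (τ : I → ℤ) (n : ℤ) (u : List I) : AddSubgroup K :=
  if u = [] then ⊥ else 𝒜 (n + 1 - wdeg τ u)

theorem mem_column_iff {n : ℤ} {f : PowSer I K} :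
    f ∈ column 𝒜 τ n ↔ ∀ u, f u ∈ columnCoeff 𝒜 τ n u := by
  constructor
  · intro hf u
    unfold columnCoeff
    split_ifs with hu
    · rw [hu]
      exact hf.1
    · exact hf.2 u
  · intro hf
    have h0 : f [] = 0 := hf []
    refine ⟨h0, fun u => ?_⟩
    by_cases hu : u = []
    · rw [hu, h0]
      exact zero_mem _
    · have h := hf u
      rwa [columnCoeff, if_neg hu] at h

/-- Locally finite families of orthogonal projections give direct product decompositions; the family
of factors may be shifted. -/
theorem isDirectProduct_column {n : ℤ} {E : ℕ → Module.End K (PowSer I K)}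
    (hc : ∀ j, Continuous (E j)) (hmem : ∀ j, ∀ f ∈ column 𝒜 τ n, E j f ∈ column 𝒜 τ n)
    (horth : ∀ j k, ∀ f ∈ column 𝒜 τ n, E k (E j f) = if k = j then E j f else 0)
    (hsum : ∀ f ∈ column 𝒜 τ n, HasSum (fun j => E j f) f)
    (hlen : ∀ j f (u : List I), u.length < j → E j f u = 0) (k : ℕ) :
    IsDirectProduct (column 𝒜 τ n)
      (fun j => if k ≤ j then (column 𝒜 τ n).map (E (j - k)).toAddMonoidHom else ⊥) := by
  refine isDirectProduct_of_projections (AddMonoidHom.id _) continuous_id (AddMonoidHom.id _)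
    continuous_id (fun _ => rfl) (fun j => if k ≤ j then (E (j - k)).toAddMonoidHom else 0)
    (fun j => ?_) (fun j f hf => ?_) (fun j l y hy => ?_) (fun f hf => ?_)
    (fun u => Finset.range (u.length + k + 1)) (fun u j hj y hy => ?_) (columnCoeff 𝒜 τ n)
    (fun j y hy => ?_) (fun f hf => mem_column_iff.2 hf)
  · split_ifs
    · exact hc _
    · exact continuous_zero
  · split_ifs
    · exact ⟨f, hf, rfl⟩
    · exact zero_mem _
  · by_cases hk : k ≤ j
    · rw [if_pos hk] at hy
      obtain ⟨f, hf, rfl⟩ := hy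
      have h := horth (j - k) (l - k) f hf
      by_cases hl : k ≤ l
      · rw [if_pos hl]
        refine h.trans ?_
        simp only [show l - k = j - k ↔ l = j by omega]
        rfl
      · rw [if_neg hl, if_neg (by omega)]
        rfl
    · rw [if_neg hk, AddSubgroup.mem_bot] at hy
      rw [hy, map_zero, ite_self]
  · refine ((add_left_injective k).hasSum_iff fun j hj => ?_).1 ?_
    · rw [if_neg]
      · rfl
      · exact fun hk => hj ⟨j - k, Nat.sub_add_cancel hk⟩
    · simpa [Function.comp_def] using hsum f hf
  · by_cases hk : k ≤ j
    · rw [if_pos hk] at hy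
      obtain ⟨f, hf, rfl⟩ := hy
      exact hlen _ f u (by simp only [Finset.mem_range] at hj; omega)
    · rw [if_neg hk, AddSubgroup.mem_bot] at hy
      rw [hy]
      rfl
  · refine mem_column_iff.1 ?_
    by_cases hk : k ≤ j
    · rw [if_pos hk] at hy
      obtain ⟨f, hf, rfl⟩ := hy
      exact hmem _ f hf
    · rw [if_neg hk, AddSubgroup.mem_bot] at hy
      rw [hy]
      exact zero_mem _

theorem CInftyStructure.isComplex_cyclicCochains [GradedRing 𝒜] {d : I → ℤ}
    (m : CInftyStructure 𝒜 d) (h𝒜 : ∀ n, Odd n → 𝒜 n = ⊥)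
    (hb : commutators K (dualDeg d) ≤ (commutators K (dualDeg d)).comap m.bPrime) :
    IsComplex (cyclicCochains 𝒜 (dualDeg d)) (onZeroForms hb) := by
  rintro n _ ⟨f, hf, rfl⟩
  refine ⟨⟨m.bPrime f, m.bPrime_mem_column hf, rfl⟩, ?_⟩
  change (commutators K (dualDeg d)).mkQ (m.bPrime (m.bPrime f)) = 0
  rw [m.bPrime_bPrime h𝒜, map_zero]

variable [Algebra ℚ K]

/-- `e(j)` descends to the cyclic coinvariants, as `e(j) (1 - z) = (1 - z) ẽ(j)`. -/
theorem commutators_le_comap_hodgeProj (j : ℕ) :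
    commutators K τ ≤ (commutators K τ).comap (hodgeProj τ j) := by
  intro f hf
  rw [commutators_eq_map] at hf
  obtain ⟨g, hg, rfl⟩ := hf
  rw [Submodule.mem_comap, hodgeProj_one_sub_cyc τ j hg]
  exact one_sub_cyc_mem_commutators τ (hodgeProjTilde_mem_pos τ j g)

variable [GradedRing 𝒜]

theorem isDirectProduct_hodgeQ (n : ℤ) (k : ℕ) : IsDirectProduct (column 𝒜 τ n)
    (fun j => if k ≤ j then hodgeQ 𝒜 τ (j - k) n else ⊥) :=
  isDirectProduct_column (continuous_hodgeProj τ) (fun j _ hf => hodgeProj_mem_column j hf)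
    (fun j k f _ => hodgeProj_hodgeProj τ j k f) (fun f _ => hasSum_hodgeProj τ f)
    (fun _ f _ hu => hodgeProj_of_lt τ f hu) k

theorem isDirectProduct_hodgeQTilde (n : ℤ) (k : ℕ) : IsDirectProduct (column 𝒜 τ n)
    (fun j => if k ≤ j then hodgeQTilde 𝒜 τ (j - k) n else ⊥) :=
  isDirectProduct_column (continuous_hodgeProjTilde τ)
    (fun j _ hf => hodgeProjTilde_mem_column j hf)
    (fun j k f _ => hodgeProjTilde_of_eigen τ (hodgeProjTilde_mem_pos τ j f)
      (oneTensor_hodgeProjTilde τ j f) k)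
    (fun _ hf => hasSum_hodgeProjTilde τ hf.1) (fun _ f _ hu => hodgeProjTilde_of_lt τ f hu) k

theorem isDirectProduct_strip (p : ℕ) (q : ℤ) :
    IsDirectProduct (tsygan 𝒜 τ p q) (fun j => strip 𝒜 τ j p q) := by
  by_cases hp : Even p
  · simp only [strip, if_pos hp]
    exact isDirectProduct_hodgeQTilde q (p / 2)
  · have h : (fun j => strip 𝒜 τ j p q)
        = fun j => if p / 2 ≤ j then hodgeQ 𝒜 τ (j - p / 2) q else ⊥ := by
      funext j
      rw [strip, if_neg hp]
      -- in column `p`, the two conditions differ at `j = p / 2`, where `Q_0 = 0`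
      rcases lt_trichotomy (p / 2) j with hj | hj | hj
      · rw [if_pos hj, if_pos hj.le]
      · rw [if_neg (by omega), if_pos hj.le, show j - p / 2 = 0 by omega, hodgeQ_zero]
      · rw [if_neg (by omega), if_neg (by omega)]
    rw [h]
    exact isDirectProduct_hodgeQ q (p / 2)

/-- `b'` descends to the cyclic coinvariants, as `b' (1 - z) = -(1 - z) b`. -/
theorem CInftyStructure.commutators_le_comap_bPrime {d : I → ℤ} (m : CInftyStructure 𝒜 d)
    (h𝒜 : ∀ n, Odd n → 𝒜 n = ⊥) :
    commutators K (dualDeg d) ≤ (commutators K (dualDeg d)).comap m.bPrime := by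
  intro f hf
  rw [commutators_eq_map] at hf
  obtain ⟨g, hg, rfl⟩ := hf
  rw [Submodule.mem_comap, eq_neg_of_add_eq_zero_right (m.one_sub_cyc_b h𝒜 hg)]
  exact neg_mem (one_sub_cyc_mem_commutators _ (m.b_mem_pos g))

theorem CInftyStructure.isSubcomplex_map_hodgeProj {d : I → ℤ} (m : CInftyStructure 𝒜 d)
    (h𝒜 : ∀ n, Odd n → 𝒜 n = ⊥)
    (hb : commutators K (dualDeg d) ≤ (commutators K (dualDeg d)).comap m.bPrime) (j : ℕ)
    (he : commutators K (dualDeg d)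
      ≤ (commutators K (dualDeg d)).comap (hodgeProj (dualDeg d) j)) :
    IsSubcomplex (fun n => (cyclicCochains 𝒜 (dualDeg d) n).map (onZeroForms he))
      (cyclicCochains 𝒜 (dualDeg d)) (onZeroForms hb) := by
  intro n
  constructor
  · rintro _ ⟨_, ⟨f, hf, rfl⟩, rfl⟩
    exact ⟨hodgeProj (dualDeg d) j f, hodgeProj_mem_column j hf, rfl⟩
  · rintro _ ⟨_, ⟨f, hf, rfl⟩, rfl⟩
    obtain ⟨g, hg, hgf⟩ := m.bPrime_mem_hodgeQ h𝒜 (j := j) ⟨f, hf, rfl⟩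
    exact ⟨_, ⟨g, hg, rfl⟩, congrArg (commutators K (dualDeg d)).mkQ hgf⟩

theorem isDirectProduct_cyclicCochains
    (he : ∀ j : {j : ℕ // 1 ≤ j}, commutators K τ ≤ (commutators K τ).comap (hodgeProj τ j))
    (n : ℤ) : IsDirectProduct (cyclicCochains 𝒜 τ n)
      (fun j => (cyclicCochains 𝒜 τ n).map (onZeroForms (he j))) := by
  refine isDirectProduct_of_projections (zeroFormsLift τ).toAddMonoidHom
    (continuous_zeroFormsLift τ) (commutators K τ).mkQ.toAddMonoidHom (continuous_mkQ τ)
    (mkQ_zeroFormsLift τ) (fun j => onZeroForms (he j)) (fun j => ?_)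
    (fun j x hx => ⟨x, hx, rfl⟩) ?_ ?_
    (fun u => (Finset.range (u.length + 1)).subtype (1 ≤ ·)) ?_ (columnCoeff 𝒜 τ n) ?_
    (fun f hf => ⟨f, mem_column_iff.2 hf, rfl⟩)
  · exact Continuous.quotient_lift ((continuous_mkQ τ).comp (continuous_hodgeProj τ j)) _
  · rintro j k _ ⟨_, ⟨f, hf, rfl⟩, rfl⟩
    change (commutators K τ).mkQ (hodgeProj τ k (hodgeProj τ j f))
      = if k = j then (commutators K τ).mkQ (hodgeProj τ j f) else 0
    simp only [hodgeProj_hodgeProj, Subtype.coe_inj]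
    split_ifs
    · rfl
    · exact map_zero _
  · rintro _ ⟨f, hf, rfl⟩
    have h : HasSum (fun j : {j : ℕ // 1 ≤ j} => hodgeProj τ j f) f := by
      refine (Subtype.val_injective.hasSum_iff fun j hj => ?_).2 (hasSum_hodgeProj τ f)
      have hj0 : j = 0 := by
        by_contra hne
        exact hj ⟨⟨j, Nat.one_le_iff_ne_zero.2 hne⟩, rfl⟩
      rw [hj0, hodgeProj_zero τ hf.1]
    exact h.map (commutators K τ).mkQ (continuous_mkQ τ)
  · rintro u j hj _ ⟨_, ⟨f, hf, rfl⟩, rfl⟩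
    change cycAvg τ (hodgeProj τ j f) u = 0
    refine lenPres_cycAvg τ u.length _ (fun v hv => hodgeProj_of_lt τ f ?_) u rfl
    rw [Finset.mem_subtype, Finset.mem_range] at hj
    omega
  · rintro j _ ⟨_, ⟨f, hf, rfl⟩, rfl⟩
    exact mem_column_iff.1 (cycAvg_mem_column (hodgeProj_mem_column j hf))

end Decomposition

end HodgeCyclic

end

theorem mainTheorem2 {I K : Type*} [CommRing K] [Algebra ℚ K]
    (𝒜 : ℤ → AddSubgroup K) [GradedRing 𝒜] (h𝒜 : ∀ n, Odd n → 𝒜 n = ⊥)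
    (d : I → ℤ) (m : CInftyStructure 𝒜 d) :
    -- part (i); the first clause identifies the 0-forms vanishing at zero with cyclic coinvariants
    (commutators K (dualDeg d) = (pos I K).map (1 - cyc K (dualDeg d)) ∧
      ∃ (hb : commutators K (dualDeg d) ≤ (commutators K (dualDeg d)).comap m.bPrime)
        (he : ∀ j : {j : ℕ // 1 ≤ j},
          commutators K (dualDeg d) ≤ (commutators K (dualDeg d)).comap (hodgeProj (dualDeg d) j)),
        IsComplex (cyclicCochains 𝒜 (dualDeg d)) (onZeroForms hb) ∧
        (∀ j, IsSubcomplex (fun n => (cyclicCochains 𝒜 (dualDeg d) n).map (onZeroForms (he j)))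
          (cyclicCochains 𝒜 (dualDeg d)) (onZeroForms hb)) ∧
        ∀ n, IsDirectProduct (cyclicCochains 𝒜 (dualDeg d) n)
          (fun j => (cyclicCochains 𝒜 (dualDeg d) n).map (onZeroForms (he j)))) ∧
    -- part (ii)
    (IsBicomplex (tsygan 𝒜 (dualDeg d)) m.tsyganV (tsyganH K (dualDeg d)) ∧
      (∀ j, IsSubbicomplex (strip 𝒜 (dualDeg d) j) (tsygan 𝒜 (dualDeg d)) m.tsyganV
        (tsyganH K (dualDeg d))) ∧
      ∀ p q, IsDirectProduct (tsygan 𝒜 (dualDeg d) p q) (fun j => strip 𝒜 (dualDeg d) j p q)) := by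
  refine ⟨⟨commutators_eq_map _, m.commutators_le_comap_bPrime h𝒜,
    fun j => commutators_le_comap_hodgeProj j, m.isComplex_cyclicCochains h𝒜 _,
    fun j => m.isSubcomplex_map_hodgeProj h𝒜 _ j _, isDirectProduct_cyclicCochains _⟩,
    m.isBicomplex_tsygan h𝒜, m.isSubbicomplex_strip h𝒜, isDirectProduct_strip⟩
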